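/- **Nets.** A linear $3$-periodic net in $\mathbb R^3$ is a pair $\mathcal N=(N,S)$, where $S$ is a countable set of line segments $[p,q]$, $p\neq q$ (the edges), any two different ones meeting at most in a common endpoint, $N$ (the nodes) is the set of endpoints of the edges, and there is a basis $\underline a$ of $\mathbb R^3$ such that $N$ and $S$ are invariant under, and split into finitely many orbits of, the translation group generated by $\underline a$; such a basis is called a periodicity basis. The body $|\mathcal N|$ is the union of the edges. Two such nets $\mathcal N_0,\mathcal N_1$ are *periodically isotopic* if there are linear $3$-periodic nets $\mathcal N_t$ $(0\le t\le 1)$ starting at $\mathcal N_0$ and ending at $\mathcal N_1$, a continuous path $t\mapsto\underline a^t$ of bases such that $\underline a^t$ is a right-handed periodicity basis of $\mathcal N_t$, and bijections $f_t:|\mathcal N_0|\to|\mathcal N_t|$ mapping nodes to nodes, with $f_0=\mathrm{id}$, with $t\mapsto f_t(p)$ continuous for each node $p$ of $\mathcal N_0$, and mapping each edge $[p,q]$ of $\mathcal N_0$ affinely onto the edge $[f_t(p),f_t(q)]$ of $\mathcal N_t$. **Graph knots.** A linear graph knot in the flat torus $\mathbb T^3=\mathbb R^3/\mathbb Z^3$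 is a pair $K=(N,S)$ of a finite set $N$ of nodes and a finite set $S$ of edges, where each edge is the image of a nondegenerate line segment of $\mathbb R^3$ whose endpoints map to (possibly equal) nodes and whose interior is mapped injectively and avoids the nodes, and where different edges meet only in nodes. Its body $|K|$ is the union of its nodes and edges. Linear graph knots $K_0,K_1$ are *linearly isotopic* if there are linear graph knots $K_t=(N_t,S_t)$ $(0\le t\le1)$ starting at $K_0$ and ending at $K_1$, and continuous bijections $f_t:|K_0|\to|K_t|$ with $f_0=\mathrm{id}$, $f_t(N_0)=N_t$, $f_t(S_0)=S_t$, such that $t\mapsto f_t(p)$ is continuous for each $p\in|K_0|$. They are *rotationally isotopic* if $K_1$ is linearly isotopic to $X_\pi K_0$ for some rotation matrix $X\in SL(3,\mathbb Z)\cap SO(3)$, where $X_\pi$ is the automorphism of $\mathbb T^3$ induced by $X$. **Grids.** The model net $\mathcal M_{\rm pcu}$ has node set $\mathbb Z^3$ and edges $[k,k+e_j]$, $k\in\mathbb Z^3$, $j=1,2,3$. For $n\ge1$, an *$n$-grid* is a linear $3$-periodic net that is the union of $n$ pairwise disjoint translates of $\mathcal M_{\rm pcu}$. Its standard linear graph knot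 is its image in $\mathbb T^3$ under the quotient map $\mathbb R^3\to\mathbb T^3$. **Patterns.** Let $T=\{1,\dots,n\}^3$, viewed as a discrete torus, and let $\mathcal X(n)$ be the set of $n$-element subsets of $T$ any two distinct points of which differ in all three coordinates. The group $C_n^3$ acts on $T$ by cyclic shifts of the coordinates, and the group $R$ of the $24$ rotations of the cube acts on $T$ by permuting the coordinates and applying $i\mapsto n+1-i$ to some of them. Let $\alpha(n)$ be the number of orbits in $\mathcal X(n)$ under $C_n^3$, and $\beta(n)$ the number of orbits under the group generated by $C_n^3$ and $R$. **Theorem.** Let $n\ge 1$. Linear isotopy and rotational isotopy are equivalence relations on the set of standard linear graph knots of $n$-grids, periodic isotopy is an equivalence relation on the set of $n$-grids, and: (i) the number of linear isotopy classes of standard linear graph knots of $n$-grids is $\alpha(n)$; (ii) the number of rotational isotopy classes of standard linear graph knots of $n$-grids is $\beta(n)$; (iii) the number of periodic isotopy classes of $n$-grids is $\beta(n)$. -/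

import Mathlib

open scoped Pointwise unitInterval

noncomputable section

/-- Three-dimensional real space. Only its topology and its affine structure are used. -/
abbrev Space3 : Type := Fin 3 → ℝ

/-- The flat `3`-torus `ℝ³ / ℤ³`, whose points are represented by `[0,1)³`. -/
abbrev Torus3 : Type := Fin 3 → UnitAddCircle

/-- A pair `(N, S)` of a set of nodes and a set of edges, the edges being subsets of the space. -/
@[ext]
structure LineNet (X : Type) where
  nodes : Set X
  edges : Set (Set X)

namespace LineNet

/-- The body `|(N, S)|`. -/
def body {X : Type} (K : LineNet X) : Set X := K.nodes ∪ ⋃₀ K.edges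

/-- The image of a net under a map, edge by edge. -/
def map {X Y : Type} (g : X → Y) (K : LineNet X) : LineNet Y where
  nodes := g '' K.nodes
  edges := (fun e => g '' e) '' K.edges

/-- The union of a family of nets. -/
def iUnion {X ι : Type} (K : ι → LineNet X) : LineNet X where
  nodes := ⋃ i, (K i).nodes
  edges := ⋃ i, (K i).edges

end LineNet

/-! ### Linear 3-periodic nets and periodic isotopy -/

/-- The basis `a` of `ℝ³` is a periodicity basis of `K`: nodes and edges are invariant under the
translation group generated by `a`, and fall into finitely many orbits under this group. -/
def IsPeriodicityBasis (K : LineNet Space3) (a : Module.Basis (Fin 3) ℝ Space3) : Prop :=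
  (∀ i, K.map (fun x => x + a i) = K) ∧
  (∃ F : Set Space3, F.Finite ∧
    ∀ x ∈ K.nodes, ∃ k : Fin 3 → ℤ, x + ∑ i, (k i : ℝ) • a i ∈ F) ∧
  (∃ F : Set (Set Space3), F.Finite ∧
    ∀ e ∈ K.edges, ∃ k : Fin 3 → ℤ, (fun x => x + ∑ i, (k i : ℝ) • a i) '' e ∈ F)

/-- A basis of `ℝ³` with positive orientation. -/
def RightHanded (a : Module.Basis (Fin 3) ℝ Space3) : Prop :=
  0 < Matrix.det (Matrix.of fun i j => a i j)

/-- A (proper) linear `3`-periodic net in `ℝ³`: the edges form a countable set of nondegenerate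
line segments, two different edges meet at most in a common endpoint, the nodes are the endpoints
of the edges, and there is a periodicity basis. -/
structure IsLinearPeriodicNet (K : LineNet Space3) : Prop where
  countable : K.edges.Countable
  isSegment : ∀ e ∈ K.edges, ∃ p q : Space3, p ≠ q ∧ e = segment ℝ p q
  essentiallyDisjoint : ∀ p q p' q' : Space3,
    segment ℝ p q ∈ K.edges → segment ℝ p' q' ∈ K.edges → segment ℝ p q ≠ segment ℝ p' q' →
      segment ℝ p q ∩ segment ℝ p' q' ⊆ {p, q} ∩ {p', q'}
  nodes_eq : K.nodes = {p | ∃ q, segment ℝ p q ∈ K.edges}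
  periodic : ∃ a : Module.Basis (Fin 3) ℝ Space3, IsPeriodicityBasis K a

/-- Periodic isotopy of linear `3`-periodic nets: a path `K t` of such nets from `K₀` to `K₁`, a
continuous path `a t` of right-handed periodicity bases, and bijections `f t` from the body of `K₀`
to the body of `K t` which start at the identity, map nodes to nodes, map each edge affinely onto
an edge, and move every node continuously. -/
def PeriodicallyIsotopic (K₀ K₁ : LineNet Space3) : Prop :=
  ∃ (K : I → LineNet Space3) (a : I → Module.Basis (Fin 3) ℝ Space3) (f : I → Space3 → Space3),
    K 0 = K₀ ∧ K 1 = K₁ ∧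
    (∀ t, IsLinearPeriodicNet (K t)) ∧
    (∀ t, IsPeriodicityBasis (K t) (a t)) ∧
    (∀ t, RightHanded (a t)) ∧
    (∀ i, Continuous fun t => a t i) ∧
    (∀ t, Set.BijOn (f t) K₀.body (K t).body) ∧
    (∀ t, Set.MapsTo (f t) K₀.nodes (K t).nodes) ∧
    Set.EqOn (f 0) id K₀.body ∧
    (∀ p ∈ K₀.nodes, Continuous fun t => f t p) ∧
    (∀ t p q, segment ℝ p q ∈ K₀.edges →
      segment ℝ (f t p) (f t q) ∈ (K t).edges ∧
      ∀ s ∈ Set.Icc (0 : ℝ) 1,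
        f t (AffineMap.lineMap p q s) = AffineMap.lineMap (f t p) (f t q) s)

/-! ### Linear graph knots in the flat torus and linear isotopy -/

/-- The quotient map `ℝ³ → ℝ³ / ℤ³` precomposed with the linear map taking the basis `a` to the
standard basis. -/
def torusProj (a : Module.Basis (Fin 3) ℝ Space3) (x : Space3) : Torus3 :=
  fun i => ((a.repr x i : ℝ) : UnitAddCircle)

/-- The standard basis of `ℝ³`. -/
abbrev standardBasis : Module.Basis (Fin 3) ℝ Space3 := Pi.basisFun ℝ (Fin 3)

/-- The linear graph knot of a net with respect to a periodicity basis. -/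
def lgk (K : LineNet Space3) (a : Module.Basis (Fin 3) ℝ Space3) : LineNet Torus3 :=
  K.map (torusProj a)

/-- A linear graph knot in the flat torus: finitely many nodes and edges, each edge is a flat torus
line segment joining nodes, without self-crossing and with no node in its interior (the two
endpoints may coincide in the torus), and different edges meet only in nodes. -/
structure IsLinearGraphKnot (K : LineNet Torus3) : Prop where
  finite_nodes : K.nodes.Finite
  finite_edges : K.edges.Finite
  isSegment : ∀ e ∈ K.edges, ∃ p q : Space3, p ≠ q ∧
    e = torusProj standardBasis '' segment ℝ p q ∧
    torusProj standardBasis p ∈ K.nodes ∧ torusProj standardBasis q ∈ K.nodes ∧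
    Set.InjOn (torusProj standardBasis) (openSegment ℝ p q) ∧
    Disjoint (torusProj standardBasis '' openSegment ℝ p q) K.nodes
  essentiallyDisjoint : ∀ e ∈ K.edges, ∀ e' ∈ K.edges, e ≠ e' → e ∩ e' ⊆ K.nodes

/-- Linear isotopy: a path `K t` of linear graph knots from `K₀` to `K₁`, with continuous bijections
`f t` of bodies, starting at the identity, respecting nodes and edges, and moving every point of
the body continuously. -/
def LinearlyIsotopic (K₀ K₁ : LineNet Torus3) : Prop :=
  ∃ (K : I → LineNet Torus3) (f : I → Torus3 → Torus3),
    K 0 = K₀ ∧ K 1 = K₁ ∧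
    (∀ t, IsLinearGraphKnot (K t)) ∧
    (∀ t, Set.BijOn (f t) K₀.body (K t).body) ∧
    (∀ t, ContinuousOn (f t) K₀.body) ∧
    Set.EqOn (f 0) id K₀.body ∧
    (∀ t, f t '' K₀.nodes = (K t).nodes) ∧
    (∀ t, (fun e => f t '' e) '' K₀.edges = (K t).edges) ∧
    (∀ p ∈ K₀.body, Continuous fun t => f t p)

/-- An integer matrix which is a rotation. These are the `24` rotational symmetries of the cube. -/
def IsIntegerRotation (X : Matrix (Fin 3) (Fin 3) ℤ) : Prop :=
  X * X.transpose = 1 ∧ X.det = 1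

/-- The automorphism of the flat torus induced by an integer matrix. -/
def torusAut (X : Matrix (Fin 3) (Fin 3) ℤ) (y : Torus3) : Torus3 :=
  fun i => ∑ j, X i j • y j

/-- Linear isotopy up to a rotation automorphism of the flat torus. -/
def RotationallyIsotopic (K₀ K₁ : LineNet Torus3) : Prop :=
  ∃ X : Matrix (Fin 3) (Fin 3) ℤ, IsIntegerRotation X ∧
    LinearlyIsotopic K₁ (K₀.map (torusAut X))

/-! ### Multigrids -/

/-- The model net `pcu`: nodes at the integer points, and all axial edges of unit length. -/
def pcuNet : LineNet Space3 where
  nodes := {x | ∃ k : Fin 3 → ℤ, x = fun i => (k i : ℝ)}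
  edges := {e | ∃ (k : Fin 3 → ℤ) (j : Fin 3),
    e = segment ℝ (fun i => (k i : ℝ)) ((fun i => (k i : ℝ)) + Pi.single j 1)}

/-- An `n`-grid: a linear `3`-periodic net which is the union of `n` disjoint translates of the
model net `pcu`. -/
def IsNGrid (n : ℕ) (K : LineNet Space3) : Prop :=
  IsLinearPeriodicNet K ∧
  ∃ p : Fin n → Space3,
    Pairwise (fun i j =>
      Disjoint (pcuNet.map (fun x => x + p i)).body (pcuNet.map (fun x => x + p j)).body) ∧
    K = LineNet.iUnion fun i => pcuNet.map (fun x => x + p i)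

/-- The set of `n`-grids. -/
abbrev NGrid (n : ℕ) : Type := {K : LineNet Space3 // IsNGrid n K}

/-- The set of standard linear graph knots of `n`-grids. -/
abbrev StandardKnot (n : ℕ) : Type :=
  {K : LineNet Torus3 // ∃ N : LineNet Space3, IsNGrid n N ∧ K = lgk N standardBasis}

/-! ### Patterns in the discrete torus -/

/-- The discrete torus `{1, …, n}³`, the coordinates being read modulo `n` (for `n ≥ 1`). -/
abbrev DTorus (n : ℕ) : Type := Fin 3 → ZMod n

/-- The patterns of `n` points in the discrete torus with distinct coordinates. -/
def patterns (n : ℕ) : Set (Finset (DTorus n)) :=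
  {P | P.card = n ∧ ∀ p ∈ P, ∀ q ∈ P, p ≠ q → ∀ i, p i ≠ q i}

/-- The cyclic shifts of the coordinates, forming the group `C_n × C_n × C_n`. -/
def shiftSet (n : ℕ) : Set (Equiv.Perm (DTorus n)) :=
  {g | ∃ v : DTorus n, ∀ x, g x = x + v}

/-- The rotations of the cube `{1, …, n}³`. In each row of `X` one entry is `1` or `-1` and the
others are zero; an entry `1` in column `j` gives the new coordinate `x j`, and an entry `-1` gives
the new coordinate `n + 1 - x j`, which is `1 - x j` modulo `n`. -/
def rotationSet (n : ℕ) : Set (Equiv.Perm (DTorus n)) :=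
  {g | ∃ X : Matrix (Fin 3) (Fin 3) ℤ, IsIntegerRotation X ∧
    ∀ x i, g x i = ∑ j, (X i j : ZMod n) * x j + (((1 - ∑ j, X i j) / 2 : ℤ) : ZMod n)}

/-- The number of orbits of patterns under a group of permutations of the discrete torus. -/
def numOrbits (n : ℕ) (G : Subgroup (Equiv.Perm (DTorus n))) : ℕ :=
  ((fun P : Finset (DTorus n) => MulAction.orbit G P) '' patterns n).ncard

/-- The number of orbits of patterns under coordinate shifts. -/
def alphaCount (n : ℕ) : ℕ := numOrbits n (Subgroup.closure (shiftSet n))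

/-- The number of orbits of patterns under coordinate shifts and cube rotations. -/
def betaCount (n : ℕ) : ℕ := numOrbits n (Subgroup.closure (shiftSet n ∪ rotationSet n))

end

/-! An `n`-grid is a union of lattice frames based at `n` points whose coordinates are pairwise
distinct modulo 1 (`isNGrid_iff`). All three counts rest on one invariant: the integers `⌊p i c - p
j c⌋`, up to relabelling and integer translations of the points (`SameOrder`). It amounts to a
cyclic order of the points in each coordinate. The ranks `∑ k, ⌊p i c - p k c⌋`, read modulo `n`,
turn it into a pattern up to shifts (`sameOrder_iff`, `exists_pattern_eq`), and rotations of space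
act on ranks as rotations of the cube (`rankVec_rotConfig`).

Equal invariants give an isotopy: in the straight motion of the points every coordinate difference
stays in one open unit interval, so components never meet. For periodic isotopy this is combined
with a path of matrices of positive determinant from the identity to a rotation.

For the converse in the torus, each moving edge is a closed loop at its node, hence a translate of
the image of a rational line, and there are only countably many such directions. By Sierpinski's
theorem (`eq_of_isClosed_fibers`) an interval is not a disjoint union of countably many, but more
than one, nonempty closed sets. So the directions never change, the grid stays axial, different
nodes keep different coordinates, and the floors of the lifted differences are constant.

For the converse in space the intermediate nets need not be axial. Sierpinski's theorem now shows
that the period translations act on the labels of nodes independently of time. At the end each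
component is therefore mapped by a signed permutation matrix, the same for all components, and a
rotation because the bases are right-handed. Once this rotation is undone along a path, the floors
are protected by linking: after a normalization, two unit squares from two components are linked at
the start, and would be unlinked at the end if a floor had changed (`floor_eq_of_lattice_isotopy`).
Linking is measured by half the solid angle of one square as seen from a point running along the
other, the argument of a trace of Pauli matrices that vanishes only if the curves meet
(`phase_ne_zero`). A nonzero winding number of this loop means that it has no closed logarithm. -/

/-! ### Countable partitions of the unit interval into closed sets -/

/-- A preconnected space meeting a set and its complement meets the frontier of the set. -/
theorem exists_mem_frontier_of_isPreconnected {X : Type*} [TopologicalSpace X] {U F : Set X}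
    (hU : IsPreconnected U) {x y : X} (hx : x ∈ U) (hxF : x ∈ F) (hy : y ∈ U) (hyF : y ∉ F) :
    ∃ z ∈ U, z ∈ frontier F := by
  by_contra! h
  have h1 : U ⊆ interior F ∪ (closure F)ᶜ := by
    intro z hz
    by_cases hz' : z ∈ closure F
    · left
      by_contra h2
      exact h z hz ⟨hz', h2⟩
    · exact Or.inr hz'
  have hxi : x ∈ interior F := by
    rcases h1 hx with h2 | h2
    · exact h2
    · exact absurd (subset_closure hxF) h2
  have hyi : y ∈ (closure F)ᶜ := by
    rcases h1 hy with h2 | h2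
    · exact absurd (interior_subset h2) hyF
    · exact h2
  obtain ⟨z, -, hz1, hz2⟩ := hU _ _ isOpen_interior isClosed_closure.isOpen_compl h1
    ⟨x, hx, hxi⟩ ⟨y, hy, hyi⟩
  exact hz2 (subset_closure (interior_subset hz1))

/-- A function on the unit interval with countable range and closed fibers is constant. -/
theorem eq_of_isClosed_fibers {β : Type*} (g : I → β) (hc : (Set.range g).Countable)
    (hcl : ∀ t, IsClosed {s | g s = g t}) (t s : I) : g t = g s := by
  by_contra hts
  have : Countable (Set.range g) := hc.to_subtype
  set F : Set.range g → Set I := fun b => {s | g s = b.1} with hF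
  have hFcl : ∀ b, IsClosed (F b) := by
    rintro ⟨_, ⟨t, rfl⟩⟩
    exact hcl t
  -- `B` is the union of the frontiers of the fibers. If `g` is not constant it is nonempty, and as
  -- a compact space covered by countably many closed traces of fibers it is subject to Baire's
  -- theorem.
  set B : Set I := (⋃ b, interior (F b))ᶜ with hB
  have hBcl : IsClosed B := (isOpen_iUnion fun b => isOpen_interior).isClosed_compl
  have frontier_sub : ∀ b, frontier (F b) ⊆ B := by
    intro b z hz hz'
    obtain ⟨c, hc⟩ := Set.mem_iUnion.1 hz'
    have hzF : z ∈ F b := (hFcl b).frontier_subset hz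
    have hzc : z ∈ F c := interior_subset hc
    have hbc : b = c := Subtype.ext (hzF.symm.trans hzc)
    subst hbc
    exact hz.2 hc
  have hBne : B.Nonempty := by
    obtain ⟨z, -, hz⟩ := exists_mem_frontier_of_isPreconnected (U := Set.univ)
      (F := F ⟨g t, t, rfl⟩) isPreconnected_univ (Set.mem_univ t) rfl (Set.mem_univ s)
      (fun h => hts h.symm)
    exact ⟨z, frontier_sub _ hz⟩
  have : Nonempty B := hBne.to_subtype
  have : CompactSpace B := isCompact_iff_compactSpace.1 hBcl.isCompact
  obtain ⟨b, x, hx⟩ := nonempty_interior_of_iUnion_of_closed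
    (f := fun b : Set.range g => ((↑) : B → I) ⁻¹' F b)
    (fun b => (hFcl b).preimage continuous_subtype_val) (by
      ext x
      simp only [Set.mem_iUnion, Set.mem_univ, iff_true]
      exact ⟨⟨g x, x.1, rfl⟩, rfl⟩)
  rw [mem_interior_iff_mem_nhds, mem_nhds_subtype] at hx
  obtain ⟨u, hu, hsub⟩ := hx
  obtain ⟨ε, hε, hball⟩ := Metric.mem_nhds_iff.1 hu
  have hUpre : IsPreconnected (Metric.ball x.1 ε) := by
    have : Metric.ball x.1 ε = ((↑) : I → ℝ) ⁻¹' Metric.ball (x.1 : ℝ) ε := rfl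
    rw [this, Real.ball_eq_Ioo]
    exact (Set.ordConnected_Ioo.preimage_mono (Subtype.mono_coe _)).isPreconnected
  have hBF : ∀ z ∈ Metric.ball x.1 ε, z ∈ B → z ∈ F b := fun z hz hzB =>
    hsub (a := ⟨z, hzB⟩) (hball hz)
  have hxb : x.1 ∈ F b := hBF _ (Metric.mem_ball_self hε) x.2
  have hxint : x.1 ∉ interior (F b) := fun h => x.2 (Set.mem_iUnion.2 ⟨b, h⟩)
  -- Inside the ball, `B` lies in the single fiber `F b`. Another fiber entering the ball has a
  -- frontier point there; this point is in `B`, hence in both fibers.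
  obtain ⟨y, hy, hyb⟩ : ∃ y ∈ Metric.ball x.1 ε, y ∉ F b := by
    by_contra! h
    exact hxint (mem_interior.2 ⟨_, h, Metric.isOpen_ball, Metric.mem_ball_self hε⟩)
  obtain ⟨z, hz, hzf⟩ := exists_mem_frontier_of_isPreconnected (F := F ⟨g y, y, rfl⟩) hUpre hy rfl
    (Metric.mem_ball_self hε) (fun h => hyb (h.symm.trans hxb))
  have h1 : z ∈ F b := hBF z hz (frontier_sub _ hzf)
  have h2 : g z = g y := (hFcl _).frontier_subset hzf
  exact hyb (h2.symm.trans h1)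

/-! ### Configurations of points and their patterns -/

/-- The points of a configuration differ pairwise in all coordinates, even modulo one. -/
def IsGeneric {n : ℕ} (p : Fin n → Space3) : Prop :=
  ∀ i j, i ≠ j → ∀ (c : Fin 3) (m : ℤ), p i c - p j c ≠ m

/-- Two configurations agree up to a relabelling, integer translations of the points, and
motions which do not change the integer parts of coordinate differences. -/
def SameOrder {n : ℕ} (p p' : Fin n → Space3) : Prop :=
  ∃ (τ : Equiv.Perm (Fin n)) (k : Fin n → Fin 3 → ℤ), ∀ i j c,
    ⌊p i c - p j c⌋ = ⌊(p' (τ i) c + k i c) - (p' (τ j) c + k j c)⌋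

theorem SameOrder.refl {n : ℕ} (p : Fin n → Space3) : SameOrder p p :=
  ⟨1, 0, by simp⟩

theorem SameOrder.symm {n : ℕ} {p p' : Fin n → Space3} (h : SameOrder p p') : SameOrder p' p := by
  obtain ⟨τ, k, h⟩ := h
  refine ⟨τ.symm, fun i => -k (τ.symm i), fun i j c => ?_⟩
  have h1 := h (τ.symm i) (τ.symm j) c
  simp only [Equiv.apply_symm_apply] at h1
  have e1 : p (τ.symm i) c + ((-k (τ.symm i)) c : ℤ) - (p (τ.symm j) c + ((-k (τ.symm j)) c : ℤ))
    = (p (τ.symm i) c - p (τ.symm j) c) - ((k (τ.symm i) c - k (τ.symm j) c : ℤ) : ℝ) := by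
    simp only [Pi.neg_apply]; push_cast; ring
  have e2 : p' i c - p' j c = (p' i c + k (τ.symm i) c - (p' j c + k (τ.symm j) c)) -
      ((k (τ.symm i) c - k (τ.symm j) c : ℤ) : ℝ) := by
    push_cast; ring
  rw [e1, e2, Int.floor_sub_intCast, Int.floor_sub_intCast, h1]

/-- The rank vector of a point of a configuration. -/
noncomputable def rankVec {n : ℕ} (p : Fin n → Space3) (i : Fin n) (c : Fin 3) : ℤ :=
  ∑ k, ⌊p i c - p k c⌋

theorem floor_neg_of_ne_intCast {x : ℝ} (hx : ∀ m : ℤ, x ≠ m) : ⌊-x⌋ = -⌊x⌋ - 1 := by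
  rw [Int.floor_eq_iff]
  have h1 := Int.floor_le x
  have h2 := Int.lt_floor_add_one x
  have h3 := lt_of_le_of_ne h1 (Ne.symm (hx ⌊x⌋))
  push_cast
  constructor <;> linarith

/-- With `d` the floor, each summand of the rank difference is `d` or `d + 1`. The term `k = i` is
`d + 1`, by genericity, and the term `k = j` is `d`, so both inequalities are strict. -/
theorem rankVec_bounds {n : ℕ} {p : Fin n → Space3} (hp : IsGeneric p) {i j : Fin n} (hij : i ≠ j)
    (c : Fin 3) :
    n * ⌊p i c - p j c⌋ < rankVec p i c - rankVec p j c ∧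
      rankVec p i c - rankVec p j c < n * (⌊p i c - p j c⌋ + 1) := by
  set d := ⌊p i c - p j c⌋ with hd
  have hle := Int.floor_le (p i c - p j c)
  have hlt := Int.lt_floor_add_one (p i c - p j c)
  have hneg : ⌊p j c - p i c⌋ = -d - 1 := by
    rw [hd, ← floor_neg_of_ne_intCast (hp i j hij c), neg_sub]
  have e1 : (n : ℤ) * d = ∑ _k : Fin n, d := by simp
  have e2 : (n : ℤ) * (d + 1) = ∑ _k : Fin n, (d + 1) := by simp
  have lower : ∀ k, d ≤ ⌊p i c - p k c⌋ - ⌊p j c - p k c⌋ := by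
    intro k
    have h1 : d + ⌊p j c - p k c⌋ ≤ ⌊p i c - p k c⌋ := by
      rw [Int.le_floor]
      have := Int.floor_le (p j c - p k c)
      push_cast; linarith
    linarith
  have upper : ∀ k, ⌊p i c - p k c⌋ - ⌊p j c - p k c⌋ ≤ d + 1 := by
    intro k
    have h1 : ⌊p i c - p k c⌋ < d + 1 + (⌊p j c - p k c⌋ + 1) := by
      rw [Int.floor_lt]
      have := Int.lt_floor_add_one (p j c - p k c)
      push_cast; linarith
    linarith
  rw [e1, e2, rankVec, rankVec, ← Finset.sum_sub_distrib]
  refine ⟨Finset.sum_lt_sum (fun k _ => lower k) ⟨i, Finset.mem_univ _, ?_⟩,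
    Finset.sum_lt_sum (fun k _ => upper k) ⟨j, Finset.mem_univ _, ?_⟩⟩
  · simp only [sub_self, Int.floor_zero, hneg]; linarith
  · simp only [sub_self, Int.floor_zero]; linarith

/-- Passing to ranks loses nothing: by `rankVec_bounds`, division by `n` recovers every floor. -/
theorem rankVec_sub_ediv {n : ℕ} {p : Fin n → Space3} (hp : IsGeneric p) (i j : Fin n)
    (c : Fin 3) : (rankVec p i c - rankVec p j c) / n = ⌊p i c - p j c⌋ := by
  have hn : (0 : ℤ) < n := by exact_mod_cast i.pos
  by_cases hij : i = j
  · simp [hij]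
  · obtain ⟨h1, h2⟩ := rankVec_bounds hp hij c
    rw [Int.ediv_eq_iff_of_pos hn]
    constructor <;> nlinarith

/-- The point of the discrete torus given by the rank vector. -/
noncomputable def rankPt {n : ℕ} (p : Fin n → Space3) (i : Fin n) : DTorus n :=
  fun c => (rankVec p i c : ZMod n)

theorem rankPt_apply_ne {n : ℕ} {p : Fin n → Space3} (hp : IsGeneric p) {i j : Fin n}
    (hij : i ≠ j) (c : Fin 3) : rankPt p i c ≠ rankPt p j c := by
  intro h
  have hn : (0 : ℤ) < n := by exact_mod_cast i.pos
  rw [rankPt, rankPt, eq_comm, ZMod.intCast_eq_intCast_iff_dvd_sub] at h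
  obtain ⟨m, hm⟩ := h
  obtain ⟨h1, h2⟩ := rankVec_bounds hp hij c
  rw [hm] at h1 h2
  have h3 := lt_of_mul_lt_mul_left h1 hn.le
  have h4 := lt_of_mul_lt_mul_left h2 hn.le
  omega

theorem rankPt_injective {n : ℕ} {p : Fin n → Space3} (hp : IsGeneric p) :
    Function.Injective (rankPt p) := by
  intro i j h
  by_contra hij
  exact rankPt_apply_ne hp hij 0 (congrFun h 0)

open Classical in
/-- The pattern of a configuration. -/
noncomputable def pattern {n : ℕ} (p : Fin n → Space3) : Finset (DTorus n) :=
  Finset.univ.image (rankPt p)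

theorem mem_pattern {n : ℕ} {p : Fin n → Space3} {x : DTorus n} :
    x ∈ pattern p ↔ ∃ i, rankPt p i = x := by
  simp [pattern]

theorem pattern_mem {n : ℕ} {p : Fin n → Space3} (hp : IsGeneric p) : pattern p ∈ patterns n := by
  refine ⟨?_, ?_⟩
  · rw [pattern, Finset.card_image_of_injective _ (rankPt_injective hp)]; simp
  · intro x hx y hy hxy c
    obtain ⟨i, rfl⟩ := mem_pattern.1 hx
    obtain ⟨j, rfl⟩ := mem_pattern.1 hy
    exact rankPt_apply_ne hp (fun h => hxy (by rw [h])) c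

/-- Translating the points by integers `k i` changes the ranks by `n * k i - ∑ j, k j`, which modulo
`n` is one shift for all points. Conversely, a shift between the patterns matches the points, and
the `k i` are the quotients by `n` in the lifted congruences; the lift of the shift cancels in
differences. -/
theorem sameOrder_iff {n : ℕ} {p p' : Fin n → Space3} (hp : IsGeneric p) (hp' : IsGeneric p') :
    SameOrder p p' ↔ ∃ v : DTorus n, ∀ x, x ∈ pattern p ↔ x + v ∈ pattern p' := by
  constructor
  · rintro ⟨τ, k, h⟩
    have key : ∀ i c, rankVec p i c = rankVec p' (τ i) c + n * k i c - ∑ j, k j c := by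
      intro i c
      have e : ∀ j, ⌊p i c - p j c⌋ = ⌊p' (τ i) c - p' (τ j) c⌋ + (k i c - k j c) := by
        intro j
        rw [h i j c, ← Int.floor_add_intCast]
        congr 1; push_cast; ring
      simp only [rankVec, e, Finset.sum_add_distrib, Finset.sum_sub_distrib]
      rw [Equiv.sum_comp τ (fun j => ⌊p' (τ i) c - p' j c⌋)]
      simp
      ring
    have key2 : ∀ i, rankPt p i + (fun c => ((∑ j, k j c : ℤ) : ZMod n)) = rankPt p' (τ i) := by
      intro i
      funext c
      simp only [rankPt, Pi.add_apply, key]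
      push_cast
      simp
    refine ⟨fun c => ((∑ j, k j c : ℤ) : ZMod n), fun x => ?_⟩
    rw [mem_pattern, mem_pattern]
    constructor
    · rintro ⟨i, rfl⟩
      exact ⟨τ i, (key2 i).symm⟩
    · rintro ⟨i, hi⟩
      refine ⟨τ.symm i, add_right_cancel (b := fun c => ((∑ j, k j c : ℤ) : ZMod n)) ?_⟩
      rw [key2, ← hi]; simp
  · rintro ⟨v, hv⟩
    have h1 : ∀ i, ∃ j, rankPt p' j = rankPt p i + v := fun i =>
      mem_pattern.1 ((hv _).1 (mem_pattern.2 ⟨i, rfl⟩))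
    choose τ hτ using h1
    have hinj : Function.Injective τ := by
      intro i j hij
      have := hτ i
      rw [hij, hτ j] at this
      exact (rankPt_injective hp (add_right_cancel this)).symm
    have hb : Function.Bijective τ := Finite.injective_iff_bijective.1 hinj
    have h2 : ∀ i c, ∃ m : ℤ, rankVec p i c + (v c).cast = rankVec p' (τ i) c + n * m := by
      intro i c
      have h3 := congrFun (hτ i) c
      simp only [rankPt, Pi.add_apply] at h3
      have h4 : ((rankVec p' (τ i) c : ℤ) : ZMod n) = ((rankVec p i c + (v c).cast : ℤ) : ZMod n) := by
        rw [h3]; push_cast; simp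
      rw [ZMod.intCast_eq_intCast_iff_dvd_sub] at h4
      obtain ⟨m, hm⟩ := h4
      exact ⟨m, by linarith⟩
    choose k hk using h2
    refine ⟨Equiv.ofBijective τ hb, k, fun i j c => ?_⟩
    have hn : (n : ℤ) ≠ 0 := by
      have := i.pos
      omega
    have e1 : (p' (τ i) c + k i c) - (p' (τ j) c + k j c)
        = (p' (τ i) c - p' (τ j) c) + ((k i c - k j c : ℤ) : ℝ) := by push_cast; ring
    simp only [Equiv.ofBijective_apply]
    rw [e1, Int.floor_add_intCast, ← rankVec_sub_ediv hp, ← rankVec_sub_ediv hp',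
      ← Int.add_mul_ediv_left _ _ hn]
    congr 1
    linarith [hk i c, hk j c]

/-- The differences `z i - z k` run once through all residues, so the sum does not depend on `i`. -/
theorem sum_emod_sub {n : ℕ} [NeZero n] (z : Fin n → ℤ)
    (hz : Function.Injective fun i => (z i : ZMod n)) (i : Fin n) :
    ∑ k, (z i - z k) % n = ∑ m : ZMod n, (m.val : ℤ) := by
  have hinj : Function.Injective fun k => ((z i - z k : ℤ) : ZMod n) := by
    intro k l h
    apply hz
    simpa using h
  have hb : Function.Bijective fun k => ((z i - z k : ℤ) : ZMod n) := by
    rw [Fintype.bijective_iff_injective_and_card]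
    exact ⟨hinj, by simp⟩
  rw [← (Equiv.ofBijective _ hb).sum_comp]
  refine Finset.sum_congr rfl fun k _ => ?_
  rw [Equiv.ofBijective_apply, ZMod.val_intCast]

/-- Every pattern is, up to a shift, the pattern of a configuration. -/
theorem exists_pattern_eq {n : ℕ} (hn : 1 ≤ n) {P : Finset (DTorus n)} (hP : P ∈ patterns n) :
    ∃ p : Fin n → Space3, IsGeneric p ∧
      ∃ v : DTorus n, ∀ x, x ∈ P ↔ x + v ∈ pattern p := by
  have : NeZero n := ⟨by omega⟩
  obtain ⟨e⟩ : Nonempty (Fin n ≃ P) := ⟨(Fintype.equivFinOfCardEq (by simp [hP.1])).symm⟩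
  have hn0 : (n : ℝ) ≠ 0 := by exact_mod_cast NeZero.ne n
  -- The configuration realizing `P` consists of the representatives in `0, …, n - 1` of its points,
  -- divided by `n`.
  set z : Fin n → Fin 3 → ℤ := fun i c => ((e i).1 c).val with hzdef
  have hz : ∀ i c, ((z i c : ℤ) : ZMod n) = (e i).1 c := by intro i c; simp [hzdef]
  have hinj : ∀ c, Function.Injective fun i => (z i c : ZMod n) := by
    intro c i j h
    by_contra hij
    simp only [hz] at h
    exact hP.2 _ (e i).2 _ (e j).2 (fun h' => hij (e.injective (Subtype.ext h'))) c h
  have hfl : ∀ i j c, ⌊(z i c : ℝ) / n - z j c / n⌋ = (z i c - z j c) / n := by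
    intro i j c
    rw [← sub_div, ← Int.cast_sub, Int.floor_div_natCast, Int.floor_intCast]
  -- The right-hand side is independent of `i`: in each coordinate the ranks differ from `z` by a
  -- constant, which becomes the shift.
  have hr : ∀ i c, n * (rankVec (fun i c => (z i c : ℝ) / n) i c - z i c)
      = - ∑ k, z k c - ∑ m : ZMod n, (m.val : ℤ) := by
    intro i c
    have h1 : ∀ k, n * ((z i c - z k c) / n) = z i c - z k c - (z i c - z k c) % n := fun k => by
      linarith [Int.emod_add_mul_ediv (z i c - z k c) n]
    simp only [rankVec, hfl]
    rw [mul_sub, Finset.mul_sum, Finset.sum_congr rfl fun k _ => h1 k, Finset.sum_sub_distrib,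
      sum_emod_sub (fun i => z i c) (hinj c), Finset.sum_sub_distrib]
    simp
    ring
  refine ⟨fun i c => z i c / n, ?_, ?_⟩
  · intro i j hij c m h
    apply hij
    apply hinj c
    have h1 : (z i c - z j c : ℝ) = n * m := by
      field_simp at h
      linarith
    have h2 : z i c - z j c = n * m := by exact_mod_cast h1
    have h3 : z i c = z j c + n * m := by linarith
    simp [h3]
  · set p : Fin n → Space3 := fun i c => z i c / n with hpdef
    let i₀ : Fin n := ⟨0, by omega⟩
    have hc : ∀ i c, rankVec p i c = z i c + (rankVec p i₀ c - z i₀ c) := by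
      intro i c
      have h1 := (hr i c).trans (hr i₀ c).symm
      have h2 := mul_left_cancel₀ (by exact_mod_cast NeZero.ne n) h1
      linarith
    have hpt : ∀ i, rankPt p i = (e i).1 + fun c => ((rankVec p i₀ c - z i₀ c : ℤ) : ZMod n) := by
      intro i
      funext c
      rw [rankPt, hc, Int.cast_add, hz]
      rfl
    refine ⟨fun c => ((rankVec p i₀ c - z i₀ c : ℤ) : ZMod n), fun x => ?_⟩
    rw [mem_pattern]
    constructor
    · intro hx
      exact ⟨e.symm ⟨x, hx⟩, by rw [hpt]; simp⟩
    · rintro ⟨i, hi⟩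
      rw [hpt] at hi
      rw [← add_right_cancel hi]
      exact (e i).2

/-! ### Orbits of patterns -/

open Matrix in
/-- The action of an integer matrix on configurations. -/
def rotConfig {n : ℕ} (X : Matrix (Fin 3) (Fin 3) ℤ) (p : Fin n → Space3) : Fin n → Space3 :=
  fun i => (X.map (Int.cast : ℤ → ℝ)) *ᵥ p i

theorem IsIntegerRotation.one : IsIntegerRotation 1 := by
  constructor <;> simp

theorem IsIntegerRotation.mul {X Y : Matrix (Fin 3) (Fin 3) ℤ} (hX : IsIntegerRotation X)
    (hY : IsIntegerRotation Y) : IsIntegerRotation (X * Y) := by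
  refine ⟨?_, by simp [hX.2, hY.2]⟩
  rw [Matrix.transpose_mul, Matrix.mul_assoc, ← Matrix.mul_assoc Y, hY.1, Matrix.one_mul, hX.1]

theorem IsIntegerRotation.transpose {X : Matrix (Fin 3) (Fin 3) ℤ} (hX : IsIntegerRotation X) :
    IsIntegerRotation X.transpose :=
  ⟨by rw [Matrix.transpose_transpose]; exact mul_eq_one_comm.1 hX.1, by simp [hX.2]⟩

theorem IsIntegerRotation.transpose_mul {X : Matrix (Fin 3) (Fin 3) ℤ}
    (hX : IsIntegerRotation X) : X.transpose * X = 1 := mul_eq_one_comm.1 hX.1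

/-- An integer rotation matrix is a signed permutation matrix. -/
theorem IsIntegerRotation.exists_perm {X : Matrix (Fin 3) (Fin 3) ℤ} (hX : IsIntegerRotation X) :
    ∃ (π : Equiv.Perm (Fin 3)) (ε : Fin 3 → ℤ), (∀ i, ε i = 1 ∨ ε i = -1) ∧
      ∀ i j, X i j = if j = π i then ε i else 0 := by
  have hrow : ∀ i, ∃ (l : Fin 3) (e : ℤ), (e = 1 ∨ e = -1) ∧ ∀ j, X i j = if j = l then e else 0 := by
    intro i
    have h1 : X i 0 * X i 0 + X i 1 * X i 1 + X i 2 * X i 2 = 1 := by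
      have := congrFun (congrFun hX.1 i) i
      simpa [Matrix.mul_apply, Fin.sum_univ_three] using this
    have b : ∀ a b c : ℤ, a * a + b * b + c * c = 1 →
        (a = 0 ∨ a = 1 ∨ a = -1) := by
      intro a b c h
      have h1 : a ≤ 1 := by nlinarith [mul_self_nonneg b, mul_self_nonneg c]
      have h2 : -1 ≤ a := by nlinarith [mul_self_nonneg b, mul_self_nonneg c]
      omega
    have b0 := b _ _ _ h1
    have b1 := b (X i 1) (X i 0) (X i 2) (by linarith)
    have b2 := b (X i 2) (X i 0) (X i 1) (by linarith)
    rcases b0 with b0 | b0 | b0 <;> rcases b1 with b1 | b1 | b1 <;>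
      rcases b2 with b2 | b2 | b2 <;> rw [b0, b1, b2] at h1 <;> norm_num at h1
    · exact ⟨2, 1, Or.inl rfl, by simp [Fin.forall_fin_succ, *]⟩
    · exact ⟨2, -1, Or.inr rfl, by simp [Fin.forall_fin_succ, *]⟩
    · exact ⟨1, 1, Or.inl rfl, by simp [Fin.forall_fin_succ, *]⟩
    · exact ⟨1, -1, Or.inr rfl, by simp [Fin.forall_fin_succ, *]⟩
    · exact ⟨0, 1, Or.inl rfl, by simp [Fin.forall_fin_succ, *]⟩
    · exact ⟨0, -1, Or.inr rfl, by simp [Fin.forall_fin_succ, *]⟩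
  choose π ε hε hX' using hrow
  have hinj : Function.Injective π := by
    intro i j hij
    by_contra hne
    have := congrFun (congrFun hX.1 i) j
    rw [Matrix.mul_apply, Matrix.one_apply_ne hne] at this
    simp only [Matrix.transpose_apply, hX', hij, mul_ite, ite_mul, mul_zero, zero_mul] at this
    simp at this
    rcases hε i with h | h <;> rcases hε j with h' | h' <;> simp [h, h'] at this
  exact ⟨Equiv.ofBijective π (Finite.injective_iff_bijective.1 hinj), ε, hε, hX'⟩

/-- A row with entry `-1` negates differences, and `⌊-x⌋ = -⌊x⌋ - 1` costs one for each of the `n -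
1` indices `k ≠ i`. A rank `r` becomes `-r + 1 - n`, which modulo `n` is the reflection `n + 1 - r`
of the cube. The factor `(1 - ∑ j, X c j) / 2` is 1 for such rows and 0 for the others. -/
theorem rankVec_rotConfig {n : ℕ} {p : Fin n → Space3} (hp : IsGeneric p)
    {X : Matrix (Fin 3) (Fin 3) ℤ} (hX : IsIntegerRotation X) (i : Fin n) (c : Fin 3) :
    rankVec (rotConfig X p) i c =
      ∑ j, X c j * rankVec p i j + (1 - ∑ j, X c j) / 2 * (1 - n) := by
  obtain ⟨π, ε, hε, hX⟩ := hX.exists_perm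
  have e : ∀ i, rotConfig X p i c = ε c * p i (π c) := by
    intro i
    simp [rotConfig, Matrix.mulVec, dotProduct, hX]
  simp only [rankVec, e, hX]
  simp only [ite_mul, zero_mul, Finset.sum_ite_eq', Finset.mem_univ, if_true]
  rcases hε c with h | h
  · simp [h]
  · have h2 : ∀ k, ⌊(((ε c : ℤ) : ℝ) * p i (π c) - ((ε c : ℤ) : ℝ) * p k (π c))⌋
        = -⌊p i (π c) - p k (π c)⌋ + if k = i then 0 else -1 := by
      intro k
      by_cases hk : k = i
      · simp [hk]
      · rw [if_neg hk, h]
        have : ((-1 : ℤ) : ℝ) * p i (π c) - ((-1 : ℤ) : ℝ) * p k (π c)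
          = -(p i (π c) - p k (π c)) := by push_cast; ring
        rw [this, floor_neg_of_ne_intCast (hp i k (Ne.symm hk) (π c))]
        ring
    rw [Finset.sum_congr rfl fun k _ => h2 k, Finset.sum_add_distrib, Finset.sum_neg_distrib]
    simp only [h]
    have h3 : ∑ k : Fin n, (if k = i then (0 : ℤ) else -1) = 1 - n := by
      rw [← Finset.sum_erase_add _ _ (Finset.mem_univ i), if_pos rfl,
        Finset.sum_congr rfl (g := fun _ => (-1 : ℤ))
          (fun k hk => if_neg (Finset.ne_of_mem_erase hk))]
      have := i.pos
      simp
      omega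
    rw [h3]
    ring

theorem IsGeneric.rotConfig {n : ℕ} {p : Fin n → Space3} (hp : IsGeneric p)
    {X : Matrix (Fin 3) (Fin 3) ℤ} (hX : IsIntegerRotation X) : IsGeneric (rotConfig X p) := by
  obtain ⟨π, ε, hε, hX⟩ := hX.exists_perm
  intro i j hij c m h
  have e : ∀ i, _root_.rotConfig X p i c = ε c * p i (π c) := by
    intro i
    simp [_root_.rotConfig, Matrix.mulVec, dotProduct, hX]
  rw [e, e] at h
  rcases hε c with h1 | h1 <;> rw [h1] at h
  · exact hp i j hij (π c) m (by push_cast at h; linarith)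
  · exact hp i j hij (π c) (-m) (by push_cast at h ⊢; linarith)

/-- The affine map of the discrete torus with an integer rotation as linear part. -/
def affPt {n : ℕ} (X : Matrix (Fin 3) (Fin 3) ℤ) (v : DTorus n) (x : DTorus n) : DTorus n :=
  fun i => ∑ j, (X i j : ZMod n) * x j + v i

theorem affPt_affPt {n : ℕ} (X Y : Matrix (Fin 3) (Fin 3) ℤ) (v w x : DTorus n) :
    affPt X v (affPt Y w x) = affPt (X * Y) (affPt X v w) x := by
  funext i
  simp only [affPt, Matrix.mul_apply, Fin.sum_univ_three]
  push_cast
  ring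

/-- The shift part of the action of a cube rotation on the discrete torus. -/
def rotShift {n : ℕ} (X : Matrix (Fin 3) (Fin 3) ℤ) : DTorus n :=
  fun i => (((1 - ∑ j, X i j) / 2 : ℤ) : ZMod n)

theorem rankPt_rotConfig {n : ℕ} {p : Fin n → Space3} (hp : IsGeneric p)
    {X : Matrix (Fin 3) (Fin 3) ℤ} (hX : IsIntegerRotation X) (i : Fin n) :
    rankPt (rotConfig X p) i = affPt X (rotShift X) (rankPt p i) := by
  funext c
  rw [rankPt, rankVec_rotConfig hp hX, Int.cast_add, Int.cast_mul (_ / 2), Int.cast_sub _ (n : ℤ)]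
  simp [affPt, rotShift, rankPt]

/-- Permutations of the discrete torus of the form `x ↦ X x + v` with an integer rotation `X`. -/
def affSubgroup (n : ℕ) : Subgroup (Equiv.Perm (DTorus n)) where
  carrier := {g | ∃ (X : Matrix (Fin 3) (Fin 3) ℤ) (v : DTorus n), IsIntegerRotation X ∧
    ∀ x, g x = affPt X v x}
  mul_mem' := by
    rintro g h ⟨X, v, hX, hg⟩ ⟨Y, w, hY, hh⟩
    exact ⟨X * Y, affPt X v w, hX.mul hY, fun x => by
      rw [Equiv.Perm.mul_apply, hh, hg, affPt_affPt]⟩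
  one_mem' := ⟨1, 0, IsIntegerRotation.one, fun x => by
    funext i
    simp [affPt, Matrix.one_apply]⟩
  inv_mem' := by
    rintro g ⟨X, v, hX, hg⟩
    refine ⟨X.transpose, affPt X.transpose 0 (-v), hX.transpose, fun x => ?_⟩
    have h1 : ∀ x, g (affPt X.transpose (affPt X.transpose 0 (-v)) x) = x := by
      intro x
      rw [hg, affPt_affPt, affPt_affPt, hX.1]
      funext i
      simp [affPt, Matrix.one_apply]
    conv_lhs => rw [← h1 x]
    exact g.symm_apply_apply _

/-- Every affine map with linear part `X` is the cube rotation of `X` followed by a shift. -/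
theorem closure_shiftSet_union_rotationSet (n : ℕ) :
    Subgroup.closure (shiftSet n ∪ rotationSet n) = affSubgroup n := by
  apply le_antisymm
  · rw [Subgroup.closure_le]
    rintro g (⟨v, hv⟩ | ⟨X, hX, hg⟩)
    · exact ⟨1, v, IsIntegerRotation.one, fun x => by
        rw [hv]
        funext i
        simp [affPt, Matrix.one_apply]⟩
    · exact ⟨X, rotShift X, hX, fun x => by
        funext i
        rw [hg]
        rfl⟩
  · rintro g ⟨X, v, hX, hg⟩
    -- The cube rotation is a permutation because it differs from `g` by a translation.
    have hb : Function.Bijective (affPt (n := n) X (rotShift X)) := by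
      have : affPt (n := n) X (rotShift X) = fun x => g x + (rotShift X - v) := by
        funext x i
        rw [hg]
        simp [affPt]
      rw [this]
      exact ((Equiv.addRight (rotShift X - v)).bijective).comp g.bijective
    have h1 : Equiv.ofBijective _ hb ∈ rotationSet n := ⟨X, hX, fun x i => rfl⟩
    have h2 : Equiv.addRight (v - rotShift X) ∈ shiftSet n := ⟨v - rotShift X, fun x => rfl⟩
    have h3 : g = Equiv.addRight (v - rotShift X) * Equiv.ofBijective _ hb := by
      ext x i
      rw [hg]
      simp [affPt]
    rw [h3]
    exact mul_mem (Subgroup.subset_closure (Or.inl h2)) (Subgroup.subset_closure (Or.inr h1))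

theorem mem_closure_shiftSet {n : ℕ} {g : Equiv.Perm (DTorus n)} :
    g ∈ Subgroup.closure (shiftSet n) ↔ ∃ v : DTorus n, ∀ x, g x = x + v := by
  constructor
  · intro h
    induction h using Subgroup.closure_induction with
    | mem x hx => exact hx
    | one => exact ⟨0, by simp⟩
    | mul a b _ _ ha hb =>
      obtain ⟨v, hv⟩ := ha
      obtain ⟨w, hw⟩ := hb
      exact ⟨w + v, fun x => by rw [Equiv.Perm.mul_apply, hw, hv, add_assoc]⟩
    | inv a _ ha =>
      obtain ⟨v, hv⟩ := ha
      refine ⟨-v, fun x => ?_⟩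
      have : a (x + -v) = x := by rw [hv]; simp
      conv_lhs => rw [← this]
      exact a.symm_apply_apply _
  · exact fun h => Subgroup.subset_closure h

theorem orbit_eq_iff {n : ℕ} {G : Subgroup (Equiv.Perm (DTorus n))} {P Q : Finset (DTorus n)} :
    MulAction.orbit G P = MulAction.orbit G Q ↔ ∃ g ∈ G, ∀ x, x ∈ P ↔ g x ∈ Q := by
  rw [eq_comm, MulAction.orbit_eq_iff, MulAction.mem_orbit_iff]
  constructor
  · rintro ⟨g, hg⟩
    refine ⟨g.1, g.2, fun x => ?_⟩
    rw [← hg]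
    exact (Finset.smul_mem_smul_finset_iff g).symm
  · rintro ⟨g, hg, h⟩
    refine ⟨⟨g, hg⟩, ?_⟩
    ext y
    have hy : y = (⟨g, hg⟩ : G) • (g⁻¹ y) := by
      change y = g (g⁻¹ y)
      exact (g.apply_symm_apply y).symm
    rw [hy, Finset.smul_mem_smul_finset_iff]
    exact h _

theorem orbit_shift_eq_iff {n : ℕ} {p p' : Fin n → Space3} (hp : IsGeneric p)
    (hp' : IsGeneric p') :
    MulAction.orbit (Subgroup.closure (shiftSet n)) (pattern p) =
      MulAction.orbit (Subgroup.closure (shiftSet n)) (pattern p') ↔ SameOrder p p' := by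
  rw [orbit_eq_iff, sameOrder_iff hp hp']
  constructor
  · rintro ⟨g, hg, h⟩
    obtain ⟨v, hv⟩ := mem_closure_shiftSet.1 hg
    exact ⟨v, fun x => by rw [h, hv]⟩
  · rintro ⟨v, hv⟩
    exact ⟨Equiv.addRight v, mem_closure_shiftSet.2 ⟨v, fun x => rfl⟩, hv⟩

/-- Rotating the configuration acts on the pattern by `affPt X (rotShift X)`; the remaining freedom
of an affine map with linear part `X` is a shift, which `SameOrder` absorbs. -/
theorem orbit_rot_eq_iff {n : ℕ} (hn : 1 ≤ n) {p p' : Fin n → Space3} (hp : IsGeneric p)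
    (hp' : IsGeneric p') :
    MulAction.orbit (Subgroup.closure (shiftSet n ∪ rotationSet n)) (pattern p) =
      MulAction.orbit (Subgroup.closure (shiftSet n ∪ rotationSet n)) (pattern p') ↔
    ∃ X, IsIntegerRotation X ∧ SameOrder (rotConfig X p) p' := by
  have : NeZero n := ⟨by omega⟩
  rw [closure_shiftSet_union_rotationSet, orbit_eq_iff]
  have aff_add : ∀ (X : Matrix (Fin 3) (Fin 3) ℤ) (v w x : DTorus n),
      affPt X v x + w = affPt X (v + w) x := by
    intro X v w x; funext i; simp [affPt, add_assoc]
  constructor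
  · rintro ⟨g, ⟨X, v, hX, hg⟩, h⟩
    refine ⟨X, hX, (sameOrder_iff (hp.rotConfig hX) hp').2 ⟨v - rotShift X, fun x => ?_⟩⟩
    have e : ∀ y, affPt X (rotShift X) y + (v - rotShift X) = g y := by
      intro y; rw [aff_add, hg, add_sub_cancel]
    rw [mem_pattern]
    constructor
    · rintro ⟨i, rfl⟩
      rw [rankPt_rotConfig hp hX, e, ← h]
      exact mem_pattern.2 ⟨i, rfl⟩
    · intro hx
      obtain ⟨y, hy⟩ := g.surjective (x + (v - rotShift X))
      rw [← hy, ← h, mem_pattern] at hx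
      obtain ⟨i, rfl⟩ := hx
      refine ⟨i, ?_⟩
      rw [rankPt_rotConfig hp hX]
      exact add_right_cancel ((e _).trans hy)
  · rintro ⟨X, hX, h⟩
    obtain ⟨v, hv⟩ := (sameOrder_iff (hp.rotConfig hX) hp').1 h
    have hb : Function.Bijective (affPt X (rotShift X + v)) := by
      rw [← Finite.injective_iff_bijective]
      intro x y hxy
      have h2 : ∀ x, affPt X.transpose (affPt X.transpose 0 (-(rotShift X + v)))
          (affPt X (rotShift X + v) x) = x := by
        intro x
        rw [affPt_affPt, hX.transpose_mul]
        funext i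
        simp [affPt, Matrix.one_apply, Finset.sum_add_distrib, mul_add]
      rw [← h2 x, hxy, h2]
    refine ⟨Equiv.ofBijective _ hb, ⟨X, _, hX, fun x => rfl⟩, fun x => ?_⟩
    rw [Equiv.ofBijective_apply, ← aff_add, ← hv, mem_pattern, mem_pattern]
    constructor
    · rintro ⟨i, rfl⟩
      exact ⟨i, rankPt_rotConfig hp hX i⟩
    · rintro ⟨i, hi⟩
      refine ⟨i, hb.1 ?_⟩
      rw [← aff_add, ← aff_add, ← hi, rankPt_rotConfig hp hX]

/-- Counting the classes of a relation by means of a complete invariant. -/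
theorem equivalence_and_card_quot {α : Type*} {n : ℕ} (hn : 1 ≤ n)
    {r : α → α → Prop} {G : Subgroup (Equiv.Perm (DTorus n))} (pat : α → Finset (DTorus n))
    (hr : ∀ a b, r a b ↔ MulAction.orbit G (pat a) = MulAction.orbit G (pat b))
    (hpat : ∀ a, pat a ∈ patterns n)
    (hsurj : ∀ P ∈ patterns n, ∃ a, MulAction.orbit G (pat a) = MulAction.orbit G P) :
    Equivalence r ∧ ENat.card (Quot r) = (numOrbits n G : ℕ∞) := by
  have : NeZero n := ⟨by omega⟩
  refine ⟨⟨fun a => (hr a a).2 rfl, fun h => (hr _ _).2 ((hr _ _).1 h).symm,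
    fun h h' => (hr _ _).2 (((hr _ _).1 h).trans ((hr _ _).1 h'))⟩, ?_⟩
  have hfin : ((fun P : Finset (DTorus n) => MulAction.orbit G P) '' patterns n).Finite :=
    (Set.toFinite _).image _
  rw [numOrbits, hfin.cast_ncard_eq, ← ENat.card_coe_set_eq]
  let f : Quot r → ((fun P : Finset (DTorus n) => MulAction.orbit G P) '' patterns n) :=
    Quot.lift (fun a => ⟨MulAction.orbit G (pat a), pat a, hpat a, rfl⟩)
      (fun a b h => Subtype.ext ((hr a b).1 h))
  refine ENat.card_congr (Equiv.ofBijective f ⟨?_, ?_⟩)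
  · rintro ⟨a⟩ ⟨b⟩ h
    exact Quot.sound ((hr a b).2 (congrArg Subtype.val h))
  · rintro ⟨_, P, hP, rfl⟩
    obtain ⟨a, ha⟩ := hsurj P hP
    exact ⟨Quot.mk _ a, Subtype.ext ha⟩

/-! ### Axial grids in space -/

/-- An integer vector as a point of space. -/
def ivec (k : Fin 3 → ℤ) : Space3 := fun i => (k i : ℝ)

@[simp] theorem ivec_apply (k : Fin 3 → ℤ) (c : Fin 3) : ivec k c = k c := rfl

theorem ivec_add (k l : Fin 3 → ℤ) : ivec (k + l) = ivec k + ivec l := by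
  funext c; simp

theorem ivec_single (j : Fin 3) : ivec (Pi.single j 1) = Pi.single j 1 := by
  funext c
  rcases eq_or_ne c j with rfl | h <;> simp [*]

theorem ivec_injective : Function.Injective ivec := by
  intro k l h
  funext c
  have := congrFun h c
  rwa [ivec_apply, ivec_apply, Int.cast_inj] at this

@[simp] theorem ivec_zero : ivec 0 = 0 := by
  funext c; simp

/-- The unit segment starting at `x` in the direction of the axis `j`. -/
def axisEdge (x : Space3) (j : Fin 3) : Set Space3 := segment ℝ x (x + Pi.single j 1)

theorem mem_axisEdge {x y : Space3} {j : Fin 3} :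
    y ∈ axisEdge x j ↔ (∀ c, c ≠ j → y c = x c) ∧ x j ≤ y j ∧ y j ≤ x j + 1 := by
  rw [axisEdge, segment_eq_image']
  constructor
  · rintro ⟨s, ⟨h0, h1⟩, rfl⟩
    refine ⟨fun c hc => by simp [hc], ?_, ?_⟩ <;> simp [h0, h1]
  · rintro ⟨h, h0, h1⟩
    refine ⟨y j - x j, ⟨by linarith, by linarith⟩, ?_⟩
    funext c
    rcases eq_or_ne c j with rfl | hc
    · simp
    · simp [hc, h c hc]

theorem axisEdge_translate (x v : Space3) (j : Fin 3) :
    (fun y => y + v) '' axisEdge x j = axisEdge (x + v) j := by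
  have : (fun y : Space3 => y + v) = fun y => v + y := by funext y; exact add_comm _ _
  rw [axisEdge, axisEdge, this, segment_translate_image, add_comm v x, ← add_assoc, add_comm v x]

/-- The union of the translates of the model net by the points of a configuration. -/
def gridNet {n : ℕ} (p : Fin n → Space3) : LineNet Space3 where
  nodes := {x | ∃ i k, x = p i + ivec k}
  edges := {e | ∃ i k j, e = axisEdge (p i + ivec k) j}

theorem iUnion_pcuNet_eq {n : ℕ} (p : Fin n → Space3) :
    (LineNet.iUnion fun i => pcuNet.map (fun x => x + p i)) = gridNet p := by
  ext x
  · simp only [LineNet.iUnion, LineNet.map, pcuNet, gridNet, Set.mem_iUnion, Set.mem_image,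
      Set.mem_ofPred_eq]
    refine exists_congr fun i => ?_
    constructor
    · rintro ⟨_, ⟨k, rfl⟩, rfl⟩
      exact ⟨k, add_comm _ _⟩
    · rintro ⟨k, rfl⟩
      exact ⟨_, ⟨k, rfl⟩, add_comm _ _⟩
  · simp only [LineNet.iUnion, LineNet.map, pcuNet, gridNet, Set.mem_iUnion, Set.mem_image,
      Set.mem_ofPred_eq]
    refine exists_congr fun i => ?_
    constructor
    · rintro ⟨_, ⟨k, j, rfl⟩, rfl⟩
      exact ⟨k, j, (axisEdge_translate (ivec k) (p i) j).trans (by rw [add_comm])⟩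
    · rintro ⟨k, j, rfl⟩
      exact ⟨_, ⟨k, j, rfl⟩, (axisEdge_translate (ivec k) (p i) j).trans (by rw [add_comm])⟩

theorem mem_body_gridNet {n : ℕ} {p : Fin n → Space3} {x : Space3} :
    x ∈ (gridNet p).body ↔ ∃ i j, ∀ c, c ≠ j → ∃ m : ℤ, x c = p i c + m := by
  constructor
  · rintro (⟨i, k, rfl⟩ | ⟨_, ⟨i, k, j, rfl⟩, hx⟩)
    · exact ⟨i, 0, fun c _ => ⟨k c, rfl⟩⟩
    · exact ⟨i, j, fun c hc => ⟨k c, (mem_axisEdge.1 hx).1 c hc⟩⟩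
  · rintro ⟨i, j, h⟩
    choose! m hm using h
    let k : Fin 3 → ℤ := fun c => if c = j then ⌊x j - p i j⌋ else m c
    refine Or.inr ⟨_, ⟨i, k, j, rfl⟩, mem_axisEdge.2 ⟨fun c hc => ?_, ?_, ?_⟩⟩
    · simp [k, hc, hm c hc]
    · have := Int.floor_le (x j - p i j)
      simp [k]
      linarith
    · have := Int.lt_floor_add_one (x j - p i j)
      simp [k]
      linarith

/-- Any two axial lines have a coordinate that is constant on both. This is why coordinates distinct
modulo 1 make frames disjoint. -/
theorem exists_ne_ne (j j' : Fin 3) : ∃ c, c ≠ j ∧ c ≠ j' := by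
  revert j j'; decide

theorem pcuNet_translate_eq (v : Space3) :
    pcuNet.map (fun x => x + v) = gridNet (fun _ : Fin 1 => v) := by
  rw [← iUnion_pcuNet_eq]
  simp only [LineNet.iUnion, Set.iUnion_const]

/-- If the coordinate `c` agrees modulo 1, the point with one further coordinate from `w` and the
other two from `v` lies on both frames. Otherwise a coordinate from `exists_ne_ne` separates any two
edges. -/
theorem disjoint_pcuNet_iff (v w : Space3) :
    Disjoint (pcuNet.map (fun x => x + v)).body (pcuNet.map (fun x => x + w)).body ↔
      ∀ (c : Fin 3) (m : ℤ), v c - w c ≠ m := by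
  rw [pcuNet_translate_eq, pcuNet_translate_eq, Set.disjoint_left]
  simp only [mem_body_gridNet, Fin.exists_fin_one]
  constructor
  · intro h c m hm
    obtain ⟨a, b, hac, hbc, hab⟩ : ∃ a b : Fin 3, a ≠ c ∧ b ≠ c ∧ a ≠ b := by
      clear hm
      revert c; decide
    refine h (a := fun d => if d = b then w d else v d) ⟨b, fun d hd => ⟨0, by simp [hd]⟩⟩
      ⟨a, fun d hd => ?_⟩
    by_cases hdb : d = b
    · exact ⟨0, by simp [hdb]⟩
    · have hdc : d = c := by
        clear hm h
        revert a b c d; decide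
      subst hdc
      exact ⟨m, by simp [hdb]; linarith⟩
  · rintro h x ⟨j, hj⟩ ⟨j', hj'⟩
    obtain ⟨c, hc, hc'⟩ := exists_ne_ne j j'
    obtain ⟨m, hm⟩ := hj c hc
    obtain ⟨m', hm'⟩ := hj' c hc'
    exact h c (m' - m) (by push_cast; linarith)

/-- Edges are stored as sets, so their endpoints have to be recovered. Seen from `P`, the points `u`
and `v` have parameters `a, b ≥ 0` along `Q - P`, and `P` has parameter `(1 - s) * a + s * b = 0`,
so both terms vanish. -/
theorem endpoint_of_segment_eq {E : Type*} [AddCommGroup E] [Module ℝ E] {P Q u v : E}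
    (h : segment ℝ P Q = segment ℝ u v) : P = u ∨ P = v := by
  have hP : P ∈ segment ℝ u v := h ▸ left_mem_segment ℝ P Q
  have hu : u ∈ segment ℝ P Q := h ▸ left_mem_segment ℝ u v
  have hv : v ∈ segment ℝ P Q := h ▸ right_mem_segment ℝ u v
  rw [segment_eq_image'] at hP hu hv
  obtain ⟨s, ⟨hs0, hs1⟩, hs⟩ := hP
  obtain ⟨a, ⟨ha0, -⟩, ha⟩ := hu
  obtain ⟨b, ⟨hb0, -⟩, hb⟩ := hv
  simp only at hs ha hb
  by_cases hQ : Q - P = 0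
  · left; rw [← ha, hQ]; simp
  have h1 : ((1 - s) * a + s * b) • (Q - P) = 0 := by
    have : u + s • (v - u) - P = ((1 - s) * a + s * b) • (Q - P) := by
      rw [← ha, ← hb]
      module
    rw [← this, hs, sub_self]
  have h2 := (smul_eq_zero.1 h1).resolve_right hQ
  rcases eq_or_lt_of_le hs0 with hs0' | hs0'
  · left; rw [← hs, ← hs0']; simp
  · right
    have h3 : s * b = 0 := by nlinarith [mul_nonneg (sub_nonneg.2 hs1) ha0, mul_nonneg hs0 hb0]
    have h4 : b = 0 := (mul_eq_zero.1 h3).resolve_left hs0'.ne'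
    rw [← hb, h4]; simp

theorem mem_endpoints_of_mem_axisEdge {x : Space3} {j : Fin 3} {k : Fin 3 → ℤ}
    (h : x + ivec k ∈ axisEdge x j) : x + ivec k = x ∨ x + ivec k = x + Pi.single j 1 := by
  obtain ⟨h1, h2, h3⟩ := mem_axisEdge.1 h
  simp only [Pi.add_apply, ivec_apply] at h1 h2 h3
  have h4 : k j = 0 ∨ k j = 1 := by
    have a : (0 : ℝ) ≤ k j := by linarith
    have b : (k j : ℝ) ≤ 1 := by linarith
    have a' : 0 ≤ k j := by exact_mod_cast a
    have b' : k j ≤ 1 := by exact_mod_cast b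
    omega
  rcases h4 with h4 | h4
  · left
    funext c
    rcases eq_or_ne c j with rfl | hc
    · simp [h4]
    · exact h1 c hc
  · right
    funext c
    rcases eq_or_ne c j with rfl | hc
    · simp [h4]
    · have := h1 c hc
      simp [hc] at this ⊢
      exact this

/-- A common point of two different axial unit edges of the integer lattice is a lattice point. -/
theorem exists_eq_add_ivec_of_mem_axisEdge {q y : Space3} {k k' : Fin 3 → ℤ} {j j' : Fin 3}
    (h : y ∈ axisEdge (q + ivec k) j) (h' : y ∈ axisEdge (q + ivec k') j')
    (hne : ¬(k = k' ∧ j = j')) : ∃ l, y = q + ivec l := by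
  obtain ⟨h1, h2, h3⟩ := mem_axisEdge.1 h
  obtain ⟨h1', h2', h3'⟩ := mem_axisEdge.1 h'
  suffices hj : ∃ m : ℤ, y j = q j + m by
    obtain ⟨m, hm⟩ := hj
    refine ⟨fun c => if c = j then m else k c, ?_⟩
    funext c
    rcases eq_or_ne c j with rfl | hc
    · simp [hm]
    · simp [hc, h1 c hc]
  simp only [Pi.add_apply, ivec_apply] at *
  rcases eq_or_ne j j' with rfl | hj
  · have hk : ∀ c, c ≠ j → k c = k' c := by
      intro c hc
      have := (h1 c hc).symm.trans (h1' c hc)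
      exact_mod_cast add_left_cancel this
    have hkj : k j ≠ k' j := by
      intro hkj
      refine hne ⟨funext fun c => ?_, rfl⟩
      rcases eq_or_ne c j with rfl | hc
      · exact hkj
      · exact hk c hc
    rcases lt_or_gt_of_ne hkj with hlt | hlt
    · have : (k j : ℝ) + 1 ≤ k' j := by exact_mod_cast hlt
      exact ⟨k' j, by linarith⟩
    · have : (k' j : ℝ) + 1 ≤ k j := by exact_mod_cast hlt
      exact ⟨k j, by linarith⟩
  · exact ⟨k' j, h1' j hj⟩

theorem eq_of_mem_axisEdge_axisEdge {n : ℕ} {p : Fin n → Space3} (hp : IsGeneric p) {y : Space3}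
    {i i' : Fin n} {k k' : Fin 3 → ℤ} {j j' : Fin 3} (h : y ∈ axisEdge (p i + ivec k) j)
    (h' : y ∈ axisEdge (p i' + ivec k') j') : i = i' := by
  by_contra hne
  obtain ⟨c, hc, hc'⟩ := exists_ne_ne j j'
  have e1 := (mem_axisEdge.1 h).1 c hc
  have e2 := (mem_axisEdge.1 h').1 c hc'
  simp only [Pi.add_apply, ivec_apply] at e1 e2
  exact hp i i' hne c (k' c - k c) (by push_cast; linarith)

theorem isPeriodicityBasis_gridNet {n : ℕ} (p : Fin n → Space3) :
    IsPeriodicityBasis (gridNet p) standardBasis := by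
  have hsum : ∀ k : Fin 3 → ℤ, ∑ i, (k i : ℝ) • standardBasis i = ivec k := by
    intro k
    funext c
    simp [Finset.sum_apply, Pi.single_apply]
  refine ⟨fun c => ?_, ?_, ?_⟩
  · have e : standardBasis c = ivec (Pi.single c 1) := by rw [ivec_single]; simp
    rw [e]
    ext x
    · simp only [LineNet.map, gridNet, Set.mem_image, Set.mem_ofPred_eq]
      constructor
      · rintro ⟨_, ⟨i, k, rfl⟩, rfl⟩
        exact ⟨i, k + Pi.single c 1, by rw [ivec_add, add_assoc]⟩
      · rintro ⟨i, k, rfl⟩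
        exact ⟨_, ⟨i, k - Pi.single c 1, rfl⟩, by rw [add_assoc, ← ivec_add, sub_add_cancel]⟩
    · simp only [LineNet.map, gridNet, Set.mem_image, Set.mem_ofPred_eq]
      constructor
      · rintro ⟨_, ⟨i, k, j, rfl⟩, rfl⟩
        exact ⟨i, k + Pi.single c 1, j, by rw [axisEdge_translate, ivec_add, add_assoc]⟩
      · rintro ⟨i, k, j, rfl⟩
        exact ⟨_, ⟨i, k - Pi.single c 1, j, rfl⟩, by
          rw [axisEdge_translate, add_assoc, ← ivec_add, sub_add_cancel]⟩
  · refine ⟨Set.range p, Set.finite_range p, ?_⟩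
    rintro _ ⟨i, k, rfl⟩
    refine ⟨-k, i, ?_⟩
    rw [hsum, add_assoc, ← ivec_add]
    simp
  · refine ⟨Set.range fun q : Fin n × Fin 3 => axisEdge (p q.1) q.2, Set.finite_range _, ?_⟩
    rintro _ ⟨i, k, j, rfl⟩
    refine ⟨-k, (i, j), ?_⟩
    rw [hsum, axisEdge_translate, add_assoc, ← ivec_add]
    simp

theorem isLinearPeriodicNet_gridNet {n : ℕ} {p : Fin n → Space3} (hp : IsGeneric p) :
    IsLinearPeriodicNet (gridNet p) where
  countable := by
    refine (Set.countable_range fun q : Fin n × (Fin 3 → ℤ) × Fin 3 =>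
      axisEdge (p q.1 + ivec q.2.1) q.2.2).mono ?_
    rintro _ ⟨i, k, j, rfl⟩
    exact ⟨(i, k, j), rfl⟩
  isSegment := by
    rintro _ ⟨i, k, j, rfl⟩
    refine ⟨_, _, fun h => ?_, rfl⟩
    have := congrFun h j
    simp at this
  essentiallyDisjoint := by
    rintro P Q P' Q' ⟨i, k, j, h⟩ ⟨i', k', j', h'⟩ hne y ⟨hy, hy'⟩
    rw [h] at hy
    rw [h'] at hy'
    have hii := eq_of_mem_axisEdge_axisEdge hp hy hy'
    subst hii
    obtain ⟨l, hl⟩ := exists_eq_add_ivec_of_mem_axisEdge hy hy' (by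
      rintro ⟨rfl, rfl⟩
      exact hne (h.trans h'.symm))
    have aux : ∀ (P Q : Space3) (k : Fin 3 → ℤ) (j : Fin 3),
        segment ℝ P Q = axisEdge (p i + ivec k) j → y ∈ axisEdge (p i + ivec k) j →
          y ∈ ({P, Q} : Set Space3) := by
      intro P Q k j h hy
      have e : y = (p i + ivec k) + ivec (l - k) := by
        rw [hl, add_assoc, ← ivec_add, add_sub_cancel]
      rw [e] at hy
      rcases mem_endpoints_of_mem_axisEdge hy with h1 | h1
      · rcases endpoint_of_segment_eq h.symm with h2 | h2
        · left; rw [← h2, e, h1]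
        · right; rw [Set.mem_singleton_iff, ← h2, e, h1]
      · rw [axisEdge, segment_symm ℝ (p i + ivec k)] at h
        rcases endpoint_of_segment_eq h.symm with h2 | h2
        · left; rw [← h2, e, h1]
        · right; rw [Set.mem_singleton_iff, ← h2, e, h1]
    exact ⟨aux _ _ _ _ h hy, aux _ _ _ _ h' hy'⟩
  nodes_eq := by
    ext x
    constructor
    · rintro ⟨i, k, rfl⟩
      exact ⟨_, i, k, 0, rfl⟩
    · rintro ⟨q, i, k, j, h⟩
      rcases endpoint_of_segment_eq h with h2 | h2
      · exact ⟨i, k, h2⟩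
      · exact ⟨i, k + Pi.single j 1, by rw [h2, ivec_add, ivec_single, add_assoc]⟩
  periodic := ⟨_, isPeriodicityBasis_gridNet p⟩

theorem isNGrid_iff {n : ℕ} {K : LineNet Space3} :
    IsNGrid n K ↔ ∃ p : Fin n → Space3, IsGeneric p ∧ K = gridNet p := by
  constructor
  · rintro ⟨-, p, hp, rfl⟩
    exact ⟨p, fun i j hij => (disjoint_pcuNet_iff _ _).1 (hp hij), iUnion_pcuNet_eq p⟩
  · rintro ⟨p, hp, rfl⟩
    exact ⟨isLinearPeriodicNet_gridNet hp, p,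
      fun i j hij => (disjoint_pcuNet_iff _ _).2 (hp i j hij), (iUnion_pcuNet_eq p).symm⟩

/-! ### Linear images of nets -/

theorem isPeriodicityBasis_map {K : LineNet Space3} {a : Module.Basis (Fin 3) ℝ Space3}
    (h : IsPeriodicityBasis K a) (A : Space3 ≃ₗ[ℝ] Space3) :
    IsPeriodicityBasis (K.map A) (a.map A) := by
  obtain ⟨h1, ⟨F, hF, hF'⟩, ⟨G, hG, hG'⟩⟩ := h
  have hcomm : ∀ k : Fin 3 → ℝ, (fun x => x + ∑ i, k i • (a.map A) i) ∘ A =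
      A ∘ (fun x => x + ∑ i, k i • a i) := by
    intro k; funext x; simp
  refine ⟨fun i => ?_, ⟨A '' F, hF.image _, ?_⟩, ⟨(fun e => A '' e) '' G, hG.image _, ?_⟩⟩
  · conv_rhs => rw [← h1 i]
    have hc : (fun x => x + (a.map A) i) ∘ A = A ∘ (fun x => x + a i) := by
      funext x; simp
    simp only [LineNet.map, ← Set.image_comp, hc, LineNet.mk.injEq, true_and]
    congr 1
    funext e
    simp only [Function.comp, ← Set.image_comp]
    exact congrArg (fun f => f '' e) hc
  · rintro _ ⟨x, hx, rfl⟩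
    obtain ⟨k, hk⟩ := hF' x hx
    exact ⟨k, _, hk, (congrFun (hcomm _) x).symm⟩
  · rintro _ ⟨e, he, rfl⟩
    obtain ⟨k, hk⟩ := hG' e he
    refine ⟨k, _, hk, ?_⟩
    simp only [← Set.image_comp]
    rw [hcomm]

theorem segment_mem_map_iff {K : LineNet Space3} (A : Space3 ≃ₗ[ℝ] Space3) {P Q : Space3} :
    segment ℝ P Q ∈ (K.map A).edges ↔ segment ℝ (A.symm P) (A.symm Q) ∈ K.edges := by
  have e : segment ℝ P Q = A '' segment ℝ (A.symm P) (A.symm Q) := by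
    have := image_segment ℝ A.toLinearMap.toAffineMap (A.symm P) (A.symm Q)
    simpa using this.symm
  rw [e]
  exact (Set.image_injective.2 A.injective).mem_set_image

theorem isLinearPeriodicNet_map {K : LineNet Space3} (h : IsLinearPeriodicNet K)
    (A : Space3 ≃ₗ[ℝ] Space3) : IsLinearPeriodicNet (K.map A) where
  countable := h.countable.image _
  isSegment := by
    rintro _ ⟨e, he, rfl⟩
    obtain ⟨p, q, hpq, rfl⟩ := h.isSegment e he
    refine ⟨A p, A q, A.injective.ne hpq, ?_⟩
    simpa using image_segment ℝ A.toLinearMap.toAffineMap p q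
  essentiallyDisjoint := by
    intro P Q P' Q' h1 h2 hne y ⟨hy, hy'⟩
    rw [segment_mem_map_iff] at h1 h2
    have im : ∀ P Q, A.symm '' segment ℝ P Q = segment ℝ (A.symm P) (A.symm Q) := fun P Q => by
      simpa using image_segment ℝ A.symm.toLinearMap.toAffineMap P Q
    have h3 := h.essentiallyDisjoint _ _ _ _ h1 h2 (by
      rw [← im, ← im]
      exact fun h => hne (A.symm.injective.image_injective h))
      ⟨(im P Q) ▸ Set.mem_image_of_mem _ hy, (im P' Q') ▸ Set.mem_image_of_mem _ hy'⟩
    simpa using h3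
  nodes_eq := by
    ext x
    simp only [Set.mem_ofPred_eq, segment_mem_map_iff]
    simp only [LineNet.map, h.nodes_eq, Set.mem_image, Set.mem_ofPred_eq]
    constructor
    · rintro ⟨y, ⟨q, hq⟩, rfl⟩
      exact ⟨A q, by simpa using hq⟩
    · rintro ⟨q, hq⟩
      exact ⟨A.symm x, ⟨A.symm q, hq⟩, by simp⟩
  periodic := by
    obtain ⟨a, ha⟩ := h.periodic
    exact ⟨_, isPeriodicityBasis_map ha A⟩

/-! ### The phase of a spatial quadrilateral as seen from a point -/

/-- The Euclidean length of a vector. -/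
noncomputable def euclLen (v : Space3) : ℝ := √(v 0 ^ 2 + v 1 ^ 2 + v 2 ^ 2)

theorem euclLen_sq (v : Space3) : euclLen v ^ 2 = v 0 ^ 2 + v 1 ^ 2 + v 2 ^ 2 :=
  Real.sq_sqrt (by positivity)

theorem euclLen_nonneg (v : Space3) : 0 ≤ euclLen v := Real.sqrt_nonneg _

theorem continuous_euclLen : Continuous euclLen := by
  unfold euclLen
  fun_prop

/-- The rank one matrix `|v| + v · σ` formed with the Pauli matrices `σ`. -/
noncomputable def pauli (v : Space3) : Matrix (Fin 2) (Fin 2) ℂ :=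
  !![(euclLen v + v 2 : ℂ), v 0 - Complex.I * v 1; v 0 + Complex.I * v 1, (euclLen v - v 2 : ℂ)]

/-- The matrix is Hermitian with trace `2|v|` and determinant `|v|² - v · v = 0`, hence of the form
`ψ ψ*`. An explicit spinor has first entry `√(|v| + v 2)`; this vanishes on the closed negative
third half-axis, which is treated apart. -/
theorem pauli_eq_spinor (v : Space3) : ∃ s w : ℂ, pauli v =
    !![s * starRingEnd ℂ s, s * starRingEnd ℂ w; w * starRingEnd ℂ s, w * starRingEnd ℂ w] := by
  have hsq := euclLen_sq v
  have hr := euclLen_nonneg v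
  set r := euclLen v with hrdef
  have hge : 0 ≤ r + v 2 := by nlinarith [sq_nonneg (v 0), sq_nonneg (v 1)]
  rcases eq_or_lt_of_le hge with h0 | hpos
  · have h2 : v 2 = -r := by linarith
    have h1 : v 0 = 0 ∧ v 1 = 0 := by
      rw [h2] at hsq
      constructor <;> nlinarith [sq_nonneg (v 0), sq_nonneg (v 1)]
    refine ⟨0, (√(2 * r) : ℝ), ?_⟩
    have h3 : ((√(2 * r) : ℝ) : ℂ) * (√(2 * r) : ℝ) = 2 * r := by
      rw [← Complex.ofReal_mul, Real.mul_self_sqrt (by linarith)]; push_cast; ring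
    simp only [pauli, ← hrdef, h2, h1, Complex.conj_ofReal, h3]
    ext i j
    fin_cases i <;> fin_cases j <;> simp
    ring
  · set q := √(r + v 2) with hq
    have hqpos : 0 < q := Real.sqrt_pos.2 hpos
    have hqq : (q : ℂ) * q = r + v 2 := by
      rw [← Complex.ofReal_mul, Real.mul_self_sqrt hge]; push_cast; ring
    have hq0 : (q : ℂ) ≠ 0 := by exact_mod_cast hqpos.ne'
    have hsq' : (r : ℂ) ^ 2 = v 0 ^ 2 + v 1 ^ 2 + v 2 ^ 2 := by exact_mod_cast hsq
    refine ⟨q, (v 0 + Complex.I * v 1) / q, ?_⟩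
    simp only [pauli, ← hrdef, map_div₀, map_add, map_mul, Complex.conj_ofReal, Complex.conj_I]
    ext i j
    fin_cases i <;> fin_cases j <;> simp
    · exact hqq.symm
    · field_simp
      ring
    · field_simp
    · have h4 : (r + v 2 : ℂ) ≠ 0 := by rw [← hqq]; exact mul_ne_zero hq0 hq0
      have h5 : ((v 0 : ℂ) + Complex.I * v 1) / q * ((v 0 + -(Complex.I * v 1)) / q)
          = (v 0 ^ 2 + v 1 ^ 2) / (r + v 2) := by
        rw [div_mul_div_comm, hqq]
        congr 1
        linear_combination (-(v 1 : ℂ) ^ 2) * Complex.I_sq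
      rw [h5]
      field_simp
      linear_combination hsq'

/-- The complex number whose argument is half the solid angle of the quadrilateral `v`, as seen
from the origin. -/
noncomputable def phase (v : Fin 4 → Space3) : ℂ :=
  (pauli (v 0) * pauli (v 1) * pauli (v 2) * pauli (v 3)).trace

/-- This is the equality case of the Cauchy-Schwarz inequality: `|w| v + |v| w` has squared length
`2 |v| |w| (|v| |w| + v · w) = 0`. -/
theorem zero_mem_segment_of_euclLen {v w : Space3}
    (h : euclLen v * euclLen w + (v 0 * w 0 + v 1 * w 1 + v 2 * w 2) = 0) :
    (0 : Space3) ∈ segment ℝ v w := by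
  have hv := euclLen_sq v
  have hw := euclLen_sq w
  have hr := euclLen_nonneg v
  have hs := euclLen_nonneg w
  set r := euclLen v
  set s := euclLen w
  have hsum : (s * v 0 + r * w 0) ^ 2 + (s * v 1 + r * w 1) ^ 2 + (s * v 2 + r * w 2) ^ 2 = 0 := by
    linear_combination (-s ^ 2) * hv - r ^ 2 * hw + 2 * r * s * h
  have hcoord : ∀ c, s * v c + r * w c = 0 := by
    have h0 : s * v 0 + r * w 0 = 0 := by
      nlinarith [sq_nonneg (s * v 0 + r * w 0), sq_nonneg (s * v 1 + r * w 1),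
        sq_nonneg (s * v 2 + r * w 2)]
    have h1 : s * v 1 + r * w 1 = 0 := by
      nlinarith [sq_nonneg (s * v 0 + r * w 0), sq_nonneg (s * v 1 + r * w 1),
        sq_nonneg (s * v 2 + r * w 2)]
    have h2 : s * v 2 + r * w 2 = 0 := by
      nlinarith [sq_nonneg (s * v 0 + r * w 0), sq_nonneg (s * v 1 + r * w 1),
        sq_nonneg (s * v 2 + r * w 2)]
    intro c
    fin_cases c
    · exact h0
    · exact h1
    · exact h2
  rcases eq_or_lt_of_le (add_nonneg hs hr) with h0 | hpos
  · have hr0 : r = 0 := by linarith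
    have hv0 : v = 0 := by
      rw [hr0] at hv
      have : ∀ a b c : ℝ, (0 : ℝ) ^ 2 = a ^ 2 + b ^ 2 + c ^ 2 → a = 0 := by
        intro a b c h
        nlinarith [sq_nonneg a, sq_nonneg b, sq_nonneg c]
      funext c
      fin_cases c
      · exact this _ _ _ hv
      · exact this (v 1) (v 0) (v 2) (by linarith)
      · exact this (v 2) (v 0) (v 1) (by linarith)
    rw [hv0]
    exact left_mem_segment ℝ _ _
  · refine ⟨s / (s + r), r / (s + r), by positivity, by positivity, by field_simp, ?_⟩
    funext c
    have := hcoord c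
    simp only [Pi.add_apply, Pi.smul_apply, smul_eq_mul, Pi.zero_apply]
    field_simp
    linarith

/-- Writing each Pauli matrix as `ψ ψ*` makes the trace a product of inner products of consecutive
spinors. Such an inner product has squared modulus `2 (|v| |v'| + v · v')`, so it vanishes only if
the origin lies on the edge. -/
theorem phase_ne_zero {v : Fin 4 → Space3}
    (h : ∀ m, (0 : Space3) ∉ segment ℝ (v m) (v (m + 1))) : phase v ≠ 0 := by
  choose s w hsw using fun m => pauli_eq_spinor (v m)
  have key : ∀ m m', starRingEnd ℂ (s m) * s m' + starRingEnd ℂ (w m) * w m' = 0 →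
      (0 : Space3) ∈ segment ℝ (v m) (v m') := by
    intro m m' h0
    apply zero_mem_segment_of_euclLen
    have e : ∀ m, (euclLen (v m) + v m 2 : ℂ) = s m * starRingEnd ℂ (s m) ∧
        (v m 0 - Complex.I * v m 1 : ℂ) = s m * starRingEnd ℂ (w m) ∧
        (v m 0 + Complex.I * v m 1 : ℂ) = w m * starRingEnd ℂ (s m) ∧
        (euclLen (v m) - v m 2 : ℂ) = w m * starRingEnd ℂ (w m) := by
      intro m
      have h1 := hsw m
      exact ⟨congrFun (congrFun h1 0) 0, congrFun (congrFun h1 0) 1, congrFun (congrFun h1 1) 0,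
        congrFun (congrFun h1 1) 1⟩
    obtain ⟨a1, a2, a3, a4⟩ := e m
    obtain ⟨b1, b2, b3, b4⟩ := e m'
    have h2 : (2 : ℂ) * (euclLen (v m) * euclLen (v m') +
        (v m 0 * v m' 0 + v m 1 * v m' 1 + v m 2 * v m' 2)) = 0 := by
      have h3 : (starRingEnd ℂ (s m) * s m' + starRingEnd ℂ (w m) * w m') *
          (s m * starRingEnd ℂ (s m') + w m * starRingEnd ℂ (w m')) = 0 := by rw [h0, zero_mul]
      have h4 : (euclLen (v m) + v m 2 : ℂ) * (euclLen (v m') + v m' 2) +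
          (euclLen (v m) - v m 2) * (euclLen (v m') - v m' 2) +
          (v m 0 - Complex.I * v m 1) * (v m' 0 + Complex.I * v m' 1) +
          (v m 0 + Complex.I * v m 1) * (v m' 0 - Complex.I * v m' 1) = 0 := by
        rw [a1, a2, a3, a4, b1, b2, b3, b4, ← h3]
        ring
      linear_combination h4 + 2 * (v m 1 : ℂ) * v m' 1 * Complex.I_sq
    have h5 := (mul_eq_zero.1 h2).resolve_left two_ne_zero
    exact_mod_cast h5
  have e : phase v = (starRingEnd ℂ (s 0) * s 1 + starRingEnd ℂ (w 0) * w 1) *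
      (starRingEnd ℂ (s 1) * s 2 + starRingEnd ℂ (w 1) * w 2) *
      (starRingEnd ℂ (s 2) * s 3 + starRingEnd ℂ (w 2) * w 3) *
      (starRingEnd ℂ (s 3) * s 0 + starRingEnd ℂ (w 3) * w 0) := by
    simp only [phase, hsw, Matrix.trace_fin_two, Matrix.mul_apply, Fin.sum_univ_two]
    simp
    ring
  rw [e]
  exact mul_ne_zero (mul_ne_zero (mul_ne_zero (fun h' => h 0 (key 0 1 h'))
    (fun h' => h 1 (key 1 2 h'))) (fun h' => h 2 (key 2 3 h'))) (fun h' => h 3 (key 3 0 h'))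

theorem continuous_phase : Continuous phase := by
  have hp : Continuous pauli := by
    refine continuous_matrix fun i j => ?_
    have := continuous_euclLen
    fin_cases i <;> fin_cases j <;> simp [pauli] <;> fun_prop
  unfold phase
  have h : ∀ m : Fin 4, Continuous fun v : Fin 4 → Space3 => pauli (v m) :=
    fun m => hp.comp (continuous_apply m)
  exact (((((h 0).mul (h 1)).mul (h 2)).mul (h 3))).matrix_trace

/-- The unit square with corner `p` perpendicular to the axis `0`. -/
def squareCorner (m : Fin 4) : Fin 3 → ℤ :=
  ![0, Pi.single 1 1, Pi.single 1 1 + Pi.single 2 1, Pi.single 2 1] m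

/-- The unit square perpendicular to the axis `2`. -/
def squareCorner' (m : Fin 4) : Fin 3 → ℤ :=
  ![0, Pi.single 0 1, Pi.single 0 1 + Pi.single 1 1, Pi.single 1 1] m

/-- The imaginary part is the signed distance to the plane of the square times a nonnegative factor,
so its sign shows on which side of this plane the viewpoint lies. -/
theorem phase_square_im (a : Space3) :
    (phase fun m => a + ivec (squareCorner m)).im =
      2 * a 0 * ∑ m, euclLen (a + ivec (squareCorner m)) := by
  simp only [phase, pauli, Matrix.trace_fin_two, Matrix.mul_apply, Fin.sum_univ_two,
    Fin.sum_univ_four]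
  simp [squareCorner]
  generalize euclLen a = r0
  generalize euclLen _ = r1
  generalize euclLen _ = r2
  generalize euclLen _ = r3
  ring

/-! ### Loops in the punctured plane with a continuous logarithm -/

/-- A continuous function without integer values on a preconnected set has a constant floor. -/
theorem floor_eq_of_isPreconnected {X : Type*} [TopologicalSpace X] {S : Set X}
    (hS : IsPreconnected S) {f : X → ℝ} (hf : ContinuousOn f S)
    (hne : ∀ x ∈ S, ∀ m : ℤ, f x ≠ m) {x y : X} (hx : x ∈ S) (hy : y ∈ S) :
    ⌊f x⌋ = ⌊f y⌋ := by
  have key : ∀ x ∈ S, ∀ y ∈ S, ⌊f y⌋ ≤ ⌊f x⌋ := by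
    intro x hx y hy
    by_contra! h
    obtain ⟨z, hz, hz'⟩ := hS.intermediate_value hx hy hf
      (show (⌊f y⌋ : ℝ) ∈ Set.Icc (f x) (f y) from ⟨(Int.floor_lt.1 h).le, Int.floor_le _⟩)
    exact hne z hz _ hz'
  exact le_antisymm (key y hy x hx) (key x hx y hy)

theorem eq_of_isPreconnected_of_int {X : Type*} [TopologicalSpace X] {S : Set X}
    (hS : IsPreconnected S) {f : X → ℝ} (hf : ContinuousOn f S)
    (hint : ∀ x ∈ S, ∃ m : ℤ, f x = m) {x y : X} (hx : x ∈ S) (hy : y ∈ S) : f x = f y := by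
  have h1 : ∀ m : ℤ, ⌊(m : ℝ) + 1 / 2⌋ = m := fun m => by
    rw [Int.floor_eq_iff]; constructor <;> linarith
  have h := floor_eq_of_isPreconnected (f := fun x => f x + 1 / 2) hS
    (hf.add continuousOn_const) (by
      intro x hx m hm
      obtain ⟨k, hk⟩ := hint x hx
      simp only [hk] at hm
      have h2 : (2 * k + 1 : ℝ) = 2 * m := by linarith
      have h3 : 2 * k + 1 = 2 * m := by exact_mod_cast h2
      omega) hx hy
  obtain ⟨k, hk⟩ := hint x hx
  obtain ⟨l, hl⟩ := hint y hy
  simp only [hk, hl, h1] at h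
  rw [hk, hl, h]

/-- The parameter interval of a closed quadrilateral. -/
abbrev LoopParam : Type := Set.Icc (0 : ℝ) 4

/-- The parameter in the loop interval which is nearest to a real number. -/
noncomputable def loopPt (x : ℝ) : LoopParam := Set.projIcc 0 4 (by norm_num) x

theorem coe_loopPt {x : ℝ} (h0 : 0 ≤ x) (h4 : x ≤ 4) : (loopPt x : ℝ) = x := by
  rw [loopPt, Set.projIcc_of_mem _ ⟨h0, h4⟩]

/-- A loop has a continuous logarithm which is again a loop. -/
def HasClosedLog (f : LoopParam → ℂ) : Prop :=
  ∃ g : LoopParam → ℂ, Continuous g ∧ (∀ s, Complex.exp (g s) = f s) ∧ g (loopPt 0) = g (loopPt 4)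

theorem hasClosedLog_const {z : ℂ} (hz : z ≠ 0) : HasClosedLog fun _ => z :=
  ⟨fun _ => Complex.log z, continuous_const, fun _ => Complex.exp_log hz, rfl⟩

/-- Having a closed logarithm is a homotopy invariant. -/
theorem HasClosedLog.homotopy {F : I → LoopParam → ℂ} (hF : Continuous (Function.uncurry F))
    (h0 : ∀ t s, F t s ≠ 0) (hcl : ∀ t, F t (loopPt 0) = F t (loopPt 4)) {t : I}
    (h : HasClosedLog (F t)) (t' : I) : HasClosedLog (F t') := by
  have : Nonempty (I × LoopParam) := ⟨(t, loopPt 0)⟩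
  obtain ⟨x₀, -, hx₀⟩ := isCompact_univ.exists_isMinOn (Set.univ_nonempty (α := I × LoopParam))
    hF.norm.continuousOn
  set ε := ‖Function.uncurry F x₀‖ with hε
  have hεpos : 0 < ε := norm_pos_iff.2 (h0 _ _)
  have hmin : ∀ t s, ε ≤ ‖F t s‖ := fun t s => hx₀ (Set.mem_univ (t, s))
  obtain ⟨δ, hδ, hunif⟩ := Metric.uniformContinuous_iff.1
    (CompactSpace.uniformContinuous_of_continuous hF) ε hεpos
  -- For close times the quotient of the loops stays in the unit disk about 1, and its principal
  -- logarithm corrects `g`. As `δ` is uniform, both the good times and the bad times form open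
  -- sets.
  have step : ∀ t t', dist t t' < δ → HasClosedLog (F t) → HasClosedLog (F t') := by
    rintro t t' htt ⟨g, hg, hexp, hgcl⟩
    have hslit : ∀ s, F t' s / F t s ∈ Complex.slitPlane := by
      intro s
      have h1 : dist (F t s) (F t' s) < ε := hunif (a := (t, s)) (b := (t', s)) (by
        rw [Prod.dist_eq, dist_self]; exact max_lt htt hδ)
      have h2 : F t' s / F t s = 1 + (F t' s - F t s) / F t s := by
        field_simp [h0 t s]; ring
      rw [h2]
      apply Complex.mem_slitPlane_of_norm_lt_one
      rw [norm_div, div_lt_one (norm_pos_iff.2 (h0 _ _)), ← dist_eq_norm, dist_comm]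
      exact h1.trans_le (hmin t s)
    have hc : ∀ t, Continuous (F t) := fun t => hF.comp (continuous_const.prodMk continuous_id)
    refine ⟨fun s => g s + Complex.log (F t' s / F t s),
      hg.add (((hc t').div (hc t) (h0 t)).clog hslit), fun s => ?_, ?_⟩
    · rw [Complex.exp_add, hexp, Complex.exp_log (div_ne_zero (h0 _ _) (h0 _ _))]
      field_simp [h0 t s]
    · simp only [hgcl, hcl]
  have hclopen : IsClopen {t | HasClosedLog (F t)} := by
    constructor
    · rw [← isOpen_compl_iff, Metric.isOpen_iff]
      intro t ht
      exact ⟨δ, hδ, fun t' ht' h' => ht (step t' t ht' h')⟩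
    · rw [Metric.isOpen_iff]
      intro t ht
      exact ⟨δ, hδ, fun t' ht' => step t t' (by rwa [dist_comm]) ht⟩
  exact Set.eq_univ_iff_forall.1 (hclopen.eq_univ ⟨t, h⟩) t'

/-- Two logarithms of a function on a preconnected set differ by a constant. -/
theorem sub_im_eq_of_exp_eq {X : Type*} [TopologicalSpace X] {S : Set X}
    (hS : IsPreconnected S) {f g : X → ℂ} (hf : ContinuousOn f S) (hg : ContinuousOn g S)
    (h : ∀ x ∈ S, Complex.exp (f x) = Complex.exp (g x)) {x y : X} (hx : x ∈ S) (hy : y ∈ S) :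
    (f x).im - (g x).im = (f y).im - (g y).im := by
  have h1 : ∀ x ∈ S, ∃ m : ℤ, ((f x).im - (g x).im) / (2 * Real.pi) = m := by
    intro x hx
    obtain ⟨m, hm⟩ := Complex.exp_eq_exp_iff_exists_int.1 (h x hx)
    refine ⟨m, ?_⟩
    rw [hm]
    simp
  have h2 := eq_of_isPreconnected_of_int (f := fun x => ((f x).im - (g x).im) / (2 * Real.pi)) hS
    (((Complex.continuous_im.comp_continuousOn hf).sub
      (Complex.continuous_im.comp_continuousOn hg)).div_const _) h1 hx hy
  have := Real.pi_ne_zero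
  field_simp at h2
  exact h2

theorem isPreconnected_loopParam (x y : ℝ) :
    IsPreconnected {s : LoopParam | x ≤ s ∧ (s : ℝ) ≤ y} := by
  rw [← Topology.IsInducing.subtypeVal.isPreconnected_image]
  have : ((↑) : LoopParam → ℝ) '' {s : LoopParam | x ≤ s ∧ (s : ℝ) ≤ y} =
      Set.Icc x y ∩ Set.Icc 0 4 := by
    ext s
    constructor
    · rintro ⟨s, hs, rfl⟩
      exact ⟨hs, s.2⟩
    · rintro ⟨hs, hs'⟩
      exact ⟨⟨s, hs'⟩, hs, rfl⟩
  rw [this]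
  exact (Set.ordConnected_Icc.inter Set.ordConnected_Icc).isPreconnected

/-- A loop crossing the real axis just twice, on different sides of the origin, has no closed
logarithm. -/
theorem not_hasClosedLog {f : LoopParam → ℂ} (hf : Continuous f) {a b : ℝ} (ha : 0 ≤ a)
    (hab : a ≤ b) (hb : b ≤ 4) (h1 : ∀ s : LoopParam, a ≤ s → s ≤ b → (f s).im ≤ 0)
    (h2 : ∀ s : LoopParam, (s : ℝ) ≤ a → 0 ≤ (f s).im)
    (h3 : ∀ s : LoopParam, b ≤ s → 0 ≤ (f s).im) (hcl : f (loopPt 0) = f (loopPt 4))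
    (h0 : ∀ s, f s ≠ 0) (hfa : (f (loopPt a)).re < 0) (hfb : 0 < (f (loopPt b)).re) :
    ¬HasClosedLog f := by
  rintro ⟨g, hg, hexp, hgcl⟩
  have hca : (loopPt a : ℝ) = a := coe_loopPt ha (hab.trans hb)
  have hcb : (loopPt b : ℝ) = b := coe_loopPt (ha.trans hab) hb
  have hc0 : (loopPt 0 : ℝ) = 0 := coe_loopPt le_rfl (by norm_num)
  have hc4 : (loopPt 4 : ℝ) = 4 := coe_loopPt (by norm_num) le_rfl
  have ima : (f (loopPt a)).im = 0 := le_antisymm (h1 _ hca.ge (hca.trans_le hab))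
    (h2 _ hca.le)
  have imb : (f (loopPt b)).im = 0 := le_antisymm (h1 _ (hab.trans hcb.ge) hcb.le) (h3 _ hcb.ge)
  have hfa' : f (loopPt a) = ((f (loopPt a)).re : ℂ) := Complex.ext rfl ima
  have hfb' : f (loopPt b) = ((f (loopPt b)).re : ℂ) := Complex.ext rfl imb
  -- the two branches of the logarithm on the closed half planes
  have branch : ∀ ω : ℂ, ω ≠ 0 → ∀ u v : ℝ,
      (∀ s : LoopParam, u ≤ s → (s : ℝ) ≤ v → ω * f s ∈ Complex.slitPlane) →
      ∀ x y : LoopParam, u ≤ x → (x : ℝ) ≤ v → u ≤ y → (y : ℝ) ≤ v →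
      (g x).im - (g y).im = (Complex.log (ω * f x)).im - (Complex.log (ω * f y)).im := by
    intro ω hω u v hsl x y hux hxv huy hyv
    have := sub_im_eq_of_exp_eq (f := g) (g := fun s => Complex.log (ω * f s) - Complex.log ω)
      (isPreconnected_loopParam u v) hg.continuousOn
      (((continuous_const.mul hf).continuousOn.clog fun s hs => hsl s hs.1 hs.2).sub continuousOn_const) (by
        intro s hs
        rw [hexp, Complex.exp_sub, Complex.exp_log (mul_ne_zero hω (h0 s)), Complex.exp_log hω]
        field_simp) ⟨hux, hxv⟩ ⟨huy, hyv⟩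
    simp only [Complex.sub_im] at this
    linarith
  have slit_of : ∀ z : ℂ, z ≠ 0 → (0 ≤ z.im → -Complex.I * z ∈ Complex.slitPlane) ∧
      (z.im ≤ 0 → Complex.I * z ∈ Complex.slitPlane) := by
    intro z hz
    have hz' : z.im = 0 → z.re ≠ 0 := fun h h' => hz (Complex.ext h' h)
    constructor
    · intro h
      rw [Complex.mem_slitPlane_iff]
      rcases eq_or_lt_of_le h with h4 | h4
      · right; simpa using hz' h4.symm
      · left; simpa using h4
    · intro h
      rw [Complex.mem_slitPlane_iff]
      rcases eq_or_lt_of_le h with h4 | h4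
      · right; simpa using hz' h4
      · left; simpa using h4
  have logs : ∀ r : ℝ, 0 < r → (Complex.log (Complex.I * (r : ℂ))).im = Real.pi / 2 ∧
      (Complex.log (-Complex.I * (r : ℂ))).im = -(Real.pi / 2) := by
    intro r hr
    constructor
    · rw [mul_comm, Complex.log_im, Complex.arg_real_mul _ hr, Complex.arg_I]
    · rw [mul_comm, Complex.log_im, Complex.arg_real_mul _ hr, Complex.arg_neg_I]
  have flip : ∀ z : ℂ, Complex.I * z = -Complex.I * (-z) ∧ -Complex.I * z = Complex.I * (-z) :=
    fun z => ⟨by ring, by ring⟩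
  have la := logs (-(f (loopPt a)).re) (by linarith)
  have lb := logs (f (loopPt b)).re hfb
  rw [← hfb'] at lb
  have la1 : (Complex.log (Complex.I * f (loopPt a))).im = -(Real.pi / 2) := by
    rw [(flip _).1, hfa', ← Complex.ofReal_neg, la.2]
  have la2 : (Complex.log (-Complex.I * f (loopPt a))).im = Real.pi / 2 := by
    rw [(flip _).2, hfa', ← Complex.ofReal_neg, la.1]
  -- The imaginary part of `g` grows by π on `[a, b]`, and by π on the other two arcs together, so
  -- `g` cannot close up.
  have e1 := branch Complex.I Complex.I_ne_zero a b
    (fun s hs hs' => (slit_of _ (h0 s)).2 (h1 s hs hs'))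
    (loopPt a) (loopPt b) hca.ge (hca.trans_le hab) (hab.trans hcb.ge) hcb.le
  have e2 := branch (-Complex.I) (neg_ne_zero.2 Complex.I_ne_zero) 0 a
    (fun s _ hs => (slit_of _ (h0 s)).1 (h2 s hs))
    (loopPt 0) (loopPt a) hc0.ge (hc0.trans_le ha) (ha.trans hca.ge) hca.le
  have e3 := branch (-Complex.I) (neg_ne_zero.2 Complex.I_ne_zero) b 4
    (fun s hs _ => (slit_of _ (h0 s)).1 (h3 s hs))
    (loopPt b) (loopPt 4) hcb.ge (hcb.trans_le hb) (hb.trans hc4.ge) hc4.le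
  rw [hcl, hgcl] at e2
  have := Real.pi_pos
  linarith

/-! ### Linking of closed quadrilaterals -/

/-- Truncation of a real number to the unit interval. -/
noncomputable def clamp (x : ℝ) : ℝ := max 0 (min 1 x)

theorem continuous_clamp : Continuous clamp := by unfold clamp; fun_prop

theorem clamp_mem (x : ℝ) : 0 ≤ clamp x ∧ clamp x ≤ 1 :=
  ⟨le_max_left _ _, max_le zero_le_one (min_le_left _ _)⟩

theorem clamp_of_le {x : ℝ} (h : x ≤ 0) : clamp x = 0 := by
  rw [clamp, min_eq_right (h.trans zero_le_one), max_eq_left h]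

theorem clamp_of_ge {x : ℝ} (h : 1 ≤ x) : clamp x = 1 := by
  rw [clamp, min_eq_left h, max_eq_right zero_le_one]

theorem clamp_of_mem {x : ℝ} (h : 0 ≤ x) (h' : x ≤ 1) : clamp x = x := by
  rw [clamp, min_eq_right h', max_eq_right h]

/-- The closed quadrilateral with the given vertices. -/
noncomputable def quad (b : Fin 4 → Space3) (s : LoopParam) : Space3 :=
  b 0 + clamp s • (b 1 - b 0) + clamp (s - 1) • (b 2 - b 1) + clamp (s - 2) • (b 3 - b 2) +
    clamp (s - 3) • (b 0 - b 3)

theorem quad_mem (b : Fin 4 → Space3) (s : LoopParam) :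
    ∃ m, quad b s ∈ segment ℝ (b m) (b (m + 1)) := by
  have hseg : ∀ m m' : Fin 4, ∀ θ : ℝ, b m + clamp θ • (b m' - b m) ∈ segment ℝ (b m) (b m') := by
    intro m m' θ
    rw [segment_eq_image']
    exact ⟨_, clamp_mem θ, rfl⟩
  have h0 := s.2.1
  rcases le_total (s : ℝ) 1 with h1 | h1
  · refine ⟨0, ?_⟩
    have : quad b s = b 0 + clamp s • (b 1 - b 0) := by
      rw [quad, clamp_of_le (x := s - 1) (by linarith), clamp_of_le (x := s - 2) (by linarith),
        clamp_of_le (x := s - 3) (by linarith)]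
      simp
    rw [this]; exact hseg 0 1 _
  rcases le_total (s : ℝ) 2 with h2 | h2
  · refine ⟨1, ?_⟩
    have : quad b s = b 1 + clamp (s - 1) • (b 2 - b 1) := by
      rw [quad, clamp_of_ge (x := s) (by linarith), clamp_of_le (x := s - 2) (by linarith),
        clamp_of_le (x := s - 3) (by linarith)]
      simp
    rw [this]; exact hseg 1 2 _
  rcases le_total (s : ℝ) 3 with h3 | h3
  · refine ⟨2, ?_⟩
    have : quad b s = b 2 + clamp (s - 2) • (b 3 - b 2) := by
      rw [quad, clamp_of_ge (x := s) (by linarith), clamp_of_ge (x := s - 1) (by linarith),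
        clamp_of_le (x := s - 3) (by linarith)]
      simp
    rw [this]; exact hseg 2 3 _
  · refine ⟨3, ?_⟩
    have : quad b s = b 3 + clamp (s - 3) • (b 0 - b 3) := by
      rw [quad, clamp_of_ge (x := s) (by linarith), clamp_of_ge (x := s - 1) (by linarith),
        clamp_of_ge (x := s - 2) (by linarith)]
      simp
    rw [this]; exact hseg 3 0 _

theorem continuous_quad : Continuous (Function.uncurry quad) := by
  have := continuous_clamp
  unfold quad Function.uncurry
  fun_prop

theorem quad_closed (b : Fin 4 → Space3) : quad b (loopPt 0) = quad b (loopPt 4) := by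
  rw [quad, quad, coe_loopPt le_rfl (by norm_num), coe_loopPt (by norm_num) le_rfl]
  rw [clamp_of_le (x := 0) le_rfl, clamp_of_le (x := 0 - 1) (by norm_num),
    clamp_of_le (x := 0 - 2) (by norm_num), clamp_of_le (x := 0 - 3) (by norm_num),
    clamp_of_ge (x := 4) (by norm_num), clamp_of_ge (x := 4 - 1) (by norm_num),
    clamp_of_ge (x := 4 - 2) (by norm_num), clamp_of_ge (x := 4 - 3) (by norm_num)]
  simp

/-- The phase of a quadrilateral along another one. -/
noncomputable def linkPhase (a b : Fin 4 → Space3) (s : LoopParam) : ℂ :=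
  phase fun m => a m - quad b s

theorem linkPhase_ne_zero {a b : Fin 4 → Space3}
    (h : ∀ m m', Disjoint (segment ℝ (a m) (a (m + 1))) (segment ℝ (b m') (b (m' + 1))))
    (s : LoopParam) : linkPhase a b s ≠ 0 := by
  apply phase_ne_zero
  intro m h0
  obtain ⟨m', hm'⟩ := quad_mem b s
  refine Set.disjoint_left.1 (h m m') ?_ hm'
  have := segment_translate_image ℝ (quad b s) (a m - quad b s) (a (m + 1) - quad b s)
  rw [add_sub_cancel, add_sub_cancel] at this
  rw [← this]
  exact ⟨0, h0, add_zero _⟩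

/-- While the edges stay disjoint, the phase is a homotopy of loops in the punctured plane, so the
vanishing of its winding number is preserved. -/
theorem hasClosedLog_linkPhase_of_isotopy {a b : I → Fin 4 → Space3} (ha : ∀ m, Continuous fun t => a t m)
    (hb : ∀ m, Continuous fun t => b t m)
    (h : ∀ t m m', Disjoint (segment ℝ (a t m) (a t (m + 1)))
      (segment ℝ (b t m') (b t (m' + 1)))) {t : I} (ht : HasClosedLog (linkPhase (a t) (b t)))
    (t' : I) : HasClosedLog (linkPhase (a t') (b t')) := by
  refine HasClosedLog.homotopy (F := fun t => linkPhase (a t) (b t)) ?_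
    (fun t s => linkPhase_ne_zero (h t) s) (fun t => ?_) ht t'
  · refine continuous_phase.comp (continuous_pi fun m => ?_)
    exact ((ha m).comp continuous_fst).sub (continuous_quad.comp
      (((continuous_pi hb).comp continuous_fst).prodMk continuous_snd))
  · simp only [linkPhase, quad_closed]

/-! ### Linked and unlinked unit squares. -/

/-- The viewpoint is the centre of the square; the solid angle is a hemisphere, half of it is π, and
the phase is negative. -/
theorem phase_square_inner : (phase fun m => ![0, -(1 / 2), -(1 / 2)] + ivec (squareCorner m)).re < 0 := by
  have hall : ∀ m, euclLen (![0, -(1 / 2), -(1 / 2)] + ivec (squareCorner m)) = √(1 / 2) := by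
    intro m
    rw [euclLen]
    congr 1
    fin_cases m <;> simp [squareCorner] <;> norm_num
  have hr : √(1 / 2 : ℝ) ^ 2 = 1 / 2 := Real.sq_sqrt (by norm_num)
  simp only [phase, pauli, hall, Matrix.trace_fin_two, Matrix.mul_apply, Fin.sum_univ_two]
  generalize √(1 / 2 : ℝ) = r at hr
  simp [squareCorner]
  ring_nf
  rw [show r ^ 4 = (r ^ 2) ^ 2 by ring, hr]
  norm_num

/-- The viewpoint lies in the plane of the square but outside it, where the solid angle is zero. -/
theorem phase_square_outer : 0 < (phase fun m => ![0, -(3 / 2), -(1 / 2)] + ivec (squareCorner m)).re := by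
  have h0 : euclLen (![0, -(3 / 2), -(1 / 2)] + ivec (squareCorner 0)) = √(5 / 2) := by
    rw [euclLen]; congr 1; simp [squareCorner]; norm_num
  have h1 : euclLen (![0, -(3 / 2), -(1 / 2)] + ivec (squareCorner 1)) = √(1 / 2) := by
    rw [euclLen]; congr 1; simp [squareCorner]; norm_num
  have h2 : euclLen (![0, -(3 / 2), -(1 / 2)] + ivec (squareCorner 2)) = √(1 / 2) := by
    rw [euclLen]; congr 1; simp [squareCorner]; norm_num
  have h3 : euclLen (![0, -(3 / 2), -(1 / 2)] + ivec (squareCorner 3)) = √(5 / 2) := by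
    rw [euclLen]; congr 1; simp [squareCorner]; norm_num
  have hr : √(1 / 2 : ℝ) ^ 2 = 1 / 2 := Real.sq_sqrt (by norm_num)
  have hs : √(5 / 2 : ℝ) ^ 2 = 5 / 2 := Real.sq_sqrt (by norm_num)
  have hr0 := Real.sqrt_nonneg (1 / 2 : ℝ)
  have hs0 := Real.sqrt_nonneg (5 / 2 : ℝ)
  simp only [phase, pauli, h0, h1, h2, h3, Matrix.trace_fin_two, Matrix.mul_apply,
    Fin.sum_univ_two]
  generalize √(1 / 2 : ℝ) = r at hr hr0
  generalize √(5 / 2 : ℝ) = s at hs hs0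
  simp [squareCorner]
  ring_nf
  rw [hr, hs]
  have := mul_nonneg hr0 hs0
  nlinarith

/-- Distinct axial lattice edges based at points with non-integer coordinate differences are
disjoint. -/
theorem disjoint_of_lattice_segments {p q : Space3} (h : ∀ c (m : ℤ), p c - q c ≠ m)
    {k k' l l' : Fin 3 → ℤ} {j j' : Fin 3} (hk : ∀ c, c ≠ j → k c = k' c)
    (hl : ∀ c, c ≠ j' → l c = l' c) :
    Disjoint (segment ℝ (p + ivec k) (p + ivec k')) (segment ℝ (q + ivec l) (q + ivec l')) := by
  rw [Set.disjoint_left]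
  intro x hx hx'
  obtain ⟨c, hc, hc'⟩ := exists_ne_ne j j'
  have aux : ∀ (p : Space3) (k k' : Fin 3 → ℤ), k c = k' c →
      x ∈ segment ℝ (p + ivec k) (p + ivec k') → x c = p c + k c := by
    intro p k k' h hx
    rw [segment_eq_image'] at hx
    obtain ⟨s, -, rfl⟩ := hx
    simp [h]
  have e1 := aux p k k' (hk c hc) hx
  have e2 := aux q l l' (hl c hc') hx'
  exact h c (l c - k c) (by push_cast; linarith)

theorem squareCorner_adj : ∀ m : Fin 4, ∃ j : Fin 3,
    squareCorner (m + 1) = squareCorner m + Pi.single j 1 ∨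
      squareCorner m = squareCorner (m + 1) + Pi.single j 1 := by
  decide

theorem squareCorner'_adj : ∀ m : Fin 4, ∃ j : Fin 3,
    squareCorner' (m + 1) = squareCorner' m + Pi.single j 1 ∨
      squareCorner' m = squareCorner' (m + 1) + Pi.single j 1 := by
  decide

theorem eq_of_adj {k k' : Fin 3 → ℤ} {j : Fin 3}
    (h : k' = k + Pi.single j 1 ∨ k = k' + Pi.single j 1) : ∀ c, c ≠ j → k c = k' c := by
  intro c hc
  rcases h with rfl | rfl <;> simp [hc]

/-- The standard pair of linked unit squares. -/
theorem not_hasClosedLog_linked (p : Space3) :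
    ¬HasClosedLog (linkPhase (fun m => p + ivec (squareCorner m))
      (fun m => (p + ![-(1 / 2), 1 / 2, 1 / 2]) + ivec (squareCorner' m))) := by
  set a : Fin 4 → Space3 := fun m => p + ivec (squareCorner m) with ha
  set b : Fin 4 → Space3 := fun m => (p + ![-(1 / 2), 1 / 2, 1 / 2]) + ivec (squareCorner' m)
    with hb
  have e : ∀ s, linkPhase a b s = phase fun m => (p - quad b s) + ivec (squareCorner m) := by
    intro s
    simp only [linkPhase, ha]
    congr 1
    funext m
    abel
  have q0 : ∀ s : LoopParam, (p - quad b s) 0 = 1 / 2 - clamp s + clamp (s - 2) := by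
    intro s
    simp [quad, hb, squareCorner', Matrix.vecHead, Matrix.vecTail]
    ring
  have q1 : ∀ s : LoopParam, (p - quad b s) 1 = -(1 / 2) - clamp (s - 1) + clamp (s - 3) := by
    intro s
    simp [quad, hb, squareCorner', Matrix.vecHead, Matrix.vecTail]
    ring
  have q2 : ∀ s : LoopParam, (p - quad b s) 2 = -(1 / 2) := by
    intro s
    simp [quad, hb, squareCorner', Matrix.vecHead, Matrix.vecTail]
  -- The second square crosses the plane of the first at parameter `1 / 2`, through the centre of
  -- the first, and returns at `5 / 2`, outside it. These are the two real values required by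
  -- `not_hasClosedLog`.
  have him : ∀ s, ∃ R : ℝ, 0 ≤ R ∧ (linkPhase a b s).im =
      (1 / 2 - clamp s + clamp (s - 2)) * R := by
    intro s
    refine ⟨2 * ∑ m, euclLen (p - quad b s + ivec (squareCorner m)),
      mul_nonneg zero_le_two (Finset.sum_nonneg fun m _ => euclLen_nonneg _), ?_⟩
    rw [e, phase_square_im, q0]
    ring
  refine not_hasClosedLog (a := 1 / 2) (b := 5 / 2) ?_ (by norm_num) (by norm_num) (by norm_num)
    ?_ ?_ ?_ ?_ ?_ ?_ ?_
  · refine continuous_phase.comp (continuous_pi fun m => continuous_const.sub ?_)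
    exact continuous_quad.comp (f := fun s => (b, s)) (by fun_prop)
  · intro s hs hs'
    obtain ⟨R, hR, hs2⟩ := him s
    rw [hs2]
    apply mul_nonpos_of_nonpos_of_nonneg _ hR
    rcases le_total (s : ℝ) 1 with h | h
    · rw [clamp_of_mem (by linarith) h, clamp_of_le (by linarith)]; linarith
    · rw [clamp_of_ge h]
      rcases le_total (s : ℝ) 2 with h' | h'
      · rw [clamp_of_le (by linarith)]; norm_num
      · rw [clamp_of_mem (by linarith) (by linarith)]; linarith
  · intro s hs
    obtain ⟨R, hR, hs2⟩ := him s
    rw [hs2]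
    apply mul_nonneg _ hR
    rw [clamp_of_mem s.2.1 (by linarith), clamp_of_le (by linarith)]
    linarith
  · intro s hs
    obtain ⟨R, hR, hs2⟩ := him s
    rw [hs2]
    apply mul_nonneg _ hR
    rw [clamp_of_ge (by linarith)]
    rcases le_total (s : ℝ) 3 with h' | h'
    · rw [clamp_of_mem (by linarith) (by linarith)]; linarith
    · rw [clamp_of_ge (by linarith)]; norm_num
  · simp only [linkPhase, quad_closed]
  · refine fun s => linkPhase_ne_zero (fun m m' => ?_) s
    obtain ⟨j, hj⟩ := squareCorner_adj m
    obtain ⟨j', hj'⟩ := squareCorner'_adj m'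
    refine disjoint_of_lattice_segments ?_ (eq_of_adj hj) (eq_of_adj hj')
    intro c m hm
    -- All coordinate differences of the base points are halves of odd integers.
    have h2 : ∃ N : ℤ, (2 * N + 1 : ℝ) = 2 * m := by
      fin_cases c
      · exact ⟨0, by rw [← hm]; simp⟩
      · exact ⟨-1, by rw [← hm]; simp; norm_num⟩
      · exact ⟨-1, by rw [← hm]; simp; norm_num⟩
    obtain ⟨N, hN⟩ := h2
    have h3 : 2 * N + 1 = 2 * m := by exact_mod_cast hN
    omega
  · rw [e]
    have : p - quad b (loopPt (1 / 2)) = ![0, -(1 / 2), -(1 / 2)] := by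
      have hc : (loopPt (1 / 2) : ℝ) = 1 / 2 := coe_loopPt (by norm_num) (by norm_num)
      funext c
      fin_cases c
      · simp only [Fin.zero_eta, q0, hc, Matrix.cons_val_zero]
        rw [clamp_of_mem (by norm_num) (by norm_num), clamp_of_le (by norm_num)]
        norm_num
      · simp only [Fin.mk_one, q1, hc, Matrix.cons_val_one, Matrix.cons_val_zero]
        rw [clamp_of_le (by norm_num), clamp_of_le (by norm_num)]
        norm_num
      · simpa using q2 _
    rw [this]
    exact phase_square_inner
  · rw [e]
    have : p - quad b (loopPt (5 / 2)) = ![0, -(3 / 2), -(1 / 2)] := by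
      have hc : (loopPt (5 / 2) : ℝ) = 5 / 2 := coe_loopPt (by norm_num) (by norm_num)
      funext c
      fin_cases c
      · simp only [Fin.zero_eta, q0, hc, Matrix.cons_val_zero]
        rw [clamp_of_ge (by norm_num), clamp_of_mem (by norm_num) (by norm_num)]
        norm_num
      · simp only [Fin.mk_one, q1, hc, Matrix.cons_val_one, Matrix.cons_val_zero]
        rw [clamp_of_ge (by norm_num), clamp_of_le (by norm_num)]
        norm_num
      · simpa using q2 _
    rw [this]
    exact phase_square_outer

/-- A unit square can be contracted in its disk if this disk avoids another square. -/
theorem hasClosedLog_unlinked {p q : Space3} (h : q 0 + 1 < p 0 ∨ p 0 < q 0) :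
    HasClosedLog (linkPhase (fun m => p + ivec (squareCorner m))
      (fun m => q + ivec (squareCorner' m))) := by
  -- Shrinking the second square to its corner `q` keeps its first coordinates in `[q 0, q 0 + 1]`,
  -- off the plane of the first square. At `t = 0` the phase is a nonzero constant.
  set b : I → Fin 4 → Space3 := fun t m => q + (t : ℝ) • ivec (squareCorner' m) with hb
  have h1 : (fun m => q + ivec (squareCorner' m)) = b 1 := by
    funext m; simp [hb]
  rw [h1]
  have hdisj : ∀ t m m', Disjoint (segment ℝ (p + ivec (squareCorner m))
      (p + ivec (squareCorner (m + 1)))) (segment ℝ (b t m') (b t (m' + 1))) := by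
    intro t m m'
    rw [Set.disjoint_left]
    intro x hx hx'
    rw [segment_eq_image'] at hx hx'
    obtain ⟨s, hs, rfl⟩ := hx
    obtain ⟨s', hs', hx'⟩ := hx'
    have h2 := congrFun hx' 0
    have c0 : ∀ m, squareCorner m 0 = 0 := by decide
    have c0' : ∀ m, squareCorner' m 0 = 0 ∨ squareCorner' m 0 = 1 := by decide
    have ht0 := t.2.1
    have ht1 := t.2.2
    have hs0 := hs'.1
    have hs1 := hs'.2
    have hts := mul_nonneg hs0 ht0
    rcases c0' m' with e1 | e1 <;> rcases c0' (m' + 1) with e2 | e2 <;>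
      simp [hb, c0, e1, e2] at h2 <;> rcases h with h | h <;> nlinarith
  refine hasClosedLog_linkPhase_of_isotopy (a := fun _ m => p + ivec (squareCorner m)) (b := b)
    (t := 0) (fun m => continuous_const) (fun m => ?_) hdisj ?_ 1
  · simp only [hb]
    fun_prop
  · have hconst : ∀ s, quad (b 0) s = q := by
      intro s
      simp [quad, hb]
    have : linkPhase (fun m => p + ivec (squareCorner m)) (b 0) =
        fun _ => phase fun m => p + ivec (squareCorner m) - q := by
      funext s
      simp only [linkPhase, hconst]
    rw [this]
    have h3 := linkPhase_ne_zero (hdisj 0) (loopPt 0)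
    simp only [linkPhase, hconst] at h3
    exact hasClosedLog_const h3

/-! ### Relative position of two lattices as a linking invariant. -/

/-- Two families of moving axial lattices with disjoint edges stay in the same relative position:
the case of the standard relative position and the first coordinate. -/
theorem floor_eq_of_lattice_isotopy_aux {P Q : I → (Fin 3 → ℤ) → Space3} {p q p' q' : Space3}
    (hP : ∀ k, Continuous fun t => P t k) (hQ : ∀ k, Continuous fun t => Q t k)
    (hP0 : ∀ k, P 0 k = p + ivec k) (hQ0 : ∀ k, Q 0 k = q + ivec k)
    (hP1 : ∀ k, P 1 k = p' + ivec k) (hQ1 : ∀ k, Q 1 k = q' + ivec k)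
    (hdisj : ∀ t k j l j', Disjoint (segment ℝ (P t k) (P t (k + Pi.single j 1)))
      (segment ℝ (Q t l) (Q t (l + Pi.single j' 1))))
    (h' : ∀ c (m : ℤ), q' c - p' c ≠ m)
    (h0 : -1 < q 0 - p 0 ∧ q 0 - p 0 < 0) (h1 : 0 < q 1 - p 1 ∧ q 1 - p 1 < 1)
    (h2 : 0 < q 2 - p 2 ∧ q 2 - p 2 < 1) : ⌊q' 0 - p' 0⌋ = -1 := by
  by_contra hne
  -- If the final floor is not `-1`, the second square misses the plane of the first, whatever the
  -- other coordinates are. So the squares are unlinked at the end, and hence at the start.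
  have hunl : q' 0 + 1 < p' 0 ∨ p' 0 < q' 0 := by
    by_contra! hcon
    have a0 := h' 0 0
    have a1 := h' 0 (-1)
    push_cast at a0 a1
    apply hne
    rw [Int.floor_eq_iff]
    push_cast
    exact ⟨by linarith, lt_of_le_of_ne (by linarith) (by simpa using a0)⟩
  have hlog := hasClosedLog_unlinked hunl
  have hseg : ∀ (R : (Fin 3 → ℤ) → Space3) (k k' : Fin 3 → ℤ) (j : Fin 3),
      (k' = k + Pi.single j 1 ∨ k = k' + Pi.single j 1) →
      ∃ l, segment ℝ (R k) (R k') = segment ℝ (R l) (R (l + Pi.single j 1)) := by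
    rintro R k k' j (rfl | rfl)
    · exact ⟨k, rfl⟩
    · exact ⟨k', segment_symm ℝ _ _⟩
  have hlog0 : HasClosedLog (linkPhase (fun m => P 0 (squareCorner m))
      (fun m => Q 0 (squareCorner' m))) := by
    refine hasClosedLog_linkPhase_of_isotopy (a := fun t m => P t (squareCorner m))
      (b := fun t m => Q t (squareCorner' m)) (t := 1) (fun m => hP _) (fun m => hQ _)
      (fun t m m' => ?_) ?_ 0
    · obtain ⟨j, hj⟩ := squareCorner_adj m
      obtain ⟨j', hj'⟩ := squareCorner'_adj m'
      obtain ⟨k, hk⟩ := hseg (P t) _ _ j hj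
      obtain ⟨l, hl⟩ := hseg (Q t) _ _ j' hj'
      rw [hk, hl]
      exact hdisj t k j l j'
    · simpa only [hP1, hQ1] using hlog
  simp only [hP0, hQ0] at hlog0
  set w : Space3 := p + ![-(1 / 2), 1 / 2, 1 / 2] with hw
  -- The initial relative position lies in the box `(-1, 0) × (0, 1) × (0, 1)`, which is convex and
  -- avoids integer coordinates. Moving straight to its centre gives the standard linked pair, a
  -- contradiction.
  refine not_hasClosedLog_linked p (hasClosedLog_linkPhase_of_isotopy
    (a := fun _ m => p + ivec (squareCorner m))
    (b := fun t m => (q + (t : ℝ) • (w - q)) + ivec (squareCorner' m)) (t := 0)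
    (fun m => continuous_const) (fun m => by fun_prop) (fun t m m' => ?_)
    (by simpa using hlog0) 1 |> fun h => by simpa [hw] using h)
  obtain ⟨j, hj⟩ := squareCorner_adj m
  obtain ⟨j', hj'⟩ := squareCorner'_adj m'
  refine disjoint_of_lattice_segments ?_ (eq_of_adj hj) (eq_of_adj hj')
  have conv : ∀ x y : ℝ, ∀ N : ℤ, (N : ℝ) < x → x < N + 1 → (N : ℝ) < y → y < N + 1 → ∀ m : ℤ,
      -(x + t * (y - x)) ≠ m := by
    intro x y N h1 h2 h3 h4 m hm
    obtain ⟨l1, l2⟩ := (convex_Ioo (N : ℝ) (N + 1)).add_smul_sub_mem ⟨h1, h2⟩ ⟨h3, h4⟩ t.2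
    rw [smul_eq_mul, show x + t * (y - x) = -m by linarith] at l1 l2
    have l1' : N < -m := by exact_mod_cast l1
    have l2' : -m < N + 1 := by exact_mod_cast l2
    omega
  intro c m hm
  fin_cases c
  · refine conv (q 0 - p 0) (-(1 / 2)) (-1) (by push_cast; linarith) (by push_cast; linarith)
      (by norm_num) (by norm_num) m ?_
    rw [← hm]
    simp [hw, Matrix.vecHead, Matrix.vecTail]
    ring
  · refine conv (q 1 - p 1) (1 / 2) 0 (by push_cast; linarith) (by push_cast; linarith)
      (by norm_num) (by norm_num) m ?_
    rw [← hm]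
    simp [hw, Matrix.vecHead, Matrix.vecTail]
    ring
  · refine conv (q 2 - p 2) (1 / 2) 0 (by push_cast; linarith) (by push_cast; linarith)
      (by norm_num) (by norm_num) m ?_
    rw [← hm]
    simp [hw, Matrix.vecHead, Matrix.vecTail]
    ring

/-- Two families of moving axial lattices with disjoint edges stay in the same relative
position. -/
theorem floor_eq_of_lattice_isotopy {P Q : I → (Fin 3 → ℤ) → Space3} {p q p' q' : Space3}
    (hP : ∀ k, Continuous fun t => P t k) (hQ : ∀ k, Continuous fun t => Q t k)
    (hP0 : ∀ k, P 0 k = p + ivec k) (hQ0 : ∀ k, Q 0 k = q + ivec k)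
    (hP1 : ∀ k, P 1 k = p' + ivec k) (hQ1 : ∀ k, Q 1 k = q' + ivec k)
    (hdisj : ∀ t k j l j', Disjoint (segment ℝ (P t k) (P t (k + Pi.single j 1)))
      (segment ℝ (Q t l) (Q t (l + Pi.single j' 1))))
    (h : ∀ c (m : ℤ), q c - p c ≠ m) (h' : ∀ c (m : ℤ), q' c - p' c ≠ m) (c : Fin 3) :
    ⌊q c - p c⌋ = ⌊q' c - p' c⌋ := by
  set τ : Equiv.Perm (Fin 3) := Equiv.swap 0 c with hτ
  have hττ : ∀ {α : Type} (k : Fin 3 → α), (k ∘ τ) ∘ τ = k := by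
    intro α k; funext i; simp [hτ]
  let T : Space3 →ₗ[ℝ] Space3 := LinearMap.funLeft ℝ ℝ τ
  have hT : ∀ x c, T x c = x (τ c) := fun x c => rfl
  have hTinj : Function.Injective T := LinearMap.funLeft_injective_of_surjective _ _ _ τ.surjective
  have hTc : Continuous T := LinearMap.continuous_of_finiteDimensional T
  have hTiv : ∀ k, T (ivec (k ∘ τ)) = ivec k := by
    intro k; funext i; simp [hT, hτ]
  have hsingle : ∀ (k : Fin 3 → ℤ) (j : Fin 3),
      (k + Pi.single j 1) ∘ τ = k ∘ τ + Pi.single (τ j) 1 := by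
    intro k j
    funext i
    simp only [Function.comp, Pi.add_apply, Pi.single_apply]
    have : τ i = j ↔ i = τ j := by
      constructor
      · rintro rfl; simp [hτ]
      · rintro rfl; simp [hτ]
    simp only [this]
  let D : Fin 3 → ℤ := fun i => ⌊q i - p i⌋
  -- Exchanging the axes `0` and `c` and relabelling the second lattice by `v` turns the initial
  -- floors into `-1, 0, 0`. The exchange may reverse orientation, which does no harm here.
  let v : Fin 3 → ℤ := fun i => (if i = 0 then -1 else 0) - D (τ i)
  have hv : ∀ i, v i = (if i = 0 then -1 else 0) - D (τ i) := fun i => rfl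
  have hfrac : ∀ i, (D i : ℝ) < q i - p i ∧ q i - p i < D i + 1 := fun i =>
    ⟨lt_of_le_of_ne (Int.floor_le _) (h i _).symm, Int.lt_floor_add_one _⟩
  have him : ∀ x y, T '' segment ℝ x y = segment ℝ (T x) (T y) := fun x y => by
    simpa using image_segment ℝ T.toAffineMap x y
  have key := floor_eq_of_lattice_isotopy_aux (P := fun t k => T (P t (k ∘ τ)))
    (Q := fun t k => T (Q t ((k + v) ∘ τ))) (p := T p) (q := T q + ivec v) (p' := T p')
    (q' := T q' + ivec v) (fun k => hTc.comp (hP _)) (fun k => hTc.comp (hQ _))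
    (fun k => by rw [hP0, map_add, hTiv])
    (fun k => by rw [hQ0, map_add, hTiv, ivec_add, add_assoc, add_comm (ivec k)])
    (fun k => by rw [hP1, map_add, hTiv])
    (fun k => by rw [hQ1, map_add, hTiv, ivec_add, add_assoc, add_comm (ivec k)])
    (fun t k j l j' => by
      rw [hsingle, add_right_comm, hsingle (l + v), ← him, ← him]
      exact (Set.disjoint_image_iff hTinj).2 (hdisj t _ _ _ _))
    (fun c m hm => h' (τ c) (m - v c) (by
      simp only [Pi.add_apply, hT, ivec_apply] at hm
      push_cast
      linarith))
    (by
      have := hfrac (τ 0)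
      simp only [Pi.add_apply, hT, ivec_apply, hv]
      push_cast
      constructor <;> simp <;> linarith)
    (by
      have := hfrac (τ 1)
      simp only [Pi.add_apply, hT, ivec_apply, hv]
      push_cast
      constructor <;> simp <;> linarith)
    (by
      have := hfrac (τ 2)
      simp only [Pi.add_apply, hT, ivec_apply, hv]
      push_cast
      constructor <;> simp <;> linarith)
  have hτ0 : τ 0 = c := by simp [hτ]
  simp only [Pi.add_apply, hT, ivec_apply, hτ0] at key
  have e : q' c + v 0 - p' c = (q' c - p' c) + v 0 := by ring
  rw [e, Int.floor_add_intCast, hv, hτ0] at key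
  simp only [if_true] at key
  change D c = _
  linarith

/-! ### Paths of matrices with positive determinant -/

/-- In general `det (x + y X) = x³ + x² y tr X + x y² tr (adj X) + y³ det X`, and for a rotation the
adjugate is the transpose. The straight path from the identity thus has positive determinant when
the trace is nonnegative. -/
theorem IsIntegerRotation.det_path {X : Matrix (Fin 3) (Fin 3) ℤ} (hX : IsIntegerRotation X)
    (t : ℝ) : ((1 - t) • (1 : Matrix (Fin 3) (Fin 3) ℝ) + t • X.map (Int.cast : ℤ → ℝ)).det =
      (1 - t) ^ 3 + (1 - t) * t * (X.trace : ℝ) + t ^ 3 := by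
  have hadj : X.adjugate = X.transpose := by
    have h1 : X * X.adjugate = 1 := by rw [Matrix.mul_adjugate, hX.2, one_smul]
    calc X.adjugate = X.transpose * X * X.adjugate := by rw [hX.transpose_mul, Matrix.one_mul]
      _ = X.transpose := by rw [Matrix.mul_assoc, h1, Matrix.mul_one]
  have htr : ((X 1 1 * X 2 2 - X 1 2 * X 2 1) + (X 0 0 * X 2 2 - X 0 2 * X 2 0) +
      (X 0 0 * X 1 1 - X 0 1 * X 1 0) : ℤ) = X.trace := by
    have h2 := congrArg Matrix.trace hadj
    rw [Matrix.trace_transpose] at h2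
    rw [← h2, Matrix.adjugate_fin_three]
    simp [Matrix.trace_fin_three]
  have hdet := hX.2
  rw [Matrix.det_fin_three] at hdet
  have htr' : (((X 1 1 * X 2 2 - X 1 2 * X 2 1) + (X 0 0 * X 2 2 - X 0 2 * X 2 0) +
      (X 0 0 * X 1 1 - X 0 1 * X 1 0) : ℤ) : ℝ) = (X.trace : ℤ) := by rw [htr]
  have hdet' := congrArg (Int.cast : ℤ → ℝ) hdet
  have htrace : ((X.trace : ℤ) : ℝ) = X 0 0 + X 1 1 + X 2 2 := by
    rw [Matrix.trace_fin_three]; push_cast; ring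
  rw [htrace] at htr' ⊢
  push_cast at htr' hdet'
  rw [Matrix.det_fin_three]
  simp
  linear_combination (t ^ 3) * hdet' + (1 - t) * t ^ 2 * htr'

/-- The quarter turns about the three axes. -/
def quarterTurn : Fin 3 → Matrix (Fin 3) (Fin 3) ℤ :=
  ![!![1, 0, 0; 0, 0, -1; 0, 1, 0], !![0, 0, 1; 0, 1, 0; -1, 0, 0], !![0, -1, 0; 1, 0, 0; 0, 0, 1]]

theorem isIntegerRotation_quarterTurn (i : Fin 3) : IsIntegerRotation (quarterTurn i) := by
  fin_cases i
  all_goals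
    refine ⟨by decide, ?_⟩
    rw [Matrix.det_fin_three]
    decide

/-- Half turns have trace `-1`, and the straight path to them degenerates at its midpoint. Splitting
off a suitable quarter turn leaves a rotation of nonnegative trace. -/
theorem exists_quarterTurn_trace (π : Equiv.Perm (Fin 3)) (ε : Fin 3 → Bool)
    (X : Matrix (Fin 3) (Fin 3) ℤ)
    (hX : X = Matrix.of fun i j => if j = π i then (if ε i then 1 else -1) else 0)
    (hdet : X.det = 1) :
    0 ≤ X.trace ∨ ∃ i, 0 ≤ ((quarterTurn i).transpose * X).trace := by
  rw [Matrix.det_fin_three] at hdet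
  subst hX
  revert π ε
  decide

theorem IsIntegerRotation.trace_cases {X : Matrix (Fin 3) (Fin 3) ℤ} (hX : IsIntegerRotation X) :
    0 ≤ X.trace ∨ ∃ i, 0 ≤ ((quarterTurn i).transpose * X).trace := by
  obtain ⟨π, ε, hε, h⟩ := hX.exists_perm
  refine exists_quarterTurn_trace π (fun i => decide (ε i = 1)) X ?_ hX.2
  ext i j
  rw [h]
  rcases hε i with h' | h' <;> simp [h']

/-- An integer rotation is joined to the identity by matrices of positive determinant. -/
theorem IsIntegerRotation.exists_path {X : Matrix (Fin 3) (Fin 3) ℤ} (hX : IsIntegerRotation X) :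
    ∃ R : I → Matrix (Fin 3) (Fin 3) ℝ, Continuous R ∧ R 0 = 1 ∧
      R 1 = X.map (Int.cast : ℤ → ℝ) ∧ ∀ t, 0 < (R t).det := by
  have key : ∀ Y : Matrix (Fin 3) (Fin 3) ℤ, IsIntegerRotation Y → 0 ≤ Y.trace →
      ∃ R : I → Matrix (Fin 3) (Fin 3) ℝ, Continuous R ∧ R 0 = 1 ∧
      R 1 = Y.map (Int.cast : ℤ → ℝ) ∧ ∀ t, 0 < (R t).det := by
    intro Y hY htr
    refine ⟨fun t => (1 - t : ℝ) • 1 + (t : ℝ) • Y.map (Int.cast : ℤ → ℝ), by fun_prop,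
      by simp, by simp, fun t => ?_⟩
    rw [hY.det_path]
    have ht0 := t.2.1
    have ht1 := t.2.2
    have htr' : (0 : ℝ) ≤ (Y.trace : ℤ) := by exact_mod_cast htr
    have h1 : 0 ≤ (1 - (t : ℝ)) * t * (Y.trace : ℤ) :=
      mul_nonneg (mul_nonneg (by linarith) ht0) htr'
    nlinarith [sq_nonneg ((t : ℝ) - 1 / 2)]
  rcases hX.trace_cases with h | ⟨i, h⟩
  · exact key X hX h
  · have hY := isIntegerRotation_quarterTurn i
    obtain ⟨R, hR, hR0, hR1, hRd⟩ := key (quarterTurn i) hY (by clear h hY; revert i; decide)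
    obtain ⟨S, hS, hS0, hS1, hSd⟩ := key _ (hY.transpose.mul hX) h
    refine ⟨fun t => R t * S t, hR.matrix_mul hS, by simp [hR0, hS0], ?_, fun t => ?_⟩
    · have e : (fun t => R t * S t) 1 = (quarterTurn i * ((quarterTurn i).transpose * X)).map
          (Int.cast : ℤ → ℝ) := by
        simp only [hR1, hS1]
        exact (Matrix.map_mul (f := Int.castRingHom ℝ)).symm
      rw [e, ← Matrix.mul_assoc, hY.1, Matrix.one_mul]
    · rw [Matrix.det_mul]
      exact mul_pos (hRd t) (hSd t)

/-! ### Automorphisms of the cubic lattice graph -/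

theorem eq_of_lattice_invariant {β : Type*} (g : (Fin 3 → ℤ) → β)
    (h : ∀ k j, g (k + Pi.single j 1) = g k) (k : Fin 3 → ℤ) : g k = g 0 := by
  have h1 : ∀ (j : Fin 3) (m : ℤ) (k : Fin 3 → ℤ), g (k + Pi.single j m) = g k := by
    intro j m
    induction m using Int.induction_on with
    | zero => intro k; simp
    | succ m ih =>
      intro k
      rw [Pi.single_add, ← add_assoc, h, ih]
    | pred m ih =>
      intro k
      have := h (k + Pi.single j (-(m : ℤ) - 1)) j
      rw [add_assoc, ← Pi.single_add, sub_add_cancel, ih] at this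
      exact this.symm
  have h2 : k = 0 + Pi.single 0 (k 0) + Pi.single 1 (k 1) + Pi.single 2 (k 2) := by
    funext c
    fin_cases c <;> simp
  rw [h2, h1, h1, h1]

/-- The six unit vectors of the cubic lattice. -/
def unitStep (u : Fin 3 × Bool) : Fin 3 → ℤ := Pi.single u.1 (if u.2 then 1 else -1)

/-- The opposite direction. -/
def oppStep (u : Fin 3 × Bool) : Fin 3 × Bool := (u.1, !u.2)

theorem unitStep_injective : Function.Injective unitStep := by
  unfold Function.Injective
  decide

theorem unitStep_oppStep (u : Fin 3 × Bool) : unitStep (oppStep u) = -unitStep u := by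
  revert u
  decide

theorem oppStep_oppStep (u : Fin 3 × Bool) : oppStep (oppStep u) = u := by
  simp [oppStep]

/-- In a nondegenerate four-cycle of the lattice, opposite sides are parallel. -/
theorem unitStep_square {a b c d : Fin 3 × Bool}
    (h : unitStep a + unitStep b = unitStep c + unitStep d) (hac : a ≠ c) (hb : b ≠ oppStep a) :
    d = a := by
  have aux : ∀ a b c d : Fin 3 × Bool, a ≠ c → b ≠ oppStep a →
      unitStep a + unitStep b = unitStep c + unitStep d → d = a := by
    set_option maxRecDepth 100000 in decide
  exact aux a b c d hac hb h

/-- The points `a` and `-a` have the origin as their only common neighbour. -/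
theorem unitStep_straight {a x y : Fin 3 × Bool}
    (h : unitStep a + unitStep x = -unitStep a + unitStep y) : x = oppStep a := by
  revert a x y
  set_option maxRecDepth 100000 in decide

theorem unitStep_dotProduct (a b : Fin 3 × Bool) :
    unitStep a ⬝ᵥ unitStep b = if a = b then 1 else if b = oppStep a then -1 else 0 := by
  revert a b
  decide

/-- Injective graph endomorphisms of the cubic lattice are given by signed permutation
matrices. -/
theorem exists_matrix_of_lattice_hom {h : (Fin 3 → ℤ) → (Fin 3 → ℤ)} (hinj : Function.Injective h)
    (hadj : ∀ k j, ∃ u, h (k + Pi.single j 1) = h k + unitStep u) (h0 : h 0 = 0) :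
    ∃ X : Matrix (Fin 3) (Fin 3) ℤ, X * X.transpose = 1 ∧ ∀ k, h k = X.mulVec k := by
  have hadj' : ∀ k u, ∃ u', h (k + unitStep u) = h k + unitStep u' := by
    rintro k ⟨j, b⟩
    cases b
    · obtain ⟨u, hu⟩ := hadj (k + unitStep (j, false)) j
      refine ⟨oppStep u, ?_⟩
      have e : k + unitStep (j, false) + Pi.single j 1 = k := by
        simp [unitStep, add_assoc, ← Pi.single_add]
      rw [e] at hu
      rw [hu, unitStep_oppStep]
      abel
    · exact hadj k j
  choose D hD using hadj'
  have hDinj : ∀ k, Function.Injective (D k) := by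
    intro k u u' huu
    have h1 := hD k u
    rw [huu, ← hD k u'] at h1
    exact unitStep_injective (add_left_cancel (hinj h1))
  have hDsurj : ∀ k, Function.Surjective (D k) := fun k => Finite.injective_iff_surjective.1 (hDinj k)
  -- Let `w` be the direction sent opposite to the image of `u`. The images of `k + u` and `k + w`
  -- then have `h k` as their only common neighbour, so `k + u + w` is sent to `h k`, and
  -- injectivity gives `w = -u`.
  have hopp : ∀ k u, D k (oppStep u) = oppStep (D k u) := by
    intro k u
    obtain ⟨w, hw⟩ := hDsurj k (oppStep (D k u))
    have hx := hD (k + unitStep u) w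
    have hy := hD (k + unitStep w) u
    rw [hD k u] at hx
    rw [hD k w, hw, unitStep_oppStep, add_right_comm, hx, add_assoc, add_assoc] at hy
    have h1 := unitStep_straight (add_left_cancel hy)
    rw [h1, unitStep_oppStep, add_neg_cancel_right] at hx
    have h2 := hinj hx
    rw [add_assoc, add_eq_left] at h2
    have h3 : w = oppStep u := unitStep_injective (by
      rw [unitStep_oppStep]; exact eq_neg_of_add_eq_zero_right h2)
    rw [← h3, hw]
  have hback : ∀ k u, D (k + unitStep u) (oppStep u) = oppStep (D k u) := by
    intro k u
    have h1 := hD (k + unitStep u) (oppStep u)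
    rw [unitStep_oppStep, add_neg_cancel_right, hD k u, add_assoc] at h1
    apply unitStep_injective
    rw [unitStep_oppStep]
    exact eq_neg_of_add_eq_zero_right (left_eq_add.1 h1)
  have hstraight : ∀ k u, D (k + unitStep u) u = D k u := by
    intro k u
    have h1 := hback k u
    rw [hopp] at h1
    rw [← oppStep_oppStep (D (k + unitStep u) u), h1, oppStep_oppStep]
  -- Parallel transport: for `u'` different from `±u`, the four-cycle spanned by `u` and `u'` has a
  -- nondegenerate image, with parallel opposite sides.
  have hconst : ∀ k u u', D (k + unitStep u') u = D k u := by
    intro k u u'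
    by_cases h1 : u' = u
    · rw [h1, hstraight]
    by_cases h2 : u' = oppStep u
    · have h3 := hstraight k (oppStep u)
      rw [hopp, hopp k] at h3
      rw [h2, ← oppStep_oppStep (D _ u), h3, oppStep_oppStep]
    have e1 := hD (k + unitStep u) u'
    have e2 := hD (k + unitStep u') u
    rw [add_right_comm, e2, hD k u, hD k u', add_assoc, add_assoc] at e1
    refine unitStep_square (add_left_cancel e1).symm (fun h => h1 (hDinj k h).symm) (fun h3 => ?_)
    have e3 := hD (k + unitStep u) u'
    rw [h3, hD k u, unitStep_oppStep, add_neg_cancel_right] at e3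
    have e4 := hinj e3
    rw [add_assoc, add_eq_left] at e4
    exact h2 (unitStep_injective (by
      rw [unitStep_oppStep]; exact eq_neg_of_add_eq_zero_right e4))
  have hD0 : ∀ k u, D k u = D 0 u := fun k u =>
    eq_of_lattice_invariant (fun k => D k u) (fun k j => hconst k u (j, true)) k
  let X : Matrix (Fin 3) (Fin 3) ℤ := Matrix.of fun i j => unitStep (D 0 (j, true)) i
  refine ⟨X, ?_, ?_⟩
  · rw [mul_eq_one_comm]
    ext i j
    have e : (X.transpose * X) i j = unitStep (D 0 (i, true)) ⬝ᵥ unitStep (D 0 (j, true)) := rfl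
    rw [e, unitStep_dotProduct, Matrix.one_apply]
    by_cases hij : i = j
    · simp [hij]
    · rw [if_neg hij, if_neg (fun h => hij (congrArg Prod.fst (hDinj 0 h))), if_neg]
      rw [← hopp]
      intro h
      have := congrArg Prod.snd (hDinj 0 h)
      simp [oppStep] at this
  · intro k
    have h1 := eq_of_lattice_invariant (fun k => h k - X.mulVec k) (fun k j => by
      have e : k + Pi.single j 1 = k + unitStep (j, true) := by simp [unitStep]
      have e2 : X.mulVec (Pi.single j 1) = unitStep (D 0 (j, true)) := by
        rw [Matrix.mulVec_single_one]; rfl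
      simp only [Matrix.mulVec_add, e2]
      rw [e, hD, hD0]
      abel) k
    simp only [h0, Matrix.mulVec_zero, sub_zero] at h1
    exact sub_eq_zero.1 h1

/-! ### Consequences of periodic isotopy -/

theorem axisEdge_mem_gridNet {n : ℕ} (p : Fin n → Space3) (i : Fin n) (k : Fin 3 → ℤ) (j : Fin 3) :
    segment ℝ (p i + ivec k) (p i + ivec (k + Pi.single j 1)) ∈ (gridNet p).edges :=
  ⟨i, k, j, by rw [axisEdge, ivec_add, ivec_single, add_assoc]⟩

theorem node_mem_gridNet {n : ℕ} (p : Fin n → Space3) (i : Fin n) (k : Fin 3 → ℤ) :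
    p i + ivec k ∈ (gridNet p).nodes := ⟨i, k, rfl⟩

theorem IsGeneric.eq_of_node_eq {n : ℕ} {p : Fin n → Space3} (hp : IsGeneric p) {i i' : Fin n}
    {k k' : Fin 3 → ℤ} (h : p i + ivec k = p i' + ivec k') : i = i' ∧ k = k' := by
  have hi : i = i' := by
    by_contra hne
    have := congrFun h 0
    simp only [Pi.add_apply, ivec_apply] at this
    exact hp i i' hne 0 (k' 0 - k 0) (by push_cast; linarith)
  subst hi
  exact ⟨rfl, ivec_injective (add_left_cancel h)⟩

/-- The data of a periodic isotopy which starts at a grid, in terms of the motion of the nodes. -/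
theorem PeriodicallyIsotopic.exists_node_motion {n : ℕ} {p : Fin n → Space3} (hp : IsGeneric p)
    {K' : LineNet Space3} (h : PeriodicallyIsotopic (gridNet p) K') :
    ∃ (F : I → Fin n → (Fin 3 → ℤ) → Space3) (a : I → Module.Basis (Fin 3) ℝ Space3),
      (∀ i k, Continuous fun t => F t i k) ∧
      (∀ i k, F 0 i k = p i + ivec k) ∧
      (∀ t, RightHanded (a t)) ∧
      (∀ t i k i' k', F t i k = F t i' k' → i = i' ∧ k = k') ∧
      (∀ i k, F 1 i k ∈ K'.nodes) ∧
      (∀ i k j, segment ℝ (F 1 i k) (F 1 i (k + Pi.single j 1)) ∈ K'.edges) ∧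
      (∀ t i i', i ≠ i' → ∀ k j k' j', Disjoint (segment ℝ (F t i k) (F t i (k + Pi.single j 1)))
        (segment ℝ (F t i' k') (F t i' (k' + Pi.single j' 1)))) ∧
      (∀ i k c, ∃ i' k', ∀ t, F t i k + a t c = F t i' k') := by
  obtain ⟨K, a, f, hK0, hK1, hnet, hper, hright, hacont, hbij, hnodes, hf0, hfcont, hedge⟩ := h
  have hbody : ∀ i k, p i + ivec k ∈ (gridNet p).body := fun i k =>
    Or.inl (node_mem_gridNet p i k)
  have hinj : ∀ t i k i' k', f t (p i + ivec k) = f t (p i' + ivec k') → i = i' ∧ k = k' :=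
    fun t i k i' k' h => hp.eq_of_node_eq ((hbij t).injOn (hbody _ _) (hbody _ _) h)
  have hcont : ∀ i k, Continuous fun t => f t (p i + ivec k) := fun i k =>
    hfcont _ (node_mem_gridNet p i k)
  have hseg : ∀ t i k j, ∀ x ∈ segment ℝ (f t (p i + ivec k)) (f t (p i + ivec (k + Pi.single j 1))),
      ∃ y ∈ axisEdge (p i + ivec k) j, f t y = x := by
    intro t i k j x hx
    rw [segment_eq_image_lineMap] at hx
    obtain ⟨s, hs, rfl⟩ := hx
    refine ⟨_, ?_, (hedge t _ _ (axisEdge_mem_gridNet p i k j)).2 s hs⟩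
    rw [axisEdge, add_assoc, ← ivec_single, ← ivec_add, segment_eq_image_lineMap]
    exact ⟨s, hs, rfl⟩
  have hedgebody : ∀ i k j, axisEdge (p i + ivec k) j ⊆ (gridNet p).body := fun i k j =>
    fun y hy => Or.inr ⟨_, ⟨i, k, j, rfl⟩, hy⟩
  -- Nodes are only required to go to nodes. That all nodes of `K t` arise in this way holds because
  -- a node lying on an edge is one of its endpoints.
  have hsurj : ∀ t, ∀ y ∈ (K t).nodes, ∃ i k, y = f t (p i + ivec k) := by
    intro t y hy
    obtain ⟨z, hz, rfl⟩ := (hbij t).surjOn (Or.inl hy)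
    rcases hz with ⟨i, k, rfl⟩ | ⟨_, ⟨i, k, j, rfl⟩, hz⟩
    · exact ⟨i, k, rfl⟩
    obtain ⟨he, hs⟩ := hedge t _ _ (axisEdge_mem_gridNet p i k j)
    have hmem : f t z ∈ segment ℝ (f t (p i + ivec k)) (f t (p i + ivec (k + Pi.single j 1))) := by
      rw [axisEdge, add_assoc, ← ivec_single, ← ivec_add, segment_eq_image_lineMap] at hz
      obtain ⟨s, hs', rfl⟩ := hz
      rw [hs s hs', segment_eq_image_lineMap]
      exact ⟨s, hs', rfl⟩
    rw [(hnet t).nodes_eq] at hy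
    obtain ⟨w, hw⟩ := hy
    have : f t z = f t (p i + ivec k) ∨ f t z = f t (p i + ivec (k + Pi.single j 1)) := by
      by_cases heq : segment ℝ (f t z) w =
          segment ℝ (f t (p i + ivec k)) (f t (p i + ivec (k + Pi.single j 1)))
      · exact endpoint_of_segment_eq heq
      · exact ((hnet t).essentiallyDisjoint _ _ _ _ hw he heq
          ⟨left_mem_segment ℝ _ _, hmem⟩).2
    rcases this with h | h
    · exact ⟨i, k, h⟩
    · exact ⟨i, _, h⟩
  refine ⟨fun t i k => f t (p i + ivec k), a, hcont, fun i k => hf0 (hbody i k), hright, hinj,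
    fun i k => hK1 ▸ hnodes 1 (node_mem_gridNet p i k),
    fun i k j => hK1 ▸ (hedge 1 _ _ (axisEdge_mem_gridNet p i k j)).1, ?_, ?_⟩
  · intro t i i' hii k j k' j'
    rw [Set.disjoint_left]
    intro x hx hx'
    obtain ⟨y, hy, rfl⟩ := hseg t i k j x hx
    obtain ⟨y', hy', hyy⟩ := hseg t i' k' j' _ hx'
    have := (hbij t).injOn (hedgebody _ _ _ hy') (hedgebody _ _ _ hy) hyy
    rw [this] at hy'
    exact hii (eq_of_mem_axisEdge_axisEdge hp hy hy')
  · intro i k c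
    have h1 : ∀ t, ∃ q : Fin n × (Fin 3 → ℤ), f t (p i + ivec k) + a t c = f t (p q.1 + ivec q.2) := by
      intro t
      have h2 : f t (p i + ivec k) + a t c ∈ (K t).nodes := by
        rw [← (hper t).1 c]
        exact ⟨_, hnodes t (node_mem_gridNet p i k), rfl⟩
      obtain ⟨i', k', h⟩ := hsurj t _ h2
      exact ⟨(i', k'), h⟩
    choose g hg using h1
    -- The label of the translated node could depend on `t`. There are countably many labels, and
    -- each occurs on a closed set of times, so Sierpinski's theorem makes the label constant.
    have h2 := eq_of_isClosed_fibers g (Set.to_countable _) (fun t => by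
      have : {s | g s = g t} = {s | f s (p i + ivec k) + a s c =
          f s (p (g t).1 + ivec (g t).2)} := by
        ext s
        constructor
        · intro (h : g s = g t)
          rw [Set.mem_ofPred_eq, hg s, h]
        · intro h
          rw [Set.mem_ofPred_eq, hg s] at h
          obtain ⟨h3, h4⟩ := hinj s _ _ _ _ h
          exact Prod.ext h3 h4
      rw [this]
      exact isClosed_eq ((hcont i k).add (hacont c)) (hcont _ _))
    exact ⟨(g 0).1, (g 0).2, fun t => by rw [h2 0 t]; exact hg t⟩

theorem sameOrder_of_periodicallyIsotopic {n : ℕ} {p p' : Fin n → Space3} (hp : IsGeneric p)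
    (hp' : IsGeneric p') (h : PeriodicallyIsotopic (gridNet p) (gridNet p')) :
    ∃ X, IsIntegerRotation X ∧ SameOrder p (rotConfig X p') := by
  rcases Nat.eq_zero_or_pos n with rfl | hn
  · exact ⟨1, IsIntegerRotation.one, 1, 0, fun i => i.elim0⟩
  let i₀ : Fin n := ⟨0, hn⟩
  obtain ⟨F, a, hcont, hF0, hright, hinj, hnode, hedge, hdisj, hper⟩ := h.exists_node_motion hp
  -- translations by multiples of the period vectors
  have hper' : ∀ c, ∃ (m : ℕ) (κ : Fin 3 → ℤ), m ≠ 0 ∧ (m : ℝ) • a 0 c = ivec κ ∧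
      ∀ t i k, F t i (k + κ) = F t i k + (m : ℝ) • a t c := by
    intro c
    have hiter : ∀ (r : ℕ) i k, ∃ i' k', ∀ t, F t i k + (r : ℝ) • a t c = F t i' k' := by
      intro r i k
      induction r with
      | zero => exact ⟨i, k, fun t => by simp⟩
      | succ r ih =>
        obtain ⟨i', k', h⟩ := ih
        obtain ⟨i'', k'', h'⟩ := hper i' k' c
        refine ⟨i'', k'', fun t => ?_⟩
        rw [← h' t, ← h t]
        push_cast
        module
    choose s v hsv using fun r => hiter r i₀ 0
    -- A period vector may permute the components. Two of its multiples carry the base node into the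
    -- same component, so their difference is an integer vector at time 0.
    obtain ⟨r, r', hlt, hrr⟩ : ∃ r r', r < r' ∧ s r = s r' := by
      obtain ⟨r, r', hne, h⟩ := Finite.exists_ne_map_eq_of_infinite s
      rcases lt_or_gt_of_ne hne with h' | h'
      · exact ⟨r, r', h', h⟩
      · exact ⟨r', r, h', h.symm⟩
    have e : ((r' - r : ℕ) : ℝ) • a 0 c = ivec (v r' - v r) := by
      have e1 := hsv r 0
      have e2 := hsv r' 0
      rw [hF0, hF0] at e1 e2
      rw [Nat.cast_sub hlt.le, sub_smul]
      have e3 : ivec (v r' - v r) = ivec (v r') - ivec (v r) := by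
        rw [eq_sub_iff_add_eq, ← ivec_add, sub_add_cancel]
      rw [e3, ← sub_eq_zero]
      rw [hrr] at e1
      have := congrArg₂ (· - ·) e2 e1
      rw [add_sub_add_left_eq_sub, add_sub_add_left_eq_sub] at this
      rw [this, sub_self]
    refine ⟨r' - r, v r' - v r, by omega, e, fun t i k => ?_⟩
    obtain ⟨i', k', h⟩ := hiter (r' - r) i k
    -- At time 0 this translation fixes the component and adds `κ` to the lattice label; as labels
    -- do not depend on time, it does so always.
    have h0 := h 0
    rw [hF0, hF0, e, add_assoc, ← ivec_add] at h0
    obtain ⟨rfl, rfl⟩ := hp.eq_of_node_eq h0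
    exact (h t).symm
  -- the final map is a lattice isomorphism on each component
  have hstep : ∀ i k j, ∃ u, F 1 i (k + Pi.single j 1) = F 1 i k + ivec (unitStep u) := by
    intro i k j
    obtain ⟨m, l, j', h⟩ := hedge i k j
    have hne : F 1 i k ≠ F 1 i (k + Pi.single j 1) := by
      intro h
      have := congrFun (hinj _ _ _ _ _ h).2 j
      simp at this
    have h1 := endpoint_of_segment_eq h
    have h2 := endpoint_of_segment_eq ((segment_symm ℝ _ _).trans h)
    have e : ivec (unitStep (j', true)) = Pi.single j' 1 := ivec_single j'
    have e' : ivec (unitStep (j', false)) = -Pi.single j' 1 := by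
      rw [← e, show unitStep (j', false) = -unitStep (j', true) from unitStep_oppStep (j', true)]
      funext c; simp
    rcases h1 with h1 | h1 <;> rcases h2 with h2 | h2
    · exact absurd (h1.trans h2.symm) hne
    · exact ⟨(j', true), by rw [h1, h2, e]⟩
    · exact ⟨(j', false), by rw [h1, h2, e', add_neg_cancel_right]⟩
    · exact absurd (h1.trans h2.symm) hne
  have hlat : ∀ i k, ∃ v, F 1 i k = F 1 i 0 + ivec v := by
    intro i k
    have h1 := eq_of_lattice_invariant (fun k => ∃ v, F 1 i k = F 1 i 0 + ivec v) (fun k j => by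
      obtain ⟨u, hu⟩ := hstep i k j
      rw [hu]
      refine propext ⟨?_, ?_⟩
      · rintro ⟨v, hv⟩
        refine ⟨v - unitStep u, ?_⟩
        rw [← add_left_inj (ivec (unitStep u)), hv, add_assoc, ← ivec_add, sub_add_cancel]
      · rintro ⟨v, hv⟩
        exact ⟨v + unitStep u, by rw [hv, ivec_add, add_assoc]⟩) k
    rw [h1]
    exact ⟨0, by simp⟩
  choose H hH using hlat
  have hX : ∀ i, ∃ X : Matrix (Fin 3) (Fin 3) ℤ, X * X.transpose = 1 ∧ ∀ k, H i k = X.mulVec k := by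
    intro i
    refine exists_matrix_of_lattice_hom ?_ ?_ ?_
    · intro k k' h
      exact (hinj 1 i k i k' (by rw [hH, hH i k', h])).2
    · intro k j
      obtain ⟨u, hu⟩ := hstep i k j
      rw [hH, hH i k, add_assoc, ← ivec_add] at hu
      exact ⟨u, ivec_injective (add_left_cancel hu)⟩
    · have := hH i 0
      rw [left_eq_add] at this
      exact ivec_injective (this.trans ivec_zero.symm)
  choose X hXX hHX using hX
  choose m κ hm hκ hmt using hper'
  have hcastmul : ∀ (Y : Matrix (Fin 3) (Fin 3) ℤ) (k : Fin 3 → ℤ),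
      (Y.map (Int.cast : ℤ → ℝ)).mulVec (ivec k) = ivec (Y.mulVec k) := by
    intro Y k
    funext c
    simp [Matrix.mulVec, dotProduct]
  -- Equivariance determines each `X i` on the basis `a 0`, with values that do not involve `i`;
  -- hence all `X i` coincide.
  have hXa : ∀ i c, ((X i).map (Int.cast : ℤ → ℝ)).mulVec (a 0 c) = a 1 c := by
    intro i c
    have h1 := hmt c 1 i 0
    rw [zero_add, hH, hHX, add_right_inj, ← hcastmul, ← hκ, Matrix.mulVec_smul] at h1
    exact smul_right_injective _ (Nat.cast_ne_zero.2 (hm c)) h1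
  have hXeq : ∀ i, X i = X i₀ := by
    intro i
    have h1 : ((X i).map (Int.cast : ℤ → ℝ)).mulVecLin = ((X i₀).map (Int.cast : ℤ → ℝ)).mulVecLin :=
      (a 0).ext fun c => by simp only [Matrix.mulVecLin_apply, hXa]
    ext r c
    have h2 := congrFun (LinearMap.congr_fun h1 (Pi.single c 1)) r
    simp only [Matrix.mulVecLin_apply, Matrix.mulVec_single_one] at h2
    simpa using h2
  have hrot : IsIntegerRotation (X i₀) := by
    refine ⟨hXX i₀, ?_⟩
    have h1 : (Matrix.of fun i j => a 1 i j) =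
        (Matrix.of fun i j => a 0 i j) * ((X i₀).map (Int.cast : ℤ → ℝ)).transpose := by
      ext r c
      rw [Matrix.of_apply, ← hXa i₀ r]
      simp [Matrix.mulVec, dotProduct, Matrix.mul_apply, mul_comm]
    have h2 := hright 1
    rw [RightHanded, h1, Matrix.det_mul, Matrix.det_transpose] at h2
    have h3 := pos_of_mul_pos_right h2 (hright 0).le
    have h4 : ((X i₀).map (Int.cast : ℤ → ℝ)).det = ((X i₀).det : ℤ) :=
      (Int.cast_det (X i₀)).symm
    rw [h4] at h3
    have h5 : 0 < (X i₀).det := by exact_mod_cast h3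
    have h6 := congrArg Matrix.det (hXX i₀)
    rw [Matrix.det_mul, Matrix.det_transpose, Matrix.det_one] at h6
    nlinarith
  -- labels of the components
  choose lab ν hlab using fun i => hnode i 0
  have hlabinj : Function.Injective lab := by
    intro i i' hii
    obtain ⟨k, hk⟩ : ∃ k, (X i₀).mulVec k = ν i' - ν i :=
      ⟨(X i₀).transpose.mulVec (ν i' - ν i), by
        rw [Matrix.mulVec_mulVec, hXX, Matrix.one_mulVec]⟩
    have h1 : F 1 i k = F 1 i' 0 := by
      rw [hH, hHX, hXeq, hk, hlab, hlab, hii, add_assoc, ← ivec_add, add_sub_cancel]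
    exact (hinj _ _ _ _ _ h1).1
  have hlabbij := Finite.injective_iff_bijective.1 hlabinj
  refine ⟨(X i₀).transpose, hrot.transpose, Equiv.ofBijective lab hlabbij,
    fun i => (X i₀).transpose.mulVec (ν i), ?_⟩
  -- Applying `R t` to the whole motion undoes the rotation, so that each lattice ends axial with
  -- its labels in standard position. Each `R t` is injective, so edges of different components stay
  -- disjoint.
  obtain ⟨R, hR, hR0, hR1, hRd⟩ := hrot.transpose.exists_path
  have hq : ∀ i, (R 1).mulVec (F 1 i 0) = rotConfig (X i₀).transpose p' (lab i) +
      ivec ((X i₀).transpose.mulVec (ν i)) := by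
    intro i
    rw [hlab, hR1, Matrix.mulVec_add, hcastmul]
    rfl
  have hgen := hp'.rotConfig hrot.transpose
  intro i j c
  rcases eq_or_ne i j with rfl | hij
  · simp
  have hRinj : ∀ t, Function.Injective (R t).mulVec := fun t =>
    Matrix.mulVec_injective_iff_isUnit.2 ((Matrix.isUnit_iff_isUnit_det _).2 (hRd t).ne'.isUnit)
  have him : ∀ t x y, (R t).mulVec '' segment ℝ x y = segment ℝ ((R t).mulVec x) ((R t).mulVec y) :=
    fun t x y => image_segment ℝ (R t).mulVecLin.toAffineMap x y
  have hone : ∀ i k, (R 1).mulVec (F 1 i k) = (R 1).mulVec (F 1 i 0) + ivec k := by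
    intro i k
    rw [hH, hHX, hXeq, Matrix.mulVec_add]
    congr 1
    rw [hR1, hcastmul, Matrix.mulVec_mulVec, hrot.transpose_mul, Matrix.one_mulVec]
  have key := floor_eq_of_lattice_isotopy (P := fun t k => (R t).mulVec (F t j k))
    (Q := fun t k => (R t).mulVec (F t i k)) (p := p j) (q := p i)
    (p' := (R 1).mulVec (F 1 j 0)) (q' := (R 1).mulVec (F 1 i 0))
    (fun k => hR.matrix_mulVec (hcont j k)) (fun k => hR.matrix_mulVec (hcont i k))
    (fun k => by rw [hR0, Matrix.one_mulVec, hF0]) (fun k => by rw [hR0, Matrix.one_mulVec, hF0])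
    (hone j) (hone i)
    (fun t k j' l j'' => by
      rw [← him, ← him]
      exact (Set.disjoint_image_iff (hRinj t)).2 (hdisj t j i hij.symm k j' l j''))
    (hp i j hij)
    (fun c m h => by
      rw [hq, hq] at h
      simp only [Pi.add_apply, ivec_apply] at h
      exact hgen (lab i) (lab j) (hlabinj.ne hij) c
        (m - ((X i₀).transpose.mulVec (ν i) c - (X i₀).transpose.mulVec (ν j) c))
        (by push_cast; linarith)) c
  rw [key, hq, hq]
  rfl

/-! ### Construction of isotopies -/

/-- The straight motion between two configurations. -/
noncomputable def interp {n : ℕ} (p q : Fin n → Space3) (t : I) : Fin n → Space3 :=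
  fun i => p i + (t : ℝ) • (q i - p i)

theorem interp_zero {n : ℕ} (p q : Fin n → Space3) : interp p q 0 = p := by
  funext i; simp [interp]

theorem interp_one {n : ℕ} (p q : Fin n → Space3) : interp p q 1 = q := by
  funext i; simp [interp]

theorem continuous_interp {n : ℕ} (p q : Fin n → Space3) (i : Fin n) :
    Continuous fun t => interp p q t i := by
  unfold interp; fun_prop

/-- Equal floors put the initial and final differences into one open unit interval, and the straight
motion does not leave it. -/
theorem isGeneric_interp {n : ℕ} {p q : Fin n → Space3} (hp : IsGeneric p)
    (h : ∀ i j c, ⌊p i c - p j c⌋ = ⌊q i c - q j c⌋) (hq : IsGeneric q) (t : I) :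
    IsGeneric (interp p q t) := by
  intro i j hij c m hm
  have h1 : ∀ {p : Fin n → Space3}, IsGeneric p →
      p i c - p j c ∈ Set.Ioo (⌊p i c - p j c⌋ : ℝ) (⌊p i c - p j c⌋ + 1) := fun hp =>
    ⟨lt_of_le_of_ne (Int.floor_le _) (hp i j hij c _).symm, Int.lt_floor_add_one _⟩
  obtain ⟨l1, l2⟩ := (convex_Ioo (⌊p i c - p j c⌋ : ℝ) (⌊p i c - p j c⌋ + 1)).add_smul_sub_mem
    (h1 hp) (h i j c ▸ h1 hq) t.2
  have e : p i c - p j c + (t : ℝ) • (q i c - q j c - (p i c - p j c)) = m := by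
    rw [← hm]
    simp [interp]
    ring
  rw [e] at l1 l2
  have l1' : ⌊p i c - p j c⌋ < m := by exact_mod_cast l1
  have l2' : m < ⌊p i c - p j c⌋ + 1 := by exact_mod_cast l2
  omega

theorem gridNet_relabel {n : ℕ} (p : Fin n → Space3) (τ : Equiv.Perm (Fin n))
    (k : Fin n → Fin 3 → ℤ) : gridNet (fun i => p (τ i) + ivec (k i)) = gridNet p := by
  ext x
  · constructor
    · rintro ⟨i, l, rfl⟩
      exact ⟨τ i, k i + l, by rw [ivec_add, add_assoc]⟩
    · rintro ⟨i, l, rfl⟩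
      refine ⟨τ.symm i, l - k (τ.symm i), ?_⟩
      beta_reduce
      rw [Equiv.apply_symm_apply, add_assoc, ← ivec_add, add_sub_cancel]
  · constructor
    · rintro ⟨i, l, j, rfl⟩
      exact ⟨τ i, k i + l, j, by rw [ivec_add, add_assoc]⟩
    · rintro ⟨i, l, j, rfl⟩
      refine ⟨τ.symm i, l - k (τ.symm i), j, ?_⟩
      beta_reduce
      rw [Equiv.apply_symm_apply, add_assoc, ← ivec_add, add_sub_cancel]

/-! ### Integer rotations acting on grids. -/

theorem mulVec_ivec (Y : Matrix (Fin 3) (Fin 3) ℤ) (k : Fin 3 → ℤ) :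
    (Y.map (Int.cast : ℤ → ℝ)).mulVec (ivec k) = ivec (Y.mulVec k) := by
  funext c
  simp [Matrix.mulVec, dotProduct]

theorem mulVec_map_transpose_mulVec {X : Matrix (Fin 3) (Fin 3) ℤ} (hX : IsIntegerRotation X)
    (v : Space3) :
    (X.map (Int.cast : ℤ → ℝ)).mulVec ((X.transpose.map (Int.cast : ℤ → ℝ)).mulVec v) = v := by
  have h : X.map (Int.cast : ℤ → ℝ) * X.transpose.map (Int.cast : ℤ → ℝ) = 1 := by
    have := Matrix.map_mul (f := Int.castRingHom ℝ) (L := X) (M := X.transpose)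
    rw [hX.1] at this
    simpa using this.symm
  rw [Matrix.mulVec_mulVec, h, Matrix.one_mulVec]

theorem rotConfig_rotConfig_transpose {n : ℕ} {X : Matrix (Fin 3) (Fin 3) ℤ}
    (hX : IsIntegerRotation X) (p : Fin n → Space3) :
    rotConfig X (rotConfig X.transpose p) = p := by
  funext i
  exact mulVec_map_transpose_mulVec hX (p i)

/-- A rotation moves axial edges to axial edges. -/
theorem exists_axisEdge_image {X : Matrix (Fin 3) (Fin 3) ℤ} (hX : IsIntegerRotation X)
    (v : Space3) (j : Fin 3) : ∃ (l : Fin 3 → ℤ) (j' : Fin 3),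
      (X.map (Int.cast : ℤ → ℝ)).mulVec '' axisEdge v j =
        axisEdge ((X.map (Int.cast : ℤ → ℝ)).mulVec v + ivec l) j' := by
  obtain ⟨π, ε, hε, h⟩ := hX.exists_perm
  have h1 : (X.map (Int.cast : ℤ → ℝ)).mulVec '' axisEdge v j =
      segment ℝ ((X.map (Int.cast : ℤ → ℝ)).mulVec v)
        ((X.map (Int.cast : ℤ → ℝ)).mulVec v + ivec (X.mulVec (Pi.single j 1))) := by
    rw [axisEdge, ← ivec_single, ← mulVec_ivec, ← Matrix.mulVec_add]
    exact image_segment ℝ (X.map (Int.cast : ℤ → ℝ)).mulVecLin.toAffineMap _ _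
  have h2 : X.mulVec (Pi.single j 1) = Pi.single (π.symm j) (ε (π.symm j)) := by
    rw [Matrix.mulVec_single_one]
    funext c
    rw [Matrix.col_apply, h, Pi.single_apply]
    by_cases hc : c = π.symm j
    · simp [hc]
    · rw [if_neg hc, if_neg]
      rintro rfl
      exact hc (π.symm_apply_apply c).symm
  rw [h1, h2]
  rcases hε (π.symm j) with h3 | h3 <;> rw [h3]
  · exact ⟨0, π.symm j, by rw [ivec_zero, add_zero, axisEdge, ivec_single]⟩
  · refine ⟨Pi.single (π.symm j) (-1), π.symm j, ?_⟩
    rw [axisEdge, segment_symm, add_assoc, ← ivec_single, ← ivec_add, ← Pi.single_add]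
    simp

theorem gridNet_map_rotation {n : ℕ} {X : Matrix (Fin 3) (Fin 3) ℤ} (hX : IsIntegerRotation X)
    (p : Fin n → Space3) :
    (gridNet p).map (X.map (Int.cast : ℤ → ℝ)).mulVec = gridNet (rotConfig X p) := by
  have hnode : ∀ {X : Matrix (Fin 3) (Fin 3) ℤ} (p : Fin n → Space3), ∀ x ∈ (gridNet p).nodes,
      (X.map (Int.cast : ℤ → ℝ)).mulVec x ∈ (gridNet (rotConfig X p)).nodes := by
    rintro X p _ ⟨i, k, rfl⟩
    exact ⟨i, X.mulVec k, by rw [Matrix.mulVec_add, mulVec_ivec]; rfl⟩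
  have hedge : ∀ {X : Matrix (Fin 3) (Fin 3) ℤ}, IsIntegerRotation X → ∀ (p : Fin n → Space3),
      ∀ e ∈ (gridNet p).edges,
      (X.map (Int.cast : ℤ → ℝ)).mulVec '' e ∈ (gridNet (rotConfig X p)).edges := by
    rintro X hX p _ ⟨i, k, j, rfl⟩
    obtain ⟨l, j', h⟩ := exists_axisEdge_image hX (p i + ivec k) j
    refine ⟨i, X.mulVec k + l, j', ?_⟩
    rw [h, Matrix.mulVec_add, mulVec_ivec, ivec_add, add_assoc]
    rfl
  have hback := rotConfig_rotConfig_transpose (n := n) hX.transpose p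
  rw [Matrix.transpose_transpose] at hback
  ext x
  · constructor
    · rintro ⟨x, hx, rfl⟩
      exact hnode p x hx
    · intro hx
      have := hnode (X := X.transpose) _ x hx
      rw [hback] at this
      exact ⟨_, this, mulVec_map_transpose_mulVec hX x⟩
  · constructor
    · rintro ⟨e, he, rfl⟩
      exact hedge hX p e he
    · intro hx
      have := hedge hX.transpose _ x hx
      rw [hback] at this
      refine ⟨_, this, ?_⟩
      simp only [← Set.image_comp]
      have e : (X.map (Int.cast : ℤ → ℝ)).mulVec ∘ (X.transpose.map (Int.cast : ℤ → ℝ)).mulVec =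
          id := funext (mulVec_map_transpose_mulVec hX)
      rw [e, Set.image_id]

/-- The body of a translate of the model net. -/
def compBody (v : Space3) : Set Space3 := {x | ∃ j, ∀ c, c ≠ j → ∃ m : ℤ, x c = v c + m}

theorem mem_body_iff_compBody {n : ℕ} {p : Fin n → Space3} {x : Space3} :
    x ∈ (gridNet p).body ↔ ∃ i, x ∈ compBody (p i) := mem_body_gridNet

theorem IsGeneric.eq_of_mem_compBody {n : ℕ} {p : Fin n → Space3} (hp : IsGeneric p) {i i' : Fin n}
    {x : Space3} (h : x ∈ compBody (p i)) (h' : x ∈ compBody (p i')) : i = i' := by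
  by_contra hne
  obtain ⟨j, hj⟩ := h
  obtain ⟨j', hj'⟩ := h'
  obtain ⟨c, hc, hc'⟩ := exists_ne_ne j j'
  obtain ⟨m, hm⟩ := hj c hc
  obtain ⟨m', hm'⟩ := hj' c hc'
  exact hp i i' hne c (m' - m) (by push_cast; linarith)

theorem translate_mem_compBody {v w x : Space3} : x + (w - v) ∈ compBody w ↔ x ∈ compBody v := by
  refine exists_congr fun j => forall_congr' fun c => forall_congr' fun hc => exists_congr fun m => ?_
  simp only [Pi.add_apply, Pi.sub_apply]
  constructor <;> intro h <;> linarith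

theorem axisEdge_subset_compBody (v : Space3) (k : Fin 3 → ℤ) (j : Fin 3) :
    axisEdge (v + ivec k) j ⊆ compBody v :=
  fun _ hx => ⟨j, fun c hc => ⟨k c, (mem_axisEdge.1 hx).1 c hc⟩⟩

open Classical in
/-- The motion of the body of a grid when its components are translated. -/
noncomputable def moveComp {n : ℕ} (p q : Fin n → Space3) (x : Space3) : Space3 :=
  if h : ∃ i, x ∈ compBody (p i) then x + (q h.choose - p h.choose) else x

theorem moveComp_of_mem {n : ℕ} {p : Fin n → Space3} (hp : IsGeneric p) (q : Fin n → Space3)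
    {i : Fin n} {x : Space3} (h : x ∈ compBody (p i)) : moveComp p q x = x + (q i - p i) := by
  have h' : ∃ i, x ∈ compBody (p i) := ⟨i, h⟩
  rw [moveComp, dif_pos h', hp.eq_of_mem_compBody h'.choose_spec h]

theorem bijOn_moveComp {n : ℕ} {p q : Fin n → Space3} (hp : IsGeneric p) (hq : IsGeneric q) :
    Set.BijOn (moveComp p q) (gridNet p).body (gridNet q).body := by
  refine ⟨?_, ?_, ?_⟩
  · intro x hx
    obtain ⟨i, hi⟩ := mem_body_iff_compBody.1 hx
    rw [moveComp_of_mem hp q hi]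
    exact mem_body_iff_compBody.2 ⟨i, translate_mem_compBody.2 hi⟩
  · intro x hx y hy hxy
    obtain ⟨i, hi⟩ := mem_body_iff_compBody.1 hx
    obtain ⟨j, hj⟩ := mem_body_iff_compBody.1 hy
    rw [moveComp_of_mem hp q hi, moveComp_of_mem hp q hj] at hxy
    have h1 := (translate_mem_compBody (w := q i)).2 hi
    rw [hxy] at h1
    obtain rfl := hq.eq_of_mem_compBody h1 (translate_mem_compBody.2 hj)
    exact add_right_cancel hxy
  · intro x hx
    obtain ⟨i, hi⟩ := mem_body_iff_compBody.1 hx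
    have h1 : x + (p i - q i) ∈ compBody (p i) := translate_mem_compBody.2 hi
    refine ⟨_, mem_body_iff_compBody.2 ⟨i, h1⟩, ?_⟩
    rw [moveComp_of_mem hp q h1]
    abel

/-- The linear automorphism given by an invertible matrix. -/
noncomputable def mulVecEquiv (R : Matrix (Fin 3) (Fin 3) ℝ) (h : 0 < R.det) :
    Space3 ≃ₗ[ℝ] Space3 :=
  Matrix.toLin'OfInv (M := R⁻¹) (M' := R) (Matrix.nonsing_inv_mul R h.ne'.isUnit)
    (Matrix.mul_nonsing_inv R h.ne'.isUnit)

theorem mulVecEquiv_apply (R : Matrix (Fin 3) (Fin 3) ℝ) (h : 0 < R.det) (x : Space3) :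
    mulVecEquiv R h x = R.mulVec x := rfl

theorem LineNet.map_body {X Y : Type} (g : X → Y) (K : LineNet X) :
    (K.map g).body = g '' K.body := by
  simp only [LineNet.body, LineNet.map, Set.image_union, Set.sUnion_image, Set.image_sUnion]

/-- The components are translated straight to the rotated and relabelled target while space is moved
along a path from the identity to `Xᵀ`, which turns this target back into the grid of `p'`. The
moved standard basis serves as periodicity basis. -/
theorem periodicallyIsotopic_of_sameOrder {n : ℕ} {p p' : Fin n → Space3} (hp : IsGeneric p)
    (hp' : IsGeneric p') {X : Matrix (Fin 3) (Fin 3) ℤ} (hX : IsIntegerRotation X)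
    (h : SameOrder p (rotConfig X p')) : PeriodicallyIsotopic (gridNet p) (gridNet p') := by
  obtain ⟨τ, k, h⟩ := h
  set q : Fin n → Space3 := fun i => rotConfig X p' (τ i) + ivec (k i) with hqdef
  have hq : IsGeneric q := by
    intro i j hij c m hm
    simp only [hqdef, Pi.add_apply, ivec_apply] at hm
    exact hp'.rotConfig hX (τ i) (τ j) (τ.injective.ne hij) c (m - (k i c - k j c))
      (by push_cast; linarith)
  have hgen := isGeneric_interp hp (q := q) h hq
  obtain ⟨R, hR, hR0, hR1, hRd⟩ := hX.transpose.exists_path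
  refine ⟨fun t => (gridNet (interp p q t)).map (mulVecEquiv (R t) (hRd t)),
    fun t => standardBasis.map (mulVecEquiv (R t) (hRd t)),
    fun t x => (R t).mulVec (moveComp p (interp p q t) x), ?_, ?_, ?_, ?_, ?_, ?_, ?_, ?_, ?_, ?_, ?_⟩
  · have e : (mulVecEquiv (R 0) (hRd 0) : Space3 → Space3) = id := by
      funext x; rw [mulVecEquiv_apply, hR0, Matrix.one_mulVec]; rfl
    simp only [e, interp_zero]
    simp [LineNet.map]
  · have e : (mulVecEquiv (R 1) (hRd 1) : Space3 → Space3) =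
        (X.transpose.map (Int.cast : ℤ → ℝ)).mulVec := by
      funext x; rw [mulVecEquiv_apply, hR1]
    simp only [e, interp_one]
    rw [hqdef, gridNet_relabel, gridNet_map_rotation hX.transpose]
    congr 1
    simpa using rotConfig_rotConfig_transpose hX.transpose p'
  · exact fun t => isLinearPeriodicNet_map (isLinearPeriodicNet_gridNet (hgen t)) _
  · exact fun t => isPeriodicityBasis_map (isPeriodicityBasis_gridNet _) _
  · intro t
    have e : (Matrix.of fun i j => (standardBasis.map (mulVecEquiv (R t) (hRd t))) i j) =
        (R t).transpose := by
      ext i j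
      simp [mulVecEquiv_apply]
    rw [RightHanded, e, Matrix.det_transpose]
    exact hRd t
  · intro i
    have e : (fun t => (standardBasis.map (mulVecEquiv (R t) (hRd t))) i) =
        fun t => (R t).mulVec (Pi.single i 1) := by
      funext t
      simp [mulVecEquiv_apply]
    rw [e]
    exact hR.matrix_mulVec continuous_const
  · intro t
    rw [LineNet.map_body]
    exact ((mulVecEquiv (R t) (hRd t)).injective.injOn.bijOn_image).comp
      (bijOn_moveComp hp (hgen t))
  · rintro t _ ⟨i, l, rfl⟩
    have h1 : p i + ivec l ∈ compBody (p i) := ⟨0, fun c _ => ⟨l c, rfl⟩⟩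
    refine ⟨interp p q t i + ivec l, ⟨i, l, rfl⟩, ?_⟩
    beta_reduce
    rw [mulVecEquiv_apply, moveComp_of_mem hp _ h1]
    congr 1
    abel
  · intro x hx
    obtain ⟨i, hi⟩ := mem_body_iff_compBody.1 hx
    simp only [moveComp_of_mem hp _ hi, interp_zero, hR0, Matrix.one_mulVec]
    simp
  · rintro _ ⟨i, l, rfl⟩
    have h1 : p i + ivec l ∈ compBody (p i) := ⟨0, fun c _ => ⟨l c, rfl⟩⟩
    simp only [moveComp_of_mem hp _ h1]
    exact hR.matrix_mulVec (continuous_const.add ((continuous_interp p q i).sub continuous_const))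
  · rintro t P Q ⟨i, l, j, hseg⟩
    have hsub : segment ℝ P Q ⊆ compBody (p i) := hseg ▸ axisEdge_subset_compBody _ _ _
    have hP := hsub (left_mem_segment ℝ P Q)
    have hQ := hsub (right_mem_segment ℝ P Q)
    have himg := image_segment ℝ (mulVecEquiv (R t) (hRd t)).toLinearMap.toAffineMap
      (P + (interp p q t i - p i)) (Q + (interp p q t i - p i))
    constructor
    · beta_reduce
      rw [moveComp_of_mem hp _ hP, moveComp_of_mem hp _ hQ]
      refine ⟨axisEdge (interp p q t i + ivec l) j, ⟨i, l, j, rfl⟩, ?_⟩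
      rw [show interp p q t i + ivec l = (p i + ivec l) + (interp p q t i - p i) by abel,
        ← axisEdge_translate, ← hseg]
      have e : (fun y => y + (interp p q t i - p i)) '' segment ℝ P Q =
          segment ℝ (P + (interp p q t i - p i)) (Q + (interp p q t i - p i)) := by
        have := segment_translate_image ℝ (interp p q t i - p i) P Q
        simpa only [add_comm] using this
      rw [e]
      exact himg
    · intro s hs
      have hS : AffineMap.lineMap P Q s ∈ compBody (p i) := hsub (by
        rw [segment_eq_image_lineMap]; exact ⟨s, hs, rfl⟩)
      beta_reduce
      rw [moveComp_of_mem hp _ hP, moveComp_of_mem hp _ hQ, moveComp_of_mem hp _ hS]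
      simp only [AffineMap.lineMap_apply_module, ← Matrix.mulVec_smul, ← Matrix.mulVec_add]
      congr 1
      module

/-! ### Axial grids in the torus -/

theorem torusProj_standardBasis (x : Space3) (c : Fin 3) :
    torusProj standardBasis x c = (x c : UnitAddCircle) := by
  simp [torusProj]

theorem torusProj_add (x y : Space3) :
    torusProj standardBasis (x + y) = torusProj standardBasis x + torusProj standardBasis y := by
  funext c
  simp [torusProj_standardBasis]

theorem unitAddCircle_coe_eq_iff {x y : ℝ} :
    (x : UnitAddCircle) = y ↔ ∃ m : ℤ, x = y + m := by
  rw [← sub_eq_zero, ← AddCircle.coe_sub, AddCircle.coe_eq_zero_iff]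
  refine exists_congr fun m => ?_
  rw [zsmul_eq_mul, mul_one]
  constructor <;> intro h <;> linarith

theorem torusProj_eq_iff {x y : Space3} :
    torusProj standardBasis x = torusProj standardBasis y ↔ ∃ k, x = y + ivec k := by
  constructor
  · intro h
    have h1 : ∀ c, ∃ m : ℤ, x c = y c + m := fun c => by
      rw [← unitAddCircle_coe_eq_iff, ← torusProj_standardBasis, h, torusProj_standardBasis]
    choose k hk using h1
    exact ⟨k, funext hk⟩
  · rintro ⟨k, rfl⟩
    funext c
    rw [torusProj_standardBasis, torusProj_standardBasis, unitAddCircle_coe_eq_iff]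
    exact ⟨k c, rfl⟩

theorem torusProj_add_ivec (x : Space3) (k : Fin 3 → ℤ) :
    torusProj standardBasis (x + ivec k) = torusProj standardBasis x :=
  torusProj_eq_iff.2 ⟨k, rfl⟩

theorem continuous_torusProj : Continuous (torusProj standardBasis) := by
  refine continuous_pi fun c => ?_
  simp only [torusProj_standardBasis]
  exact (AddCircle.continuous_mk' 1).comp (continuous_apply c)

theorem torusProj_surjective : Function.Surjective (torusProj standardBasis) := by
  intro y
  choose x hx using fun c => QuotientAddGroup.mk_surjective (y c)
  exact ⟨x, funext fun c => (torusProj_standardBasis x c).trans (hx c)⟩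

/-- The axial circle through a point of the torus. -/
def torusLine (P : Torus3) (j : Fin 3) : Set Torus3 := {y | ∀ c, c ≠ j → y c = P c}

theorem torusProj_image_axisEdge (x : Space3) (j : Fin 3) :
    torusProj standardBasis '' axisEdge x j = torusLine (torusProj standardBasis x) j := by
  ext y
  constructor
  · rintro ⟨z, hz, rfl⟩ c hc
    rw [torusProj_standardBasis, torusProj_standardBasis, (mem_axisEdge.1 hz).1 c hc]
  · intro hy
    obtain ⟨z, rfl⟩ := torusProj_surjective y
    refine ⟨Function.update x j (x j + Int.fract (z j - x j)), mem_axisEdge.2 ⟨fun c hc => ?_, ?_, ?_⟩, ?_⟩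
    · simp [hc]
    · simp
    · simpa using (Int.fract_lt_one _).le
    · funext c
      rw [torusProj_standardBasis]
      rcases eq_or_ne c j with rfl | hc
      · rw [torusProj_standardBasis, unitAddCircle_coe_eq_iff]
        refine ⟨-⌊z c - x c⌋, ?_⟩
        rw [Function.update_self, Int.fract]
        push_cast
        ring
      · rw [hy c hc, Function.update_of_ne hc, torusProj_standardBasis]

/-- The union of the axial circles through finitely many points of the torus. -/
def torusGrid {n : ℕ} (P : Fin n → Torus3) : LineNet Torus3 where
  nodes := Set.range P
  edges := {e | ∃ i j, e = torusLine (P i) j}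

theorem lgk_gridNet {n : ℕ} (p : Fin n → Space3) :
    lgk (gridNet p) standardBasis = torusGrid fun i => torusProj standardBasis (p i) := by
  ext x
  · constructor
    · rintro ⟨_, ⟨i, k, rfl⟩, rfl⟩
      exact ⟨i, (torusProj_add_ivec _ _).symm⟩
    · rintro ⟨i, rfl⟩
      exact ⟨_, ⟨i, 0, rfl⟩, torusProj_add_ivec _ _⟩
  · constructor
    · rintro ⟨_, ⟨i, k, j, rfl⟩, rfl⟩
      exact ⟨i, j, by
        beta_reduce
        rw [torusProj_image_axisEdge, torusProj_add_ivec]⟩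
    · rintro ⟨i, j, rfl⟩
      exact ⟨_, ⟨i, 0, j, rfl⟩, by
        simp only [torusProj_image_axisEdge, torusProj_add_ivec]⟩

theorem IsGeneric.torusProj_ne {n : ℕ} {p : Fin n → Space3} (hp : IsGeneric p) {i i' : Fin n}
    (hij : i ≠ i') (c : Fin 3) :
    torusProj standardBasis (p i) c ≠ torusProj standardBasis (p i') c := by
  rw [torusProj_standardBasis, torusProj_standardBasis, Ne, unitAddCircle_coe_eq_iff]
  rintro ⟨m, hm⟩
  exact hp i i' hij c m (by linarith)

theorem mem_openSegment_axis {x y : Space3} {j : Fin 3}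
    (h : y ∈ openSegment ℝ x (x + Pi.single j 1)) :
    (∀ c, c ≠ j → y c = x c) ∧ x j < y j ∧ y j < x j + 1 := by
  rw [openSegment_eq_image'] at h
  obtain ⟨s, ⟨h0, h1⟩, rfl⟩ := h
  refine ⟨fun c hc => by simp [hc], ?_, ?_⟩ <;> simp [h0, h1]

theorem isLinearGraphKnot_torusGrid {n : ℕ} {p : Fin n → Space3} (hp : IsGeneric p) :
    IsLinearGraphKnot (torusGrid fun i => torusProj standardBasis (p i)) where
  finite_nodes := Set.finite_range _
  finite_edges := by
    refine (Set.finite_range fun q : Fin n × Fin 3 =>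
      torusLine (torusProj standardBasis (p q.1)) q.2).subset ?_
    rintro _ ⟨i, j, rfl⟩
    exact ⟨(i, j), rfl⟩
  isSegment := by
    rintro _ ⟨i, j, rfl⟩
    refine ⟨p i, p i + Pi.single j 1, fun h => ?_, (torusProj_image_axisEdge _ _).symm, ⟨i, rfl⟩,
      ⟨i, by rw [← ivec_single, torusProj_add_ivec]⟩, ?_, ?_⟩
    · have := congrFun h j
      simp at this
    · intro x hx y hy hxy
      obtain ⟨hx1, hx2, hx3⟩ := mem_openSegment_axis hx
      obtain ⟨hy1, hy2, hy3⟩ := mem_openSegment_axis hy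
      obtain ⟨k, rfl⟩ := torusProj_eq_iff.1 hxy
      simp only [Pi.add_apply, ivec_apply] at hx2 hx3
      have h1 : (-1 : ℝ) < k j := by linarith
      have h2 : (k j : ℝ) < 1 := by linarith
      have h1' : -1 < k j := by exact_mod_cast h1
      have h2' : k j < 1 := by exact_mod_cast h2
      funext c
      rcases eq_or_ne c j with rfl | hc
      · have : k c = 0 := by omega
        simp [this]
      · rw [hx1 c hc, hy1 c hc]
    · rw [Set.disjoint_left]
      rintro _ ⟨x, hx, rfl⟩ ⟨i', hi'⟩
      obtain ⟨hx1, hx2, hx3⟩ := mem_openSegment_axis hx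
      obtain ⟨k, hk⟩ := torusProj_eq_iff.1 hi'
      obtain ⟨c, hc, -⟩ := exists_ne_ne j j
      have hii : i' = i := by
        by_contra hne
        have := congrFun hk c
        rw [Pi.add_apply, hx1 c hc] at this
        exact hp i' i hne c (k c) (by rw [this, ivec_apply]; ring)
      subst hii
      have h0 := congrFun hk j
      simp only [Pi.add_apply, ivec_apply] at h0
      have h1 : (-1 : ℝ) < k j := by linarith
      have h2 : (k j : ℝ) < 0 := by linarith
      have h1' : -1 < k j := by exact_mod_cast h1
      have h2' : k j < 0 := by exact_mod_cast h2
      omega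
  essentiallyDisjoint := by
    rintro _ ⟨i, j, rfl⟩ _ ⟨i', j', rfl⟩ hne y ⟨hy, hy'⟩
    have hii : i = i' := by
      by_contra hii
      obtain ⟨c, hc, hc'⟩ := exists_ne_ne j j'
      exact hp.torusProj_ne hii c ((hy c hc).symm.trans (hy' c hc'))
    subst hii
    refine ⟨i, funext fun c => ?_⟩
    by_cases hc : c = j
    · by_cases hc' : c = j'
      · exact absurd (by rw [← hc, ← hc']) hne
      · exact (hy' c hc').symm
    · exact (hy c hc).symm

/-- The body of a component of a toroidal grid. -/
def torusComp (P : Torus3) : Set Torus3 := ⋃ j, torusLine P j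

theorem mem_body_torusGrid {n : ℕ} {P : Fin n → Torus3} {y : Torus3} :
    y ∈ (torusGrid P).body ↔ ∃ i, y ∈ torusComp (P i) := by
  constructor
  · rintro (⟨i, rfl⟩ | ⟨_, ⟨i, j, rfl⟩, hy⟩)
    · exact ⟨i, Set.mem_iUnion.2 ⟨0, fun _ _ => rfl⟩⟩
    · exact ⟨i, Set.mem_iUnion.2 ⟨j, hy⟩⟩
  · rintro ⟨i, hy⟩
    obtain ⟨j, hj⟩ := Set.mem_iUnion.1 hy
    exact Or.inr ⟨_, ⟨i, j, rfl⟩, hj⟩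

theorem isClosed_torusLine (P : Torus3) (j : Fin 3) : IsClosed (torusLine P j) := by
  simp only [torusLine, Set.ofPred_forall]
  exact isClosed_iInter fun c => isClosed_iInter fun _ => isClosed_eq (continuous_apply c)
    continuous_const

theorem isClosed_torusComp (P : Torus3) : IsClosed (torusComp P) :=
  isClosed_iUnion_of_finite fun j => isClosed_torusLine P j

theorem IsGeneric.eq_of_mem_torusComp {n : ℕ} {p : Fin n → Space3} (hp : IsGeneric p)
    {i i' : Fin n} {y : Torus3} (h : y ∈ torusComp (torusProj standardBasis (p i)))
    (h' : y ∈ torusComp (torusProj standardBasis (p i'))) : i = i' := by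
  by_contra hii
  obtain ⟨j, hj⟩ := Set.mem_iUnion.1 h
  obtain ⟨j', hj'⟩ := Set.mem_iUnion.1 h'
  obtain ⟨c, hc, hc'⟩ := exists_ne_ne j j'
  exact hp.torusProj_ne hii c ((hj c hc).symm.trans (hj' c hc'))

theorem translate_mem_torusLine {P Q y : Torus3} {j : Fin 3} :
    y + (Q - P) ∈ torusLine Q j ↔ y ∈ torusLine P j := by
  refine forall_congr' fun c => forall_congr' fun _ => ?_
  simp only [Pi.add_apply, Pi.sub_apply]
  have e : y c + (Q c - P c) - Q c = y c - P c := by abel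
  rw [← sub_eq_zero, e, sub_eq_zero]

theorem translate_mem_torusComp {P Q y : Torus3} :
    y + (Q - P) ∈ torusComp Q ↔ y ∈ torusComp P := by
  simp only [torusComp, Set.mem_iUnion, translate_mem_torusLine]

open Classical in
/-- The motion of the body of a toroidal grid when its components are translated. -/
noncomputable def torusMove {n : ℕ} (P Q : Fin n → Torus3) (y : Torus3) : Torus3 :=
  if h : ∃ i, y ∈ torusComp (P i) then y + (Q h.choose - P h.choose) else y

theorem torusMove_of_mem {n : ℕ} {p : Fin n → Space3} (hp : IsGeneric p) (Q : Fin n → Torus3)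
    {i : Fin n} {y : Torus3} (h : y ∈ torusComp (torusProj standardBasis (p i))) :
    torusMove (fun i => torusProj standardBasis (p i)) Q y =
      y + (Q i - torusProj standardBasis (p i)) := by
  have h' : ∃ i, y ∈ torusComp (torusProj standardBasis (p i)) := ⟨i, h⟩
  rw [torusMove, dif_pos h', hp.eq_of_mem_torusComp h'.choose_spec h]

/-- Each component is translated rigidly. The body is a finite union of closed components, on each
of which the motion is a translation, whence its continuity; relabelling and integer translations do
not affect the target. -/
theorem linearlyIsotopic_of_sameOrder {n : ℕ} {p p' : Fin n → Space3} (hp : IsGeneric p)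
    (hp' : IsGeneric p') (h : SameOrder p p') :
    LinearlyIsotopic (lgk (gridNet p) standardBasis) (lgk (gridNet p') standardBasis) := by
  obtain ⟨τ, k, h⟩ := h
  set q : Fin n → Space3 := fun i => p' (τ i) + ivec (k i) with hqdef
  have hq : IsGeneric q := by
    intro i j hij c m hm
    simp only [hqdef, Pi.add_apply, ivec_apply] at hm
    exact hp' (τ i) (τ j) (τ.injective.ne hij) c (m - (k i c - k j c)) (by push_cast; linarith)
  have hgen := isGeneric_interp hp (q := q) h hq
  rw [← gridNet_relabel p' τ k]
  simp only [lgk_gridNet]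
  set Q : I → Fin n → Torus3 := fun t i => torusProj standardBasis (interp p q t i) with hQ
  set P : Fin n → Torus3 := fun i => torusProj standardBasis (p i) with hP
  have hmove : ∀ t i y, y ∈ torusComp (P i) → torusMove P (Q t) y = y + (Q t i - P i) :=
    fun t i y hy => torusMove_of_mem hp (Q t) hy
  have hline : ∀ t i j, torusMove P (Q t) '' torusLine (P i) j = torusLine (Q t i) j := by
    intro t i j
    ext y
    constructor
    · rintro ⟨z, hz, rfl⟩
      rw [hmove t i z (Set.mem_iUnion.2 ⟨j, hz⟩)]
      exact translate_mem_torusLine.2 hz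
    · intro hy
      have h1 : y + (P i - Q t i) ∈ torusLine (P i) j := translate_mem_torusLine.2 hy
      refine ⟨_, h1, ?_⟩
      rw [hmove t i _ (Set.mem_iUnion.2 ⟨j, h1⟩)]
      abel
  have hnode : ∀ t i, torusMove P (Q t) (P i) = Q t i := by
    intro t i
    rw [hmove t i _ (Set.mem_iUnion.2 ⟨0, fun _ _ => rfl⟩)]
    abel
  refine ⟨fun t => torusGrid (Q t), fun t => torusMove P (Q t), ?_, ?_, ?_, ?_, ?_, ?_, ?_, ?_, ?_⟩
  · simp only [hQ, interp_zero]
    rfl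
  · simp only [hQ, interp_one]
    rfl
  · exact fun t => isLinearGraphKnot_torusGrid (hgen t)
  · intro t
    refine ⟨?_, ?_, ?_⟩
    · intro y hy
      obtain ⟨i, hi⟩ := mem_body_torusGrid.1 hy
      beta_reduce
      rw [hmove t i y hi]
      exact mem_body_torusGrid.2 ⟨i, translate_mem_torusComp.2 hi⟩
    · intro x hx y hy hxy
      obtain ⟨i, hi⟩ := mem_body_torusGrid.1 hx
      obtain ⟨j, hj⟩ := mem_body_torusGrid.1 hy
      beta_reduce at hxy
      rw [hmove t i x hi, hmove t j y hj] at hxy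
      have h1 := (translate_mem_torusComp (Q := Q t i)).2 hi
      rw [hxy] at h1
      obtain rfl := (hgen t).eq_of_mem_torusComp h1 (translate_mem_torusComp.2 hj)
      exact add_right_cancel hxy
    · intro y hy
      obtain ⟨i, hi⟩ := mem_body_torusGrid.1 hy
      have h1 : y + (P i - Q t i) ∈ torusComp (P i) := translate_mem_torusComp.2 hi
      refine ⟨_, mem_body_torusGrid.2 ⟨i, h1⟩, ?_⟩
      beta_reduce
      rw [hmove t i _ h1]
      abel
  · intro t
    have e : (torusGrid P).body = ⋃ i, torusComp (P i) := by
      ext y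
      rw [mem_body_torusGrid, Set.mem_iUnion]
    rw [e]
    refine (locallyFinite_of_finite _).continuousOn_iUnion (fun i => isClosed_torusComp _)
      fun i => ?_
    exact (continuous_id.add continuous_const).continuousOn.congr (fun y hy => hmove t i y hy)
  · intro y hy
    obtain ⟨i, hi⟩ := mem_body_torusGrid.1 hy
    beta_reduce
    rw [hmove 0 i y hi]
    simp [hQ, hP, interp_zero]
  · intro t
    ext y
    constructor
    · rintro ⟨_, ⟨i, rfl⟩, rfl⟩
      exact ⟨i, (hnode t i).symm⟩
    · rintro ⟨i, rfl⟩
      exact ⟨_, ⟨i, rfl⟩, hnode t i⟩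
  · intro t
    ext e
    constructor
    · rintro ⟨_, ⟨i, j, rfl⟩, rfl⟩
      exact ⟨i, j, hline t i j⟩
    · rintro ⟨i, j, rfl⟩
      exact ⟨_, ⟨i, j, rfl⟩, hline t i j⟩
  · intro y hy
    obtain ⟨i, hi⟩ := mem_body_torusGrid.1 hy
    have : (fun t => torusMove P (Q t) y) = fun t => y + (Q t i - P i) :=
      funext fun t => hmove t i y hi
    rw [this]
    exact continuous_const.add ((continuous_torusProj.comp (continuous_interp p q i)).sub
      continuous_const)

/-! ### Consequences of linear isotopy -/

/-- The image of a line through the origin in the torus. -/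
def torusDir (v : Fin 3 → ℤ) : Set Torus3 :=
  Set.range fun s : ℝ => torusProj standardBasis (s • ivec v)

theorem torusDir_eq_image (v : Fin 3 → ℤ) :
    torusDir v = (fun s : ℝ => torusProj standardBasis (s • ivec v)) '' Set.Icc 0 1 := by
  ext y
  constructor
  · rintro ⟨s, rfl⟩
    refine ⟨Int.fract s, ⟨Int.fract_nonneg s, (Int.fract_lt_one s).le⟩, ?_⟩
    refine torusProj_eq_iff.2 ⟨-⌊s⌋ • v, ?_⟩
    funext c
    have hs := Int.self_sub_floor s
    have hv : ivec (-⌊s⌋ • v) c = -(⌊s⌋ : ℝ) * (v c : ℝ) := by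
      simp [ivec]
    rw [Pi.add_apply, hv, Pi.smul_apply, Pi.smul_apply, smul_eq_mul, smul_eq_mul, ← hs]
    change _ * (v c : ℝ) = s * (v c : ℝ) + _
    ring
  · rintro ⟨s, -, rfl⟩
    exact ⟨s, rfl⟩

theorem isClosed_torusDir (v : Fin 3 → ℤ) : IsClosed (torusDir v) := by
  rw [torusDir_eq_image]
  refine (isCompact_Icc.image (continuous_torusProj.comp ?_)).isClosed
  fun_prop

/-- Closed one-parameter subgroups of the torus are minimal. -/
theorem torusDir_eq_of_subset {v w : Fin 3 → ℤ} (hv : v ≠ 0) (h : torusDir v ⊆ torusDir w) :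
    torusDir v = torusDir w := by
  refine h.antisymm ?_
  have h1 : ∀ s : ℝ, ∃ q : ℝ × (Fin 3 → ℤ), s • ivec v = q.1 • ivec w + ivec q.2 := by
    intro s
    obtain ⟨r, hr⟩ := h ⟨s, rfl⟩
    obtain ⟨k, hk⟩ := torusProj_eq_iff.1 hr.symm
    exact ⟨(r, k), hk⟩
  choose q hq using h1
  -- There are uncountably many `s` but countably many integer vectors; two parameters sharing one
  -- show that `v` and `w` are parallel.
  obtain ⟨s, s', hne, hss⟩ : ∃ s s', s ≠ s' ∧ (q s).2 = (q s').2 := by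
    have : ¬Function.Injective fun s => (q s).2 := fun hinj =>
      not_countable (α := ℝ) hinj.countable
    simp only [Function.Injective, not_forall] at this
    obtain ⟨s, s', h, hne⟩ := this
    exact ⟨s, s', hne, h⟩
  have h2 : (s - s') • ivec v = ((q s).1 - (q s').1) • ivec w := by
    rw [sub_smul, hq, hq s', hss]
    module
  have h3 : s - s' ≠ 0 := sub_ne_zero.2 hne
  have h4 : (q s).1 - (q s').1 ≠ 0 := by
    intro h0
    rw [h0, zero_smul, smul_eq_zero] at h2
    exact hv (ivec_injective ((h2.resolve_left h3).trans ivec_zero.symm))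
  rintro _ ⟨r, rfl⟩
  refine ⟨r / ((q s).1 - (q s').1) * (s - s'), ?_⟩
  beta_reduce
  rw [mul_smul, h2, ← mul_smul, div_mul_cancel₀ _ h4]

/-- A linear isotopy starting at an axial toroidal grid passes through axial toroidal grids. -/
theorem LinearlyIsotopic.exists_point_motion {n : ℕ} {p : Fin n → Space3} (hp : IsGeneric p)
    {K' : LineNet Torus3} (h : LinearlyIsotopic (lgk (gridNet p) standardBasis) K') :
    ∃ N : I → Fin n → Torus3, (∀ i, Continuous fun t => N t i) ∧
      (∀ i, N 0 i = torusProj standardBasis (p i)) ∧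
      (∀ t i i', i ≠ i' → ∀ c, N t i c ≠ N t i' c) ∧ Set.range (N 1) = K'.nodes := by
  rw [lgk_gridNet] at h
  set P : Fin n → Torus3 := fun i => torusProj standardBasis (p i) with hP
  obtain ⟨K, f, -, hK1, hK, hbij, -, hf0, hnodes, hedges, hcont⟩ := h
  have hlinebody : ∀ i j, torusLine (P i) j ⊆ (torusGrid P).body := fun i j y hy =>
    mem_body_torusGrid.2 ⟨i, Set.mem_iUnion.2 ⟨j, hy⟩⟩
  have hPline : ∀ i j, P i ∈ torusLine (P i) j := fun i j c _ => rfl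
  have hPbody : ∀ i, P i ∈ (torusGrid P).body := fun i => hlinebody i 0 (hPline i 0)
  -- The image of the loop contains no node but `f t (P i)`, so both endpoints of the segment
  -- project to this node and differ by an integer vector.
  have hedge : ∀ t i j, ∃ v : Fin 3 → ℤ, v ≠ 0 ∧
      {z | f t (P i) + z ∈ f t '' torusLine (P i) j} = torusDir v := by
    intro t i j
    have he : f t '' torusLine (P i) j ∈ (K t).edges := by
      rw [← hedges t]
      exact ⟨_, ⟨i, j, rfl⟩, rfl⟩
    obtain ⟨a, b, hab, himg, ha, hb, -, -⟩ := (hK t).isSegment _ he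
    have hend : ∀ x, torusProj standardBasis x ∈ f t '' torusLine (P i) j →
        torusProj standardBasis x ∈ (K t).nodes → torusProj standardBasis x = f t (P i) := by
      intro x hx hx'
      rw [← hnodes t] at hx'
      obtain ⟨_, ⟨i', rfl⟩, hi'⟩ := hx'
      obtain ⟨y, hy, hyx⟩ := hx
      have h1 := (hbij t).injOn (hlinebody i j hy) (hPbody i') (hyx.trans hi'.symm)
      have h2 : i' = i := hp.eq_of_mem_torusComp (y := P i')
        (Set.mem_iUnion.2 ⟨j, hPline i' j⟩) (Set.mem_iUnion.2 ⟨j, h1 ▸ hy⟩)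
      rw [← hi', h2]
    have ha' := hend a (by rw [himg]; exact ⟨a, left_mem_segment ℝ _ _, rfl⟩) ha
    have hb' := hend b (by rw [himg]; exact ⟨b, right_mem_segment ℝ _ _, rfl⟩) hb
    obtain ⟨v, rfl⟩ := torusProj_eq_iff.1 (hb'.trans ha'.symm)
    refine ⟨v, ?_, ?_⟩
    · rintro rfl
      simp at hab
    · ext z
      rw [Set.mem_ofPred_eq, himg, ← ha', torusDir_eq_image, segment_eq_image']
      constructor
      · rintro ⟨_, ⟨s, hs, rfl⟩, hz⟩
        refine ⟨s, hs, ?_⟩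
        beta_reduce at hz
        rw [torusProj_add, add_right_inj, add_sub_cancel_left] at hz
        exact hz
      · rintro ⟨s, hs, rfl⟩
        refine ⟨_, ⟨s, hs, rfl⟩, ?_⟩
        beta_reduce
        rw [torusProj_add, add_sub_cancel_left]
  have hline : ∀ t i j, f t '' torusLine (P i) j = torusLine (f t (P i)) j := by
    intro t i j
    set g : I → Set Torus3 := fun t => {z | f t (P i) + z ∈ f t '' torusLine (P i) j} with hg
    have hmem : ∀ t y, y ∈ torusLine (P i) j → f t y - f t (P i) ∈ g t := by
      intro t y hy
      rw [hg, Set.mem_ofPred_eq, add_sub_cancel]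
      exact ⟨y, hy, rfl⟩
    have hconst := eq_of_isClosed_fibers g
      ((Set.countable_range torusDir).mono (by
        rintro _ ⟨t, rfl⟩
        obtain ⟨v, -, hv⟩ := hedge t i j
        exact ⟨v, hv.symm⟩)) (fun t => by
      obtain ⟨v, hv0, hv⟩ := hedge t i j
      -- Since `torusDir w ⊆ torusDir v` already forces equality, the fiber is cut out by closed
      -- conditions, one for each point `y` of the loop.
      have e : {s | g s = g t} = ⋂ y ∈ torusLine (P i) j, {s | f s y - f s (P i) ∈ torusDir v} := by
        ext s
        simp only [Set.mem_iInter, Set.mem_ofPred_eq]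
        constructor
        · intro h y hy
          rw [← hv]
          change _ ∈ g t
          rw [← h]
          exact hmem s y hy
        · intro h
          obtain ⟨w, hw0, hw⟩ := hedge s i j
          change {z | _} = {z | _}
          rw [hv, hw]
          apply torusDir_eq_of_subset hw0
          intro z hz
          rw [← hw] at hz
          obtain ⟨y, hy, hyz⟩ := hz
          have := h y hy
          rwa [hyz, add_sub_cancel_left] at this
      rw [e]
      refine isClosed_biInter fun y hy => (isClosed_torusDir v).preimage ?_
      exact (hcont y (hlinebody i j hy)).sub (hcont _ (hPbody i)))
    ext y
    have h1 : y ∈ f t '' torusLine (P i) j ↔ y - f t (P i) ∈ g t := by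
      rw [hg, Set.mem_ofPred_eq, add_sub_cancel]
    rw [h1, hconst t 0, hg, Set.mem_ofPred_eq, hf0 (hPbody i),
      (hf0.mono (hlinebody i j)).image_eq, id, Set.image_id]
    refine forall_congr' fun c => forall_congr' fun _ => ?_
    rw [Pi.add_apply, Pi.sub_apply, add_eq_left, sub_eq_zero]
  refine ⟨fun t i => f t (P i), fun i => hcont _ (hPbody i), fun i => hf0 (hPbody i), ?_, ?_⟩
  · intro t i i' hii c hc
    -- If two nodes shared the coordinate `c`, mixing their other coordinates as in
    -- `disjoint_pcuNet_iff` would give a common point of two axial circles, against the injectivity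
    -- of `f t`.
    obtain ⟨a, b, hac, hbc, hab⟩ : ∃ a b : Fin 3, a ≠ c ∧ b ≠ c ∧ a ≠ b := by
      clear hc
      revert c; decide
    set y : Torus3 := fun d => if d = b then f t (P i') d else f t (P i) d with hy
    have h1 : y ∈ torusLine (f t (P i)) b := fun d hd => if_neg hd
    have h2 : y ∈ torusLine (f t (P i')) a := by
      intro d hd
      by_cases hdb : d = b
      · exact if_pos hdb
      · have hdc : d = c := by
          clear h1 hy y hc
          revert a b c d; decide
        rw [hy, hdc]
        beta_reduce
        rw [if_neg (hdc ▸ hdb)]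
        exact hc
    rw [← hline] at h1 h2
    obtain ⟨z, hz, hzy⟩ := h1
    obtain ⟨z', hz', hzy'⟩ := h2
    have := (hbij t).injOn (hlinebody _ _ hz) (hlinebody _ _ hz') (hzy.trans hzy'.symm)
    subst this
    exact hii (hp.eq_of_mem_torusComp (Set.mem_iUnion.2 ⟨b, hz⟩) (Set.mem_iUnion.2 ⟨a, hz'⟩))
  · rw [← hK1, ← hnodes 1]
    ext y
    constructor
    · rintro ⟨i, rfl⟩
      exact ⟨P i, ⟨i, rfl⟩, rfl⟩
    · rintro ⟨_, ⟨i, rfl⟩, rfl⟩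
      exact ⟨i, rfl⟩

/-- Lifted to the real line, the coordinates of two moving nodes never differ by an integer, so the
floors of their differences are constant. At the end the lifts are the coordinates of `p'` up to
relabelling and integers. -/
theorem sameOrder_of_linearlyIsotopic {n : ℕ} {p p' : Fin n → Space3} (hp : IsGeneric p)
    (h : LinearlyIsotopic (lgk (gridNet p) standardBasis) (lgk (gridNet p') standardBasis)) :
    SameOrder p p' := by
  obtain ⟨N, hN, hN0, hNne, hN1⟩ := h.exists_point_motion hp
  have hlift : ∀ i c, ∃ Γ : C(I, ℝ), (∀ t, (Γ t : UnitAddCircle) = N t i c) ∧ Γ 0 = p i c := by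
    intro i c
    obtain ⟨Γ, h1, h2⟩ := (AddCircle.isCoveringMap_coe (1 : ℝ)).exists_path_lifts
      ⟨fun t => N t i c, (continuous_apply c).comp (hN i)⟩ (p i c) (by
        simp only [ContinuousMap.coe_mk, hN0, torusProj_standardBasis])
    exact ⟨Γ, fun t => congrFun h1 t, h2⟩
  choose Γ hΓ hΓ0 using hlift
  have hfloor : ∀ i j c, ⌊p i c - p j c⌋ = ⌊Γ i c 1 - Γ j c 1⌋ := by
    intro i j c
    rcases eq_or_ne i j with rfl | hij
    · simp
    rw [← hΓ0, ← hΓ0]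
    refine floor_eq_of_isPreconnected (f := fun t => Γ i c t - Γ j c t) isPreconnected_univ
      ((Γ i c).continuous.sub (Γ j c).continuous).continuousOn ?_ (Set.mem_univ 0) (Set.mem_univ 1)
    intro t _ m hm
    apply hNne t i j hij c
    rw [← hΓ, ← hΓ, unitAddCircle_coe_eq_iff]
    exact ⟨m, by linarith⟩
  have hnode : ∀ i, ∃ i', N 1 i = torusProj standardBasis (p' i') := by
    intro i
    have : N 1 i ∈ (lgk (gridNet p') standardBasis).nodes := hN1 ▸ ⟨i, rfl⟩
    rw [lgk_gridNet] at this
    obtain ⟨i', h⟩ := this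
    exact ⟨i', h.symm⟩
  choose τ hτ using hnode
  have hinj : Function.Injective τ := by
    intro i j hij
    by_contra hne
    exact hNne 1 i j hne 0 (by rw [hτ, hτ, hij])
  have hcoord : ∀ i c, ∃ m : ℤ, Γ i c 1 = p' (τ i) c + m := by
    intro i c
    rw [← unitAddCircle_coe_eq_iff, hΓ, hτ, torusProj_standardBasis]
  choose k hk using hcoord
  refine ⟨Equiv.ofBijective τ (Finite.injective_iff_bijective.1 hinj), k, fun i j c => ?_⟩
  rw [hfloor, hk, hk]
  rfl

/-! ### Rotation automorphisms of the torus. -/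

theorem torusAut_torusProj (X : Matrix (Fin 3) (Fin 3) ℤ) (x : Space3) :
    torusAut X (torusProj standardBasis x) =
      torusProj standardBasis ((X.map (Int.cast : ℤ → ℝ)).mulVec x) := by
  funext c
  rw [torusProj_standardBasis]
  simp only [torusAut, torusProj_standardBasis, Matrix.mulVec, dotProduct, Matrix.map_apply,
    Fin.sum_univ_three, AddCircle.coe_add]
  simp only [← zsmul_eq_mul, AddCircle.coe_zsmul]

theorem lgk_map_torusAut {n : ℕ} {X : Matrix (Fin 3) (Fin 3) ℤ} (hX : IsIntegerRotation X)
    (p : Fin n → Space3) : (lgk (gridNet p) standardBasis).map (torusAut X) =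
      lgk (gridNet (rotConfig X p)) standardBasis := by
  rw [← gridNet_map_rotation hX]
  have e : torusAut X ∘ torusProj standardBasis =
      torusProj standardBasis ∘ (X.map (Int.cast : ℤ → ℝ)).mulVec :=
    funext (torusAut_torusProj X)
  simp only [lgk, LineNet.map, ← Set.image_comp, e]
  congr 1
  congr 1
  funext s
  simp only [Function.comp, ← Set.image_comp]
  exact congrArg (fun g => g '' s) e

/-! ### Isotopy in terms of relative order, and the count of classes. -/

theorem linearlyIsotopic_iff {n : ℕ} {p p' : Fin n → Space3} (hp : IsGeneric p)
    (hp' : IsGeneric p') :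
    LinearlyIsotopic (lgk (gridNet p) standardBasis) (lgk (gridNet p') standardBasis) ↔
      SameOrder p p' :=
  ⟨sameOrder_of_linearlyIsotopic hp, linearlyIsotopic_of_sameOrder hp hp'⟩

theorem rotationallyIsotopic_iff {n : ℕ} {p p' : Fin n → Space3} (hp : IsGeneric p)
    (hp' : IsGeneric p') :
    RotationallyIsotopic (lgk (gridNet p) standardBasis) (lgk (gridNet p') standardBasis) ↔
      ∃ X, IsIntegerRotation X ∧ SameOrder (rotConfig X p) p' := by
  refine exists_congr fun X => and_congr_right fun hX => ?_
  rw [lgk_map_torusAut hX, linearlyIsotopic_iff hp' (hp.rotConfig hX)]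
  exact ⟨SameOrder.symm, SameOrder.symm⟩

theorem periodicallyIsotopic_iff {n : ℕ} {p p' : Fin n → Space3} (hp : IsGeneric p)
    (hp' : IsGeneric p') :
    PeriodicallyIsotopic (gridNet p) (gridNet p') ↔
      ∃ X, IsIntegerRotation X ∧ SameOrder (rotConfig X p') p := by
  constructor
  · intro h
    obtain ⟨X, hX, h⟩ := sameOrder_of_periodicallyIsotopic hp hp' h
    exact ⟨X, hX, h.symm⟩
  · rintro ⟨X, hX, h⟩
    exact periodicallyIsotopic_of_sameOrder hp hp' hX h.symm

/-- Patterns are, up to shifts, patterns of configurations. -/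
theorem exists_orbit_pattern_eq {n : ℕ} (hn : 1 ≤ n) {G : Subgroup (Equiv.Perm (DTorus n))}
    (hG : Subgroup.closure (shiftSet n) ≤ G) {P : Finset (DTorus n)} (hP : P ∈ patterns n) :
    ∃ p : Fin n → Space3, IsGeneric p ∧
      MulAction.orbit G (pattern p) = MulAction.orbit G P := by
  obtain ⟨p, hp, v, hv⟩ := exists_pattern_eq hn hP
  exact ⟨p, hp, (orbit_eq_iff.2
    ⟨Equiv.addRight v, hG (mem_closure_shiftSet.2 ⟨v, fun x => rfl⟩), hv⟩).symm⟩

theorem theorem7p2 (n : ℕ) (hn : 1 ≤ n) :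
    (Equivalence (fun K K' : StandardKnot n => LinearlyIsotopic K.1 K'.1) ∧
      ENat.card (Quot fun K K' : StandardKnot n => LinearlyIsotopic K.1 K'.1)
        = (alphaCount n : ℕ∞)) ∧
    (Equivalence (fun K K' : StandardKnot n => RotationallyIsotopic K.1 K'.1) ∧
      ENat.card (Quot fun K K' : StandardKnot n => RotationallyIsotopic K.1 K'.1)
        = (betaCount n : ℕ∞)) ∧
    (Equivalence (fun N N' : NGrid n => PeriodicallyIsotopic N.1 N'.1) ∧
      ENat.card (Quot fun N N' : NGrid n => PeriodicallyIsotopic N.1 N'.1)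
        = (betaCount n : ℕ∞)) := by
  have hgrid : ∀ N : NGrid n, ∃ p : Fin n → Space3, IsGeneric p ∧ N.1 = gridNet p :=
    fun N => isNGrid_iff.1 N.2
  have hknot : ∀ K : StandardKnot n, ∃ p : Fin n → Space3, IsGeneric p ∧
      K.1 = lgk (gridNet p) standardBasis := by
    rintro ⟨_, N, hN, rfl⟩
    obtain ⟨p, hp, rfl⟩ := isNGrid_iff.1 hN
    exact ⟨p, hp, rfl⟩
  choose p hp hpN using hgrid
  choose q hq hqK using hknot
  have hle : Subgroup.closure (shiftSet n) ≤ Subgroup.closure (shiftSet n ∪ rotationSet n) :=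
    Subgroup.closure_mono Set.subset_union_left
  -- The configuration `q K` is an arbitrary choice. Another one for the same knot gives the same
  -- orbit, because the knot is linearly isotopic to itself.
  have iff_shift : ∀ K (r : Fin n → Space3), IsGeneric r → K.1 = lgk (gridNet r) standardBasis →
      MulAction.orbit (Subgroup.closure (shiftSet n)) (pattern (q K)) =
        MulAction.orbit (Subgroup.closure (shiftSet n)) (pattern r) := by
    intro K r hr hK
    rw [orbit_shift_eq_iff (hq K) hr, ← linearlyIsotopic_iff (hq K) hr, ← hK, hqK K]
    exact (linearlyIsotopic_iff (hq K) (hq K)).2 (SameOrder.refl _)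
  have iff_rot : ∀ K (r : Fin n → Space3), IsGeneric r → K.1 = lgk (gridNet r) standardBasis →
      MulAction.orbit (Subgroup.closure (shiftSet n ∪ rotationSet n)) (pattern (q K)) =
        MulAction.orbit (Subgroup.closure (shiftSet n ∪ rotationSet n)) (pattern r) := by
    intro K r hr hK
    rw [orbit_eq_iff]
    obtain ⟨g, hg, h⟩ := orbit_eq_iff.1 (iff_shift K r hr hK)
    exact ⟨g, hle hg, h⟩
  refine ⟨?_, ?_, ?_⟩
  · refine equivalence_and_card_quot hn (fun K => pattern (q K)) (fun K K' => ?_)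
      (fun K => pattern_mem (hq K)) (fun P hP => ?_)
    · rw [hqK K, hqK K', linearlyIsotopic_iff (hq K) (hq K'), orbit_shift_eq_iff (hq K) (hq K')]
    · obtain ⟨r, hr, h⟩ := exists_orbit_pattern_eq hn le_rfl hP
      exact ⟨⟨_, gridNet r, isNGrid_iff.2 ⟨r, hr, rfl⟩, rfl⟩, (iff_shift _ r hr rfl).trans h⟩
  · refine equivalence_and_card_quot hn (fun K => pattern (q K)) (fun K K' => ?_)
      (fun K => pattern_mem (hq K)) (fun P hP => ?_)
    · rw [hqK K, hqK K', rotationallyIsotopic_iff (hq K) (hq K'),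
        orbit_rot_eq_iff hn (hq K) (hq K')]
    · obtain ⟨r, hr, h⟩ := exists_orbit_pattern_eq hn hle hP
      exact ⟨⟨_, gridNet r, isNGrid_iff.2 ⟨r, hr, rfl⟩, rfl⟩, (iff_rot _ r hr rfl).trans h⟩
  · refine equivalence_and_card_quot hn (fun N => pattern (p N)) (fun N N' => ?_)
      (fun N => pattern_mem (hp N)) (fun P hP => ?_)
    · rw [hpN N, hpN N', periodicallyIsotopic_iff (hp N) (hp N'), eq_comm,
        orbit_rot_eq_iff hn (hp N') (hp N)]
    · obtain ⟨r, hr, h⟩ := exists_orbit_pattern_eq hn hle hP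
      refine ⟨⟨gridNet r, isNGrid_iff.2 ⟨r, hr, rfl⟩⟩, Eq.trans ?_ h⟩
      set N : NGrid n := ⟨gridNet r, isNGrid_iff.2 ⟨r, hr, rfl⟩⟩ with hN
      -- The configurations `r` and `p N` describe the same grid, hence the same knot; both are
      -- compared with the one chosen for this knot.
      have h1 := iff_shift ⟨_, gridNet r, isNGrid_iff.2 ⟨r, hr, rfl⟩, rfl⟩ r hr rfl
      have h2 := iff_shift ⟨_, gridNet r, isNGrid_iff.2 ⟨r, hr, rfl⟩, rfl⟩ (p N) (hp N)
        (by rw [← hpN N])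
      obtain ⟨g, hg, h⟩ := orbit_eq_iff.1 (h2.symm.trans h1)
      exact orbit_eq_iff.2 ⟨g, hle hg, h⟩
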